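/- Let $D=(V,A)$ be a connected directed graph with $n$ nodes and $m$ arcs, without loops, parallel arcs or anti-parallel arcs, with integer capacity bounds $l_a\ge 0$, $u_a\ge 0$ ($a\in A$), integer node balances $b_i$ ($i\in V$) and real arc costs $c_a$. A feasible flow is a function $x:A\to\mathbb{R}_{\ge 0}$ with $l\le x\le u$ and $\sum_{j:(i,j)\in A}x_{ij}-\sum_{j:(j,i)\in A}x_{ji}=b_i$ for all $i\in V$; it is optimal if it minimizes $\sum_a c_ax_a$ among all feasible flows. Assume that an optimal integer flow exists and let $F$ be the number of optimal integer flows. A node potential $y\in\mathbb{R}^V$ with reduced costs $\overline c_{ij}=c_{ij}+y_i-y_j$ is optimal if it satisfies, together with some optimal flow $x$, the complementary slackness conditions: $\overline c_a>0$ implies $x_a=l_a$, and $\overline c_a<0$ implies $x_a=u_a$. Algorithm FindAllOptimalFlows$(f,\overline c,D)$ is the following recursive procedure. Let $D'_f$ be the residual graph, with respect to $f$, of the subnetwork of the arcs with $\overline c_a=0$: it has the arc $(i,j)$ for each such arc $a=(i,j)$ of $A$ with $f_a<u_a$ and the arc $(j,i)$ for each such $a$ with $f_a>l_a$. Build a depth-first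 search forest of $D'_f$. A backward arc $(i,j)$ is short if $j$ is the predecessor of $i$, and long otherwise. Look for a cycle $C$ of one of the following kinds, in this order: a long backward arc $(i,j)$ with the tree path from $j$ to $i$; a forward arc $(i,j)$ with a path of short backward arcs from $j$ to $i$; a cross arc $(i,j)$ with a path of short backward arcs from $j$ to the first common ancestor $a$ of $i$ and $j$ and the tree path from $a$ to $i$. If there is none, return. Otherwise augment $f$ by one unit along $C$ to obtain $f^*$, print $f^*$, and choose an arc $a$ with $f_a\ne f^*_a$. If $f_a<f^*_a$, call the procedure for $f$ with $u_a$ replaced by $f_a$ and then for $f^*$ with $l_a$ replaced by $f_a+1$; if $f_a>f^*_a$, call it for $f$ with $l_a$ replaced by $f_a$ and then for $f^*$ with $u_a$ replaced by $f_a-1$. Running times are measured on a unit-cost random access machine with integer and real memory, whose arithmetic operations are addition, subtraction and comparison; all constants are absolute. **Theorem.** Let $f$ be an optimal integer flow. 1. If $\overline c$ are the reduced costs of an optimal node potential, then, for all choices of the depth-first search forests, of the cycles and of the arcs $a$, the given flow $f$ followed by the flows printed by a completed run of FindAllOptimalFlows$(f,\overline c,D)$ is a list that contains every optimal integer flow exactly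 once and nothing else. 2. Given $D$, $f$ and $\overline c$ as in 1, the algorithm can be implemented so that it halts and outputs this list in $O(F(m+n))$ time. 3. If only $D$ is given and $f$ is computed by an arbitrary program in $M$ steps, then computing an optimal node potential and running the algorithm afterwards gives a program that outputs all optimal integer flows, each exactly once, in $O(F(m+n)+mn+M)$ time overall. -/

import Mathlib

namespace AOF

/-! ### Networks, flows, potentials -/

/-- The data of a flow network on the nodes `0, …, n-1` with the arcs `0, …, m-1`: arc `a` leads
from `tail a` to `head a`, has lower and upper capacity `lo a`, `up a` and cost `c a`;
`b i` is the flow balance of node `i`. -/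
structure Network (n m : ℕ) where
  tail : Fin m → Fin n
  head : Fin m → Fin n
  lo : Fin m → ℤ
  up : Fin m → ℤ
  b : Fin n → ℤ
  c : Fin m → ℝ

variable {n m : ℕ}

/-- The standing assumptions on a network: it is a connected directed graph (no two arcs join the
same ordered pair of nodes) without anti-parallel arcs (hence without loops), and the capacity
bounds are non-negative. -/
structure Network.Admissible (N : Network n m) : Prop where
  simple : ∀ a a' : Fin m, N.tail a = N.tail a' → N.head a = N.head a' → a = a'
  no_antiparallel : ∀ a a' : Fin m, ¬ (N.tail a = N.head a' ∧ N.head a = N.tail a')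
  connected : (SimpleGraph.fromRel (fun i j => ∃ a, N.tail a = i ∧ N.head a = j)).Connected
  lo_nonneg : ∀ a, 0 ≤ N.lo a
  up_nonneg : ∀ a, 0 ≤ N.up a

/-- Feasible (real) `b`-flows. -/
structure Network.IsFlow (N : Network n m) (x : Fin m → ℝ) : Prop where
  lo_le : ∀ a, (N.lo a : ℝ) ≤ x a
  le_up : ∀ a, x a ≤ (N.up a : ℝ)
  balance : ∀ i, (∑ a with N.tail a = i, x a) - (∑ a with N.head a = i, x a) = (N.b i : ℝ)

/-- The cost of a flow. -/
noncomputable def Network.cost (N : Network n m) (x : Fin m → ℝ) : ℝ := ∑ a, N.c a * x a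

/-- Minimum cost (optimal) flows. -/
def Network.IsOptimal (N : Network n m) (x : Fin m → ℝ) : Prop :=
  N.IsFlow x ∧ ∀ x', N.IsFlow x' → N.cost x ≤ N.cost x'

/-- Optimal integer flows: integer-valued functions on the arcs that are minimum cost flows. -/
def Network.IsOptInt (N : Network n m) (f : Fin m → ℤ) : Prop :=
  N.IsOptimal (fun a => (f a : ℝ))

/-- The number `F` of optimal integer flows. -/
noncomputable def Network.numOpt (N : Network n m) : ℕ := {f : Fin m → ℤ | N.IsOptInt f}.ncard

/-- The reduced costs of the arcs for the node potential `y`. -/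
def Network.reducedCost (N : Network n m) (y : Fin n → ℝ) (a : Fin m) : ℝ :=
  N.c a + y (N.tail a) - y (N.head a)

/-- Optimal node potentials: those that satisfy the complementary slackness optimality conditions
together with some minimum cost flow. -/
def Network.IsOptPotential (N : Network n m) (y : Fin n → ℝ) : Prop :=
  ∃ x, N.IsOptimal x ∧
    ∀ a, (0 < N.reducedCost y a → x a = N.lo a) ∧ (N.reducedCost y a < 0 → x a = N.up a)

/-! ### Depth-first search forests -/

section Forest

variable {V : Type*}

/-- A configuration of a depth-first search: the visited nodes, the stack of active nodes and the
predecessors `π` found so far. -/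
structure DFSState (V : Type*) where
  visited : Finset V
  stack : List V
  pred : V → Option V

/-- One step of a depth-first search of the directed graph with arc relation `R`. -/
inductive DFSStep [DecidableEq V] (R : V → V → Prop) : DFSState V → DFSState V → Prop
  | root (vis : Finset V) (π : V → Option V) (v : V) :
      v ∉ vis → DFSStep R ⟨vis, [], π⟩ ⟨insert v vis, [v], π⟩
  | advance (vis : Finset V) (π : V → Option V) (s : List V) (v w : V) :
      R v w → w ∉ vis →
      DFSStep R ⟨vis, v :: s, π⟩ ⟨insert w vis, w :: v :: s, Function.update π w (some v)⟩
  | retreat (vis : Finset V) (π : V → Option V) (s : List V) (v : V) :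
      (∀ w, R v w → w ∈ vis) → DFSStep R ⟨vis, v :: s, π⟩ ⟨vis, s, π⟩

/-- `π` is the predecessor function of a DFS-forest of the directed graph `R`, i.e. the outcome of
a complete depth-first search (`π v = none` at the roots). -/
def IsDFSForest [DecidableEq V] [Fintype V] (R : V → V → Prop) (π : V → Option V) : Prop :=
  Relation.ReflTransGen (DFSStep R) ⟨∅, [], fun _ => none⟩ ⟨Finset.univ, [], π⟩

/-- Tree arcs of the forest `π`. -/
def TreeArc (π : V → Option V) (i j : V) : Prop := π j = some i

/-- `a` is an ancestor of `v` (or equal to it). -/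
def Ancestor (π : V → Option V) (a v : V) : Prop := Relation.ReflTransGen (TreeArc π) a v

/-- Short backward arcs: arcs from a node to its predecessor. -/
def ShortBackArc (R : V → V → Prop) (π : V → Option V) (i j : V) : Prop := R i j ∧ π i = some j

/-- Long backward arcs: arcs to an ancestor other than the predecessor. -/
def LongBackArc (R : V → V → Prop) (π : V → Option V) (i j : V) : Prop :=
  R i j ∧ Ancestor π j i ∧ π i ≠ some j

/-- Forward arcs: non-tree arcs to a descendant. -/
def ForwardArc (R : V → V → Prop) (π : V → Option V) (i j : V) : Prop :=
  R i j ∧ Ancestor π i j ∧ ¬ TreeArc π i j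

/-- Cross arcs: all other arcs. -/
def CrossArc (R : V → V → Prop) (π : V → Option V) (i j : V) : Prop :=
  R i j ∧ ¬ Ancestor π i j ∧ ¬ Ancestor π j i

/-- `a` is the first (lowest) common ancestor of `i` and `j`. -/
def FirstCommonAncestor (π : V → Option V) (i j a : V) : Prop :=
  Ancestor π a i ∧ Ancestor π a j ∧ ∀ a', Ancestor π a' i → Ancestor π a' j → Ancestor π a' a

/-- `P` lists the nodes of a directed path from `x` to `y` with arcs in `R`. -/
def IsPathFromTo (R : V → V → Prop) (x y : V) (P : List V) : Prop :=
  P.head? = some x ∧ P.getLast? = some y ∧ P.IsChain R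

/-- The proper backward cycles: a long backward arc `(i, j)` and the tree path from `j` to `i`.
A cycle is given by the list of its nodes; the arc from the last node to the first closes it. -/
def IsBackwardCycle (R : V → V → Prop) (π : V → Option V) (C : List V) : Prop :=
  ∃ i j, LongBackArc R π i j ∧ IsPathFromTo (TreeArc π) j i C

/-- The proper forward cycles: a forward arc `(i, j)` and a path of short backward arcs from `j`
to `i`. -/
def IsForwardCycle (R : V → V → Prop) (π : V → Option V) (C : List V) : Prop :=
  ∃ i j, ForwardArc R π i j ∧ IsPathFromTo (ShortBackArc R π) j i C

/-- The proper cross cycles: a cross arc `(i, j)`, a path of short backward arcs from `j` to the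
first common ancestor `a` of `i` and `j`, and the tree path from `a` to `i`. -/
def IsCrossCycle (R : V → V → Prop) (π : V → Option V) (C : List V) : Prop :=
  ∃ i j a P Q, CrossArc R π i j ∧ FirstCommonAncestor π i j a ∧
    IsPathFromTo (ShortBackArc R π) j a P ∧ IsPathFromTo (TreeArc π) a i Q ∧ C = P ++ Q.tail

/-- The arcs that the cycle `C` traverses. -/
def cycleArcs (C : List V) : List (V × V) := C.zip (C.rotate 1)

end Forest

/-! ### The algorithm -/

/-- The arcs of the residual graph, with respect to `f`, of the network that is reduced to the arcs
with reduced cost `cbar a = 0`. -/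
def Network.ResArc (N : Network n m) (cbar : Fin m → ℝ) (f : Fin m → ℤ) (i j : Fin n) : Prop :=
  ∃ a, cbar a = 0 ∧ ((N.tail a = i ∧ N.head a = j ∧ f a < N.up a) ∨
    (N.head a = i ∧ N.tail a = j ∧ N.lo a < f a))

/-- The directed incidence vector of a cycle. -/
def Network.chi (N : Network n m) (C : List (Fin n)) (a : Fin m) : ℤ :=
  if (N.tail a, N.head a) ∈ cycleArcs C then 1
  else if (N.head a, N.tail a) ∈ cycleArcs C then -1
  else 0

/-- The flow `f` augmented by one unit along a cycle of the reduced network; it keeps the values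
of `f` on the arcs outside the reduced network. -/
noncomputable def Network.augment (N : Network n m) (cbar : Fin m → ℝ) (f : Fin m → ℤ)
    (C : List (Fin n)) (a : Fin m) : ℤ :=
  if cbar a = 0 then f a + N.chi C a else f a

/-- `FindAnotherOptimalFlow(f, cbar, D)` may return the given result (`none` if it finds no other
flow): it builds a DFS-forest of the residual graph of the reduced network and looks for a proper
backward cycle, then for a proper forward cycle, then for a proper cross cycle. -/
inductive FindAnotherOptimalFlow (N : Network n m) (cbar : Fin m → ℝ) (f : Fin m → ℤ) :
    Option (Fin m → ℤ) → Prop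
  | backward (π : Fin n → Option (Fin n)) (C : List (Fin n)) :
      IsDFSForest (N.ResArc cbar f) π →
      IsBackwardCycle (N.ResArc cbar f) π C →
      FindAnotherOptimalFlow N cbar f (some (N.augment cbar f C))
  | forward (π : Fin n → Option (Fin n)) (C : List (Fin n)) :
      IsDFSForest (N.ResArc cbar f) π →
      (∀ C', ¬ IsBackwardCycle (N.ResArc cbar f) π C') →
      IsForwardCycle (N.ResArc cbar f) π C →
      FindAnotherOptimalFlow N cbar f (some (N.augment cbar f C))
  | cross (π : Fin n → Option (Fin n)) (C : List (Fin n)) :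
      IsDFSForest (N.ResArc cbar f) π →
      (∀ C', ¬ IsBackwardCycle (N.ResArc cbar f) π C') →
      (∀ C', ¬ IsForwardCycle (N.ResArc cbar f) π C') →
      IsCrossCycle (N.ResArc cbar f) π C →
      FindAnotherOptimalFlow N cbar f (some (N.augment cbar f C))
  | null (π : Fin n → Option (Fin n)) :
      IsDFSForest (N.ResArc cbar f) π →
      (∀ C', ¬ IsBackwardCycle (N.ResArc cbar f) π C') →
      (∀ C', ¬ IsForwardCycle (N.ResArc cbar f) π C') →
      (∀ C', ¬ IsCrossCycle (N.ResArc cbar f) π C') →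
      FindAnotherOptimalFlow N cbar f none

/-- The network with the upper capacity of the arc `a` replaced by `z`. -/
def Network.setUp (N : Network n m) (a : Fin m) (z : ℤ) : Network n m :=
  { N with up := Function.update N.up a z }

/-- The network with the lower capacity of the arc `a` replaced by `z`. -/
def Network.setLo (N : Network n m) (a : Fin m) (z : ℤ) : Network n m :=
  { N with lo := Function.update N.lo a z }

/-- `FindAllOptimalFlows cbar N f L`: the algorithm `FindAllOptimalFlows(f, cbar, D)`, called on
the network `N`, has a run that prints the flows in the list `L`, in this order. The algorithm is
free in its choice of the DFS-forests, of the cycles and of the arcs `a` at which it branches. -/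
inductive FindAllOptimalFlows (cbar : Fin m → ℝ) :
    Network n m → (Fin m → ℤ) → List (Fin m → ℤ) → Prop
  | halt (N : Network n m) (f : Fin m → ℤ) :
      FindAnotherOptimalFlow N cbar f none → FindAllOptimalFlows cbar N f []
  | branch_up (N : Network n m) (f g : Fin m → ℤ) (a : Fin m) (L₁ L₂ : List (Fin m → ℤ)) :
      FindAnotherOptimalFlow N cbar f (some g) → f a < g a →
      FindAllOptimalFlows cbar (N.setUp a (f a)) f L₁ →
      FindAllOptimalFlows cbar (N.setLo a (f a + 1)) g L₂ →
      FindAllOptimalFlows cbar N f (g :: (L₁ ++ L₂))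
  | branch_down (N : Network n m) (f g : Fin m → ℤ) (a : Fin m) (L₁ L₂ : List (Fin m → ℤ)) :
      FindAnotherOptimalFlow N cbar f (some g) → g a < f a →
      FindAllOptimalFlows cbar (N.setLo a (f a)) f L₁ →
      FindAllOptimalFlows cbar (N.setUp a (f a - 1)) g L₂ →
      FindAllOptimalFlows cbar N f (g :: (L₁ ++ L₂))

/-! ### The machine model

A unit-cost random access machine, programmed in a structured language. It has integer variables,
integer arrays and real arrays (with indirect addressing), a read-only input that consists of
integer and real arrays, and an output tape for integers. Integers and reals can be added,
subtracted and compared; every operation, memory access, assignment and test counts one step. -/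

/-- The read-only input: integer arrays and real arrays. -/
structure Input where
  int : ℕ → ℤ → ℤ
  real : ℕ → ℤ → ℝ

/-- The memory and the output tape of the machine. -/
structure State where
  var : ℕ → ℤ
  arr : ℕ → ℤ → ℤ
  rarr : ℕ → ℤ → ℝ
  out : List ℤ

/-- Initially the memory is zero and the output is empty. -/
def State.init : State := ⟨fun _ => 0, fun _ _ => 0, fun _ _ => 0, []⟩

/-- Overwrite an integer variable. -/
def State.setVar (σ : State) (x : ℕ) (z : ℤ) : State :=
  { σ with var := Function.update σ.var x z }

/-- Overwrite an entry of an integer array. -/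
def State.setArr (σ : State) (k : ℕ) (i z : ℤ) : State :=
  { σ with arr := Function.update σ.arr k (Function.update (σ.arr k) i z) }

/-- Overwrite an entry of a real array. -/
def State.setReal (σ : State) (k : ℕ) (i : ℤ) (r : ℝ) : State :=
  { σ with rarr := Function.update σ.rarr k (Function.update (σ.rarr k) i r) }

/-- Append an integer to the output. -/
def State.append (σ : State) (z : ℤ) : State :=
  { σ with out := σ.out ++ [z] }

/-- Integer expressions. -/
inductive IExpr
  | const (z : ℤ)
  | var (x : ℕ)
  | arr (k : ℕ) (i : IExpr)
  | inp (k : ℕ) (i : IExpr)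
  | add (e₁ e₂ : IExpr)
  | sub (e₁ e₂ : IExpr)

def IExpr.eval (I : Input) (σ : State) : IExpr → ℤ
  | const z => z
  | var x => σ.var x
  | arr k i => σ.arr k (i.eval I σ)
  | inp k i => I.int k (i.eval I σ)
  | add e₁ e₂ => e₁.eval I σ + e₂.eval I σ
  | sub e₁ e₂ => e₁.eval I σ - e₂.eval I σ

def IExpr.steps : IExpr → ℕ
  | const _ => 1
  | var _ => 1
  | arr _ i => i.steps + 1
  | inp _ i => i.steps + 1
  | add e₁ e₂ => e₁.steps + e₂.steps + 1
  | sub e₁ e₂ => e₁.steps + e₂.steps + 1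

/-- Real expressions. The only real constant is `0`. -/
inductive RExpr
  | zero
  | arr (k : ℕ) (i : IExpr)
  | inp (k : ℕ) (i : IExpr)
  | add (e₁ e₂ : RExpr)
  | sub (e₁ e₂ : RExpr)

noncomputable def RExpr.eval (I : Input) (σ : State) : RExpr → ℝ
  | zero => 0
  | arr k i => σ.rarr k (i.eval I σ)
  | inp k i => I.real k (i.eval I σ)
  | add e₁ e₂ => e₁.eval I σ + e₂.eval I σ
  | sub e₁ e₂ => e₁.eval I σ - e₂.eval I σ

def RExpr.steps : RExpr → ℕ
  | zero => 1
  | arr _ i => i.steps + 1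
  | inp _ i => i.steps + 1
  | add e₁ e₂ => e₁.steps + e₂.steps + 1
  | sub e₁ e₂ => e₁.steps + e₂.steps + 1

/-- Tests. -/
inductive BExpr
  | ile (e₁ e₂ : IExpr)
  | rle (e₁ e₂ : RExpr)
  | neg (t : BExpr)
  | conj (t₁ t₂ : BExpr)

def BExpr.holds (I : Input) (σ : State) : BExpr → Prop
  | ile e₁ e₂ => e₁.eval I σ ≤ e₂.eval I σ
  | rle e₁ e₂ => e₁.eval I σ ≤ e₂.eval I σ
  | neg t => ¬ t.holds I σ
  | conj t₁ t₂ => t₁.holds I σ ∧ t₂.holds I σ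

def BExpr.steps : BExpr → ℕ
  | ile e₁ e₂ => e₁.steps + e₂.steps + 1
  | rle e₁ e₂ => e₁.steps + e₂.steps + 1
  | neg t => t.steps + 1
  | conj t₁ t₂ => t₁.steps + t₂.steps + 1

/-- Programs. -/
inductive Prog
  | skip
  | assign (x : ℕ) (e : IExpr)
  | store (k : ℕ) (i e : IExpr)
  | rstore (k : ℕ) (i : IExpr) (e : RExpr)
  | emit (e : IExpr)
  | seq (p q : Prog)
  | cond (t : BExpr) (p q : Prog)
  | loop (t : BExpr) (p : Prog)

/-- `Exec I p σ σ' k`: on the input `I`, the program `p`, started in the state `σ`, halts after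
exactly `k` steps in the state `σ'`. -/
inductive Exec (I : Input) : Prog → State → State → ℕ → Prop
  | skip (σ : State) : Exec I .skip σ σ 1
  | assign (σ : State) (x : ℕ) (e : IExpr) :
      Exec I (.assign x e) σ (σ.setVar x (e.eval I σ)) (e.steps + 1)
  | store (σ : State) (k : ℕ) (i e : IExpr) :
      Exec I (.store k i e) σ (σ.setArr k (i.eval I σ) (e.eval I σ)) (i.steps + e.steps + 1)
  | rstore (σ : State) (k : ℕ) (i : IExpr) (e : RExpr) :
      Exec I (.rstore k i e) σ (σ.setReal k (i.eval I σ) (e.eval I σ)) (i.steps + e.steps + 1)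
  | emit (σ : State) (e : IExpr) :
      Exec I (.emit e) σ (σ.append (e.eval I σ)) (e.steps + 1)
  | seq (σ σ₁ σ₂ : State) (p q : Prog) (k₁ k₂ : ℕ) :
      Exec I p σ σ₁ k₁ → Exec I q σ₁ σ₂ k₂ → Exec I (.seq p q) σ σ₂ (k₁ + k₂)
  | cond_true (σ σ' : State) (t : BExpr) (p q : Prog) (k : ℕ) :
      t.holds I σ → Exec I p σ σ' k → Exec I (.cond t p q) σ σ' (t.steps + 1 + k)
  | cond_false (σ σ' : State) (t : BExpr) (p q : Prog) (k : ℕ) :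
      ¬ t.holds I σ → Exec I q σ σ' k → Exec I (.cond t p q) σ σ' (t.steps + 1 + k)
  | loop_done (σ : State) (t : BExpr) (p : Prog) :
      ¬ t.holds I σ → Exec I (.loop t p) σ σ (t.steps + 1)
  | loop_step (σ σ₁ σ₂ : State) (t : BExpr) (p : Prog) (k₁ k₂ : ℕ) :
      t.holds I σ → Exec I p σ σ₁ k₁ → Exec I (.loop t p) σ₁ σ₂ k₂ →
      Exec I (.loop t p) σ σ₂ (t.steps + 1 + k₁ + k₂)

/-! ### Input and output formats -/

/-- A finite vector as an array, continued by `0`. -/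
def toArr {α : Type*} [Zero α] {k : ℕ} (v : Fin k → α) (z : ℤ) : α :=
  if h : z.toNat < k ∧ 0 ≤ z then v ⟨z.toNat, h.1⟩ else 0

/-- The input for a network, an integer vector `f` and a real vector `r` on its arcs.
Integer arrays: `n, m`; tails; heads; lower capacities; upper capacities; balances; `f`.
Real arrays: costs; `r`. -/
def Network.encodeWith (N : Network n m) (f : Fin m → ℤ) (r : Fin m → ℝ) : Input where
  int k := match k with
    | 0 => toArr ![(n : ℤ), (m : ℤ)]
    | 1 => toArr (fun a => ((N.tail a : ℕ) : ℤ))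
    | 2 => toArr (fun a => ((N.head a : ℕ) : ℤ))
    | 3 => toArr N.lo
    | 4 => toArr N.up
    | 5 => toArr N.b
    | 6 => toArr f
    | _ => fun _ => 0
  real k := match k with
    | 0 => toArr N.c
    | 1 => toArr r
    | _ => fun _ => 0

/-- The input that consists of a network only. -/
def Network.encode (N : Network n m) : Input := N.encodeWith 0 0

/-- The contents of the output tape once the flows of `L` are printed, each as the sequence of its
values on the arcs `0, …, m-1`. -/
def printed (L : List (Fin m → ℤ)) : List ℤ := L.flatMap List.ofFn

end AOF

/-!
By complementary slackness, the optimal integer flows are the feasible integer flows that agree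
with `f` on the arcs of nonzero reduced cost (`Network.isOptInt_iff`). The difference of two of
them is a circulation in the residual graph of the arcs of zero reduced cost, so the procedure has
to decide whether that graph carries a circulation that does not use both `(i, j)` and `(j, i)`.

*Proper cycles.* A depth-first search forest has a numbering, from which the kind of every arc can
be read off. Suppose that a nonempty set of residual arcs, without antiparallel pairs, has an arc
into the source of each of its arcs. Take the node that finishes last among those it meets, and
follow its arcs backwards from there, as long as they are short backward arcs. The next arc, which
exists because the tree is finite, is a long backward, a forward or a cross arc, and closes one of
the three kinds of cycles (`IsNumbering.no_circulation`). Conversely, such a cycle is simple and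
uses no arc together with its reversal, so augmenting along it gives a different flow
(`FindAnotherOptimalFlow.spec`). The two recursive calls partition the flows according to their
value on an arc where the two flows differ, and each part contains one of the two; hence every run
lists every flow exactly once (`FindAllOptimalFlows.enumerates`).

*Running time.* The recursion tree is binary with `F` leaves, so that there are `2F - 1` calls.
The program keeps the pending calls on a stack; its main loop is analysed by giving a call with
`k` flows the credit `2k - 1` (`HaltsIn.loop`, `enumProg_spec`, `findAllProg_spec`). A single call
takes time `O(m + n)` (`callProg_spec`): the search is linear (`dfsProg_spec`) and also records,
for every node, the highest ancestor to which it climbs along short backward arcs. An arc `(i, j)`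
that is neither a tree arc nor a short backward arc closes a cycle of one of the three kinds if
and only if the recorded ancestor of `j` is an ancestor of `i`, which the numbering decides in
constant time.

*The potential.* A closed residual walk has nonnegative cost, since otherwise a small amount of
flow sent around it would improve `f` (`Network.IsOptInt.closed_walk_nonneg`). Every walk can
therefore be shortened to a bounded number of arcs without raising its cost (`Walk.exists_short`),
and the labels of the Bellman–Ford algorithm, started at `0`, are stable after `n` rounds. Stable
labels satisfy the complementary slackness conditions together with `f`
(`Network.IsOptInt.isOptPotential`).
-/

namespace AOF

/-! ### Total correctness with time bounds for the machine -/

/-- On the input `I`, the program `p`, started in `σ`, halts within `T` steps in a state that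
satisfies `Q`. The time bounds proved with it are generous: only their order of growth matters. -/
def HaltsIn (I : Input) (p : Prog) (σ : State) (T : ℕ) (Q : State → Prop) : Prop :=
  ∃ σ' k, Exec I p σ σ' k ∧ k ≤ T ∧ Q σ'

theorem HaltsIn.mono {I : Input} {p : Prog} {σ : State} {T T' : ℕ} {Q Q' : State → Prop}
    (h : HaltsIn I p σ T Q) (hT : T ≤ T') (hQ : ∀ σ', Q σ' → Q' σ') : HaltsIn I p σ T' Q' := by
  obtain ⟨σ', k, h1, h2, h3⟩ := h
  exact ⟨σ', k, h1, h2.trans hT, hQ _ h3⟩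

theorem HaltsIn.seq {I : Input} {p q : Prog} {σ : State} {T₁ T₂ : ℕ} {Q : State → Prop}
    (h : HaltsIn I p σ T₁ (fun σ₁ => HaltsIn I q σ₁ T₂ Q)) :
    HaltsIn I (.seq p q) σ (T₁ + T₂) Q := by
  obtain ⟨σ₁, k₁, h1, h2, σ₂, k₂, h3, h4, h5⟩ := h
  exact ⟨σ₂, k₁ + k₂, .seq _ _ _ _ _ _ _ h1 h3, by omega, h5⟩

theorem HaltsIn.cond {I : Input} {t : BExpr} {p q : Prog} {σ : State} {T : ℕ} {Q : State → Prop}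
    (h1 : t.holds I σ → HaltsIn I p σ T Q) (h2 : ¬ t.holds I σ → HaltsIn I q σ T Q) :
    HaltsIn I (.cond t p q) σ (t.steps + 1 + T) Q := by
  by_cases ht : t.holds I σ
  · obtain ⟨σ', k, h3, h4, h5⟩ := h1 ht
    exact ⟨σ', _, .cond_true _ _ _ _ _ _ ht h3, by omega, h5⟩
  · obtain ⟨σ', k, h3, h4, h5⟩ := h2 ht
    exact ⟨σ', _, .cond_false _ _ _ _ _ _ ht h3, by omega, h5⟩

/-- The weakest precondition of a program without loops. -/
def Prog.wp (I : Input) : Prog → (State → Prop) → State → Prop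
  | .skip, Q, σ => Q σ
  | .assign x e, Q, σ => Q (σ.setVar x (e.eval I σ))
  | .store k i e, Q, σ => Q (σ.setArr k (i.eval I σ) (e.eval I σ))
  | .rstore k i e, Q, σ => Q (σ.setReal k (i.eval I σ) (e.eval I σ))
  | .emit e, Q, σ => Q (σ.append (e.eval I σ))
  | .seq p q, Q, σ => p.wp I (q.wp I Q) σ
  | .cond t p q, Q, σ => (t.holds I σ → p.wp I Q σ) ∧ (¬ t.holds I σ → q.wp I Q σ)
  | .loop _ _, _, _ => False

/-- A bound on the number of steps of a program without loops. -/
def Prog.cost : Prog → ℕ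
  | .skip => 1
  | .assign _ e => e.steps + 1
  | .store _ i e => i.steps + e.steps + 1
  | .rstore _ i e => i.steps + e.steps + 1
  | .emit e => e.steps + 1
  | .seq p q => p.cost + q.cost
  | .cond t p q => t.steps + 1 + (p.cost + q.cost)
  | .loop _ _ => 0

theorem HaltsIn.of_wp {I : Input} {p : Prog} {σ : State} {Q : State → Prop}
    (h : p.wp I Q σ) : HaltsIn I p σ p.cost Q := by
  induction p generalizing σ Q with
  | skip => exact ⟨_, _, .skip _, le_rfl, h⟩
  | assign x e => exact ⟨_, _, .assign _ _ _, le_rfl, h⟩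
  | store k i e => exact ⟨_, _, .store _ _ _ _, le_rfl, h⟩
  | rstore k i e => exact ⟨_, _, .rstore _ _ _ _, le_rfl, h⟩
  | emit e => exact ⟨_, _, .emit _ _, le_rfl, h⟩
  | seq p q ihp ihq => exact HaltsIn.seq ((ihp h).mono le_rfl fun σ' h' => ihq h')
  | cond t p q ihp ihq =>
    exact HaltsIn.cond (fun ht => (ihp (h.1 ht)).mono (Nat.le_add_right _ _) fun _ h => h)
      (fun ht => (ihq (h.2 ht)).mono (Nat.le_add_left _ _) fun _ h => h)
  | loop t p => exact h.elim

theorem HaltsIn.of_wp_le {I : Input} {p : Prog} {σ : State} {T : ℕ} {Q : State → Prop}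
    (hT : p.cost ≤ T) (h : p.wp I Q σ) : HaltsIn I p σ T Q :=
  (HaltsIn.of_wp h).mono hT fun _ h => h

/-- Sequential composition: the second part may use the time that the first one leaves. -/
theorem HaltsIn.chain {I : Input} {p q : Prog} {σ : State} {T T₁ : ℕ} {Q₁ Q : State → Prop}
    (h : HaltsIn I p σ T₁ Q₁) (hT : T₁ ≤ T)
    (h' : ∀ σ₁, Q₁ σ₁ → HaltsIn I q σ₁ (T - T₁) Q) : HaltsIn I (.seq p q) σ T Q :=
  (HaltsIn.seq (h.mono le_rfl h')).mono (by omega) fun _ h => h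

/-- Sequential composition whose first part contains no loop. -/
theorem HaltsIn.seq_wp {I : Input} {p q : Prog} {σ : State} {T : ℕ} {Q : State → Prop}
    (h : p.wp I (fun σ₁ => HaltsIn I q σ₁ T Q) σ) : HaltsIn I (.seq p q) σ (p.cost + T) Q :=
  HaltsIn.seq (HaltsIn.of_wp h)

/-- The program does not assign the integer variable `x`. This and the following three are
Boolean, so that they are decided by evaluation for a given program. -/
def Prog.keepsVar (x : ℕ) : Prog → Bool
  | .assign y _ => y != x
  | .seq p q => p.keepsVar x && q.keepsVar x
  | .cond _ p q => p.keepsVar x && q.keepsVar x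
  | .loop _ p => p.keepsVar x
  | _ => true

/-- The program does not write to the integer array `k`. -/
def Prog.keepsArr (k : ℕ) : Prog → Bool
  | .store l _ _ => l != k
  | .seq p q => p.keepsArr k && q.keepsArr k
  | .cond _ p q => p.keepsArr k && q.keepsArr k
  | .loop _ p => p.keepsArr k
  | _ => true

/-- The program does not write to the real array `k`. -/
def Prog.keepsReal (k : ℕ) : Prog → Bool
  | .rstore l _ _ => l != k
  | .seq p q => p.keepsReal k && q.keepsReal k
  | .cond _ p q => p.keepsReal k && q.keepsReal k
  | .loop _ p => p.keepsReal k
  | _ => true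

/-- The program does not write to the output tape. -/
def Prog.keepsOut : Prog → Bool
  | .emit _ => false
  | .seq p q => p.keepsOut && q.keepsOut
  | .cond _ p q => p.keepsOut && q.keepsOut
  | .loop _ p => p.keepsOut
  | _ => true

/-- The states `σ` and `σ'` agree on the part of the memory that the program `p` does not write
to. -/
structure Keeps (p : Prog) (σ σ' : State) : Prop where
  var : ∀ x, p.keepsVar x = true → σ'.var x = σ.var x
  arr : ∀ k, p.keepsArr k = true → σ'.arr k = σ.arr k
  rarr : ∀ k, p.keepsReal k = true → σ'.rarr k = σ.rarr k
  out : p.keepsOut = true → σ'.out = σ.out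

theorem Keeps.refl (p : Prog) (σ : State) : Keeps p σ σ :=
  ⟨fun _ _ => rfl, fun _ _ => rfl, fun _ _ => rfl, fun _ => rfl⟩

theorem Keeps.trans {p : Prog} {σ₁ σ₂ σ₃ : State} (h : Keeps p σ₁ σ₂) (h' : Keeps p σ₂ σ₃) :
    Keeps p σ₁ σ₃ :=
  ⟨fun x hx => (h'.var x hx).trans (h.var x hx), fun x hx => (h'.arr x hx).trans (h.arr x hx),
    fun x hx => (h'.rarr x hx).trans (h.rarr x hx), fun hx => (h'.out hx).trans (h.out hx)⟩

theorem Keeps.seq_left {p q : Prog} {σ σ' : State} (h : Keeps p σ σ') : Keeps (.seq p q) σ σ' := by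
  constructor <;> intros <;> simp_all [Prog.keepsVar, Prog.keepsArr, Prog.keepsReal, Prog.keepsOut]
  exacts [h.var _ ‹_ ∧ _›.1, h.arr _ ‹_ ∧ _›.1, h.rarr _ ‹_ ∧ _›.1, h.out ‹_ ∧ _›.1]

theorem Keeps.seq_right {p q : Prog} {σ σ' : State} (h : Keeps q σ σ') :
    Keeps (.seq p q) σ σ' := by
  constructor <;> intros <;> simp_all [Prog.keepsVar, Prog.keepsArr, Prog.keepsReal, Prog.keepsOut]
  exacts [h.var _ ‹_ ∧ _›.2, h.arr _ ‹_ ∧ _›.2, h.rarr _ ‹_ ∧ _›.2, h.out ‹_ ∧ _›.2]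

theorem Keeps.cond_left {t : BExpr} {p q : Prog} {σ σ' : State} (h : Keeps p σ σ') :
    Keeps (.cond t p q) σ σ' := ⟨h.seq_left.var, h.seq_left.arr, h.seq_left.rarr, h.seq_left.out⟩

theorem Keeps.cond_right {t : BExpr} {p q : Prog} {σ σ' : State} (h : Keeps q σ σ') :
    Keeps (.cond t p q) σ σ' :=
  ⟨h.seq_right.var, h.seq_right.arr, h.seq_right.rarr, h.seq_right.out⟩

theorem Keeps.loop {t : BExpr} {p : Prog} {σ σ' : State} (h : Keeps p σ σ') :
    Keeps (.loop t p) σ σ' := ⟨h.var, h.arr, h.rarr, h.out⟩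

theorem Exec.keeps {I : Input} {p : Prog} {σ σ' : State} {k : ℕ} (h : Exec I p σ σ' k) :
    Keeps p σ σ' := by
  induction h with
  | skip σ => exact .refl _ _
  | assign σ x e =>
    refine ⟨fun y hy => ?_, fun _ _ => rfl, fun _ _ => rfl, fun _ => rfl⟩
    simp only [Prog.keepsVar, bne_iff_ne] at hy
    exact Function.update_of_ne hy.symm _ _
  | store σ k i e =>
    refine ⟨fun _ _ => rfl, fun y hy => ?_, fun _ _ => rfl, fun _ => rfl⟩
    simp only [Prog.keepsArr, bne_iff_ne] at hy
    exact Function.update_of_ne hy.symm _ _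
  | rstore σ k i e =>
    refine ⟨fun _ _ => rfl, fun _ _ => rfl, fun y hy => ?_, fun _ => rfl⟩
    simp only [Prog.keepsReal, bne_iff_ne] at hy
    exact Function.update_of_ne hy.symm _ _
  | emit σ e =>
    refine ⟨fun _ _ => rfl, fun _ _ => rfl, fun _ _ => rfl, fun h => ?_⟩
    simp [Prog.keepsOut] at h
  | seq σ σ₁ σ₂ p q k₁ k₂ _ _ ih₁ ih₂ => exact ih₁.seq_left.trans ih₂.seq_right
  | cond_true σ σ' t p q k _ _ ih => exact ih.cond_left
  | cond_false σ σ' t p q k _ _ ih => exact ih.cond_right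
  | loop_done σ t p _ => exact .refl _ _
  | loop_step σ σ₁ σ₂ t p k₁ k₂ _ _ _ ih₁ ih₂ => exact ih₁.loop.trans ih₂

theorem HaltsIn.keeps {I : Input} {p : Prog} {σ : State} {T : ℕ} {Q : State → Prop}
    (h : HaltsIn I p σ T Q) : HaltsIn I p σ T (fun σ' => Q σ' ∧ Keeps p σ σ') := by
  obtain ⟨σ', k, h1, h2, h3⟩ := h
  exact ⟨σ', k, h1, h2, h3, h1.keeps⟩

/-- The loop rule. The invariant `Inv σ b` comes with a credit `b`, from which every iteration
pays for its steps. -/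
theorem HaltsIn.loop {I : Input} {t : BExpr} {p : Prog} (Inv : State → ℕ → Prop)
    (hs : ∀ σ b, Inv σ b → t.holds I σ →
      ∃ T b', b' + T + (t.steps + 1) ≤ b ∧ HaltsIn I p σ T (fun σ' => Inv σ' b'))
    {σ : State} {b : ℕ} (h : Inv σ b) :
    HaltsIn I (.loop t p) σ (b + (t.steps + 1))
      (fun σ' => (∃ b', Inv σ' b') ∧ ¬ t.holds I σ') := by
  induction b using Nat.strong_induction_on generalizing σ with
  | _ b ih =>
    by_cases ht : t.holds I σ
    · obtain ⟨T, b', hb, σ₁, k₁, h1, h2, h3⟩ := hs σ b h ht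
      obtain ⟨σ₂, k₂, h4, h5, h6⟩ := ih b' (by omega) h3
      exact ⟨σ₂, _, .loop_step _ _ _ _ _ _ _ ht h1 h4, by omega, h6⟩
    · exact ⟨σ, _, .loop_done _ _ _ ht, by omega, ⟨b, h⟩, ht⟩

/-- The test `e₁ < e₂`. -/
def BExpr.lt (e₁ e₂ : IExpr) : BExpr := .neg (.ile e₂ e₁)

/-- The test `e₁ = e₂`. -/
def BExpr.eq (e₁ e₂ : IExpr) : BExpr := .conj (.ile e₁ e₂) (.ile e₂ e₁)

/-- Sequential composition of a list of programs. -/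
def block : List Prog → Prog
  | [] => .skip
  | [p] => p
  | p :: q :: ps => .seq p (block (q :: ps))

/-- `for x = 0, …, bnd - 1 do body`. -/
def forLoop (x : ℕ) (bnd : IExpr) (body : Prog) : Prog :=
  .seq (.assign x (.const 0))
    (.loop (.lt (.var x) bnd) (.seq body (.assign x (.add (.var x) (.const 1)))))

@[simp] theorem BExpr.holds_lt (I : Input) (σ : State) (e₁ e₂ : IExpr) :
    (BExpr.lt e₁ e₂).holds I σ ↔ e₁.eval I σ < e₂.eval I σ := by
  simp [BExpr.lt, BExpr.holds]

@[simp] theorem BExpr.holds_eq (I : Input) (σ : State) (e₁ e₂ : IExpr) :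
    (BExpr.eq e₁ e₂).holds I σ ↔ e₁.eval I σ = e₂.eval I σ := by
  simp [BExpr.eq, BExpr.holds, le_antisymm_iff]

section StateLemmas

variable (σ : State) (x k : ℕ) (i z : ℤ) (r : ℝ)

@[simp] theorem State.setVar_var (y : ℕ) :
    (σ.setVar x z).var y = if y = x then z else σ.var y := Function.update_apply _ _ _ _
@[simp] theorem State.setVar_arr : (σ.setVar x z).arr = σ.arr := rfl
@[simp] theorem State.setVar_rarr : (σ.setVar x z).rarr = σ.rarr := rfl
@[simp] theorem State.setVar_out : (σ.setVar x z).out = σ.out := rfl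
@[simp] theorem State.setArr_var : (σ.setArr k i z).var = σ.var := rfl
@[simp] theorem State.setArr_arr (l : ℕ) :
    (σ.setArr k i z).arr l = if l = k then Function.update (σ.arr k) i z else σ.arr l :=
  Function.update_apply _ _ _ _
@[simp] theorem State.setArr_rarr : (σ.setArr k i z).rarr = σ.rarr := rfl
@[simp] theorem State.setArr_out : (σ.setArr k i z).out = σ.out := rfl
@[simp] theorem State.setReal_var : (σ.setReal k i r).var = σ.var := rfl
@[simp] theorem State.setReal_arr : (σ.setReal k i r).arr = σ.arr := rfl
@[simp] theorem State.setReal_rarr (l : ℕ) :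
    (σ.setReal k i r).rarr l = if l = k then Function.update (σ.rarr k) i r else σ.rarr l :=
  Function.update_apply _ _ _ _
@[simp] theorem State.setReal_out : (σ.setReal k i r).out = σ.out := rfl
@[simp] theorem State.append_var : (σ.append z).var = σ.var := rfl
@[simp] theorem State.append_arr : (σ.append z).arr = σ.arr := rfl
@[simp] theorem State.append_rarr : (σ.append z).rarr = σ.rarr := rfl
@[simp] theorem State.append_out : (σ.append z).out = σ.out ++ [z] := rfl

end StateLemmas

attribute [simp] IExpr.eval RExpr.eval BExpr.holds Prog.wp

/-- The rule for counting loops: `Inv i` holds when the loop variable is `i`. -/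
theorem HaltsIn.forLoop {I : Input} {x : ℕ} {bnd : IExpr} {body : Prog} {σ₀ : State}
    (N : ℕ) (Inv : ℕ → State → Prop) (c : ℕ)
    (hx : body.keepsVar x = true) (hb : ∀ σ, bnd.eval I σ = N)
    (h0 : Inv 0 (σ₀.setVar x 0))
    (hs : ∀ i < N, ∀ σ, Keeps (AOF.forLoop x bnd body) σ₀ σ → σ.var x = i → Inv i σ →
      HaltsIn I body σ c (fun σ' => Inv (i + 1) (σ'.setVar x (i + 1)))) :
    HaltsIn I (AOF.forLoop x bnd body) σ₀ ((N + 1) * (c + bnd.steps + 10))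
      (fun σ => Inv N σ ∧ Keeps (AOF.forLoop x bnd body) σ₀ σ) := by
  set d := c + bnd.steps + 8 with hd
  have hloop := HaltsIn.loop (I := I) (t := .lt (.var x) bnd)
    (p := .seq body (.assign x (.add (.var x) (.const 1))))
    (fun σ b => ∃ i : ℕ, i ≤ N ∧ σ.var x = i ∧ Inv i σ ∧ b = (N - i) * d ∧
      Keeps (AOF.forLoop x bnd body) σ₀ σ) ?_ (σ := σ₀.setVar x 0) (b := N * d)
    ⟨0, Nat.zero_le _, by simp, h0, by simp, ?_⟩
  · have h := HaltsIn.seq (p := .assign x (.const 0)) (HaltsIn.of_wp (I := I) hloop)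
    refine h.mono ?_ ?_
    · simp only [Prog.cost, IExpr.steps, BExpr.steps, BExpr.lt]
      nlinarith
    · rintro σ ⟨⟨b, i, hi, hxi, hinv, -, hk⟩, ht⟩
      simp only [BExpr.holds_lt, IExpr.eval, hxi, hb] at ht
      have : i = N := by omega
      exact ⟨this ▸ hinv, hk⟩
  · rintro σ b ⟨i, hi, hxi, hinv, rfl, hk⟩ ht
    simp only [BExpr.holds_lt, IExpr.eval, hxi, hb] at ht
    have hiN : i < N := by omega
    refine ⟨c + 4, (N - (i + 1)) * d, ?_, ?_⟩
    · obtain ⟨j, rfl⟩ := Nat.exists_eq_add_of_lt hiN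
      simp only [IExpr.steps, BExpr.steps, BExpr.lt]
      have e1 : i + j + 1 - (i + 1) = j := by omega
      have e2 : i + j + 1 - i = j + 1 := by omega
      rw [e1, e2, Nat.add_mul]
      omega
    · refine HaltsIn.seq ((HaltsIn.keeps (hs i hiN σ hk hxi hinv)).mono le_rfl ?_)
      rintro σ' ⟨h1, h2⟩
      have hv : σ'.var x = i := (h2.var x hx).trans hxi
      have e : σ'.setVar x ((IExpr.add (.var x) (.const 1)).eval I σ') = σ'.setVar x (i + 1) := by
        simp [hv]
      refine HaltsIn.of_wp (p := .assign x (.add (.var x) (.const 1))) ?_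
      simp only [Prog.wp]
      rw [e]
      refine ⟨i + 1, hiN, by simp, h1, rfl, hk.trans ?_⟩
      have h3 : Keeps (.assign x (.add (.var x) (.const 1))) σ' (σ'.setVar x (i + 1)) := by
        have := (Exec.assign (I := I) σ' x (.add (.var x) (.const 1))).keeps
        rwa [e] at this
      exact ((h2.seq_left.trans h3.seq_right).loop).seq_right
  · exact ((Exec.assign (I := I) σ₀ x (.const 0)).keeps).seq_left

/-! ### Numberings of depth-first search forests -/

section Forest

variable {V : Type*}

/-- A configuration of a depth-first search that numbers the nodes: `pre` numbers them in the order
of their discovery, from `1` on; `post` numbers them in the order in which they are finished, and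
is `⊤` for the nodes that are not finished; `fin` is the number of finished nodes. -/
structure NumState (V : Type*) extends DFSState V where
  pre : V → ℕ
  post : V → ℕ∞
  fin : ℕ

/-- One step of a numbering depth-first search. -/
inductive NumStep [DecidableEq V] (R : V → V → Prop) : NumState V → NumState V → Prop
  | root (vis : Finset V) (π : V → Option V) (pre : V → ℕ) (post : V → ℕ∞) (k : ℕ) (v : V) :
      v ∉ vis → NumStep R ⟨⟨vis, [], π⟩, pre, post, k⟩
        ⟨⟨insert v vis, [v], π⟩, Function.update pre v (vis.card + 1), post, k⟩
  | advance (vis : Finset V) (π : V → Option V) (pre : V → ℕ) (post : V → ℕ∞) (k : ℕ)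
      (s : List V) (v w : V) : R v w → w ∉ vis →
      NumStep R ⟨⟨vis, v :: s, π⟩, pre, post, k⟩
        ⟨⟨insert w vis, w :: v :: s, Function.update π w (some v)⟩,
          Function.update pre w (vis.card + 1), post, k⟩
  | retreat (vis : Finset V) (π : V → Option V) (pre : V → ℕ) (post : V → ℕ∞) (k : ℕ)
      (s : List V) (v : V) : (∀ w, R v w → w ∈ vis) →
      NumStep R ⟨⟨vis, v :: s, π⟩, pre, post, k⟩
        ⟨⟨vis, s, π⟩, pre, Function.update post v (k : ℕ∞), k + 1⟩

/-- The start of a numbering depth-first search. -/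
def NumState.init (V : Type*) : NumState V := ⟨⟨∅, [], fun _ => none⟩, fun _ => 0, fun _ => ⊤, 0⟩

theorem NumStep.toStep [DecidableEq V] {R : V → V → Prop} {s s' : NumState V}
    (h : NumStep R s s') : DFSStep R s.toDFSState s'.toDFSState := by
  cases h with
  | root vis π pre post k v h => exact .root _ _ _ h
  | advance vis π pre post k s v w h h' => exact .advance _ _ _ _ _ h h'
  | retreat vis π pre post k s v h => exact .retreat _ _ _ _ h

theorem DFSStep.exists_numStep [DecidableEq V] {R : V → V → Prop} {d d' : DFSState V}
    (h : DFSStep R d d') (s : NumState V) (hs : s.toDFSState = d) :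
    ∃ s' : NumState V, s'.toDFSState = d' ∧ NumStep R s s' := by
  obtain ⟨d₀, pre, post, k⟩ := s
  subst hs
  cases h with
  | root vis π v h => exact ⟨_, rfl, .root _ _ _ _ _ _ h⟩
  | advance vis π s v w h h' => exact ⟨_, rfl, .advance _ _ _ _ _ _ _ _ h h'⟩
  | retreat vis π s v h => exact ⟨_, rfl, .retreat _ _ _ _ _ _ _ h⟩

theorem ancestor_iff {π : V → Option V} {a x : V} :
    Ancestor π a x ↔ a = x ∨ ∃ y, π x = some y ∧ Ancestor π a y := by
  unfold Ancestor
  rw [Relation.ReflTransGen.cases_tail_iff]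
  constructor
  · rintro (h | ⟨c, h1, h2⟩)
    exacts [.inl h.symm, .inr ⟨c, h2, h1⟩]
  · rintro (h | ⟨c, h1, h2⟩)
    exacts [.inl h.symm, .inr ⟨c, h2, h1⟩]

theorem Ancestor.of_pred {π : V → Option V} {a x y : V} (h : π x = some y) (h' : Ancestor π a y) :
    Ancestor π a x := ancestor_iff.2 (.inr ⟨y, h, h'⟩)

theorem Ancestor.refl (π : V → Option V) (a : V) : Ancestor π a a := Relation.ReflTransGen.refl

theorem Ancestor.trans {π : V → Option V} {a b c : V} (h : Ancestor π a b) (h' : Ancestor π b c) :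
    Ancestor π a c := Relation.ReflTransGen.trans h h'

/-- Ancestors of the same node are comparable. -/
theorem Ancestor.total {π : V → Option V} {a b x : V} (ha : Ancestor π a x) (hb : Ancestor π b x) :
    Ancestor π a b ∨ Ancestor π b a := by
  unfold Ancestor at ha
  induction ha with
  | refl => exact .inr hb
  | tail h1 h2 ih =>
    rcases ancestor_iff.1 hb with rfl | ⟨y, hy, hby⟩
    · exact .inl (Relation.ReflTransGen.tail h1 h2)
    · have : some y = some _ := hy.symm.trans h2
      cases this
      exact ih hby

/-- The list is the path from its first node up to a root. -/
def IsRootPath (π : V → Option V) : List V → Prop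
  | [] => True
  | [v] => π v = none
  | v :: w :: s => π v = some w ∧ IsRootPath π (w :: s)

/-- The invariant of a numbering depth-first search: the stack is the path from the active node to
its root, and consists of the visited nodes that are not finished; ancestry can be read off the
numbers; an arc between visited nodes is a descent, an ascent, or leads to a node that was
finished before its source; and the arcs that leave a finished node lead to visited nodes. -/
structure NumInv [DecidableEq V] (R : V → V → Prop) (s : NumState V) : Prop where
  stack_sub : ∀ v ∈ s.stack, v ∈ s.visited
  path : IsRootPath s.pred s.stack
  sorted : s.stack.Pairwise (fun a b => s.pre b < s.pre a)
  pre_pos : ∀ v ∈ s.visited, 1 ≤ s.pre v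
  pre_le : ∀ v ∈ s.visited, s.pre v ≤ s.visited.card
  pre_inj : ∀ v ∈ s.visited, ∀ w ∈ s.visited, s.pre v = s.pre w → v = w
  post_top : ∀ v ∈ s.visited, (s.post v = ⊤ ↔ v ∈ s.stack)
  post_unvisited : ∀ v, v ∉ s.visited → s.post v = ⊤
  post_lt : ∀ v, s.post v ≠ ⊤ → s.post v < s.fin
  post_inj : ∀ v w, s.post v ≠ ⊤ → s.post v = s.post w → v = w
  tree : ∀ v w, s.pred w = some v → R v w ∧ v ∈ s.visited ∧ w ∈ s.visited
  tree_lt : ∀ v w, s.pred w = some v → s.pre v < s.pre w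
  anc : ∀ a ∈ s.visited, ∀ v ∈ s.visited,
    (Ancestor s.pred a v ↔ s.pre a ≤ s.pre v ∧ s.post v ≤ s.post a)
  arcs : ∀ u ∈ s.visited, ∀ v ∈ s.visited, R u v → ¬ (s.pre u < s.pre v ∧ s.post u < s.post v)
  finished : ∀ u ∈ s.visited, u ∉ s.stack → ∀ v, R u v → v ∈ s.visited

theorem NumInv.init [DecidableEq V] (R : V → V → Prop) : NumInv R (NumState.init V) := by
  constructor <;> simp [NumState.init, IsRootPath]

theorem IsRootPath.congr {π π' : V → Option V} {s : List V} (h : ∀ v ∈ s, π' v = π v)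
    (hs : IsRootPath π s) : IsRootPath π' s := by
  induction s with
  | nil => trivial
  | cons v s ih =>
    cases s with
    | nil => simpa [IsRootPath, h v (by simp)] using hs
    | cons w s =>
      exact ⟨(h v (by simp)).trans hs.1, ih (fun x hx => h x (List.mem_cons_of_mem _ hx)) hs.2⟩

/-- A predecessor for a new node does not change the ancestors of the old nodes. -/
theorem ancestor_update_of_mem [DecidableEq V] {π : V → Option V} {vis : Finset V}
    (hπ : ∀ x y, π y = some x → x ∈ vis ∧ y ∈ vis) {w : V} (hw : w ∉ vis) (o : Option V)
    {a x : V} (hx : x ∈ vis) :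
    Ancestor (Function.update π w o) a x ↔ Ancestor π a x := by
  constructor
  · intro h
    unfold Ancestor at h
    induction h with
    | refl => exact .refl _ _
    | @tail b c h1 h2 ih =>
      have hc : c ≠ w := by rintro rfl; exact hw hx
      have h3 : π c = some b := by simpa [TreeArc, Function.update_of_ne hc] using h2
      exact .of_pred h3 (ih (hπ _ _ h3).1)
  · intro h
    unfold Ancestor at h
    induction h with
    | refl => exact .refl _ _
    | @tail b c h1 h2 ih =>
      have hc : c ≠ w := by rintro rfl; exact hw hx
      exact .of_pred (by rw [Function.update_of_ne hc]; exact h2) (ih (hπ _ _ h2).1)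

theorem NumInv.step [DecidableEq V] {R : V → V → Prop} {s s' : NumState V}
    (hs : NumInv R s) (h : NumStep R s s') : NumInv R s' := by
  cases h with
  | root vis π pre post k v hv =>
    obtain ⟨h1, h2, h3, h4, h5, h6, h7, h8, h9, h10, h11, h11', h12, h13, h14⟩ := hs
    simp only at h1 h2 h3 h4 h5 h6 h7 h8 h9 h10 h11 h11' h12 h13 h14
    have ne : ∀ x ∈ vis, x ≠ v := by rintro x hx rfl; exact hv hx
    have hπv : π v = none := by
      by_contra hc
      obtain ⟨y, hy⟩ := Option.ne_none_iff_exists'.1 hc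
      exact hv (h11 _ _ hy).2.2
    have hpx : ∀ x ∈ vis, Function.update pre v (vis.card + 1) x = pre x :=
      fun x hx => Function.update_of_ne (ne x hx) _ _
    have hfin : ∀ x ∈ vis, post x ≠ ⊤ := fun x hx h => by simpa using (h7 x hx).1 h
    have ancv : ∀ x, Ancestor π x v ↔ x = v := by
      intro x
      rw [ancestor_iff]
      simp [hπv]
    have ancv' : ∀ x ∈ vis, ¬ Ancestor π v x := by
      intro x hx h
      induction h with
      | refl => exact hv hx
      | tail h1 h2 ih => exact ih (h11 _ _ h2).2.1
    constructor
    · simp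
    · exact hπv
    · simp
    · simp only [Finset.mem_insert]
      rintro x (rfl | hx)
      · simp
      · rw [hpx x hx]; exact h4 x hx
    · simp only [Finset.mem_insert, Finset.card_insert_of_notMem hv]
      rintro x (rfl | hx)
      · simp
      · rw [hpx x hx]; exact (h5 x hx).trans (Nat.le_succ _)
    · simp only [Finset.mem_insert]
      rintro x (rfl | hx) y (rfl | hy) hxy
      · rfl
      · rw [hpx y hy, Function.update_self] at hxy; have := h5 y hy; omega
      · rw [hpx x hx, Function.update_self] at hxy; have := h5 x hx; omega
      · rw [hpx y hy, hpx x hx] at hxy; exact h6 x hx y hy hxy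
    · simp only [Finset.mem_insert]
      rintro x (rfl | hx)
      · simp [h8 x hv]
      · simp [hfin x hx, ne x hx]
    · intro x hx
      simp only [Finset.mem_insert, not_or] at hx
      exact h8 x hx.2
    · exact h9
    · exact h10
    · intro x y hxy
      obtain ⟨ha, hb, hc⟩ := h11 x y hxy
      exact ⟨ha, Finset.mem_insert_of_mem hb, Finset.mem_insert_of_mem hc⟩
    · intro x y hxy
      simp only [hpx x (h11 x y hxy).2.1, hpx y (h11 x y hxy).2.2]
      exact h11' x y hxy
    · simp only [Finset.mem_insert]
      rintro x (rfl | hx) y (rfl | hy)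
      · simp [Ancestor.refl]
      · rw [hpx y hy, Function.update_self]
        have := h5 y hy
        exact ⟨fun h => absurd h (ancv' y hy), fun h => by omega⟩
      · rw [hpx x hx, Function.update_self, h8 y hv, ancv]
        simp [hfin x hx, ne x hx]
      · rw [hpx y hy, hpx x hx]; exact h12 x hx y hy
    · simp only [Finset.mem_insert]
      rintro x (rfl | hx) y (rfl | hy) hxy
      · simp
      · rw [hpx y hy, Function.update_self]
        have := h5 y hy
        omega
      -- all visited nodes are finished, so none of their arcs leads to the new root
      · exact absurd (h14 x hx (by simp) _ hxy) hv
      · rw [hpx y hy, hpx x hx]; exact h13 x hx y hy hxy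
    · simp only [Finset.mem_insert, List.mem_singleton]
      rintro x (rfl | hx) hxv y hxy
      · simp at hxv
      · exact .inr (h14 x hx (by simp) y hxy)
  | advance vis π pre post k s v w hR hw =>
    obtain ⟨h1, h2, h3, h4, h5, h6, h7, h8, h9, h10, h11, h11', h12, h13, h14⟩ := hs
    simp only at h1 h2 h3 h4 h5 h6 h7 h8 h9 h10 h11 h11' h12 h13 h14
    have hvv : v ∈ vis := h1 v (by simp)
    have ne : ∀ x ∈ vis, x ≠ w := by rintro x hx rfl; exact hw hx
    have hpx : ∀ x ∈ vis, Function.update pre w (vis.card + 1) x = pre x :=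
      fun x hx => Function.update_of_ne (ne x hx) _ _
    have hπ : ∀ x y, π y = some x → x ∈ vis ∧ y ∈ vis := fun x y h => (h11 x y h).2
    have hanc : ∀ a x, x ∈ vis → (Ancestor (Function.update π w (some v)) a x ↔ Ancestor π a x) :=
      fun a x hx => ancestor_update_of_mem hπ hw _ hx
    have hancw : ∀ a, Ancestor (Function.update π w (some v)) a w ↔ a = w ∨ Ancestor π a v := by
      intro a
      rw [ancestor_iff]
      simp [hanc a v hvv]
    have ancw' : ∀ x ∈ vis, ¬ Ancestor π w x := by
      intro x hx h
      induction h with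
      | refl => exact hw hx
      | tail h1 h2 ih => exact ih (h11 _ _ h2).2.1
    have hstack : ∀ x ∈ v :: s, pre x ≤ pre v := by
      intro x hx
      rcases List.mem_cons.1 hx with rfl | hx
      · rfl
      · exact ((List.pairwise_cons.1 h3).1 x hx).le
    have hvtop : post v = ⊤ := (h7 v hvv).2 (by simp)
    constructor
    · simp only [List.mem_cons, Finset.mem_insert]
      rintro x (rfl | hx)
      · exact .inl rfl
      · exact .inr (h1 x (List.mem_cons.2 hx))
    · refine ⟨Function.update_self _ _ _, IsRootPath.congr (fun x hx => ?_) h2⟩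
      exact Function.update_of_ne (ne x (h1 x hx)) _ _
    · refine List.pairwise_cons.2 ⟨fun x hx => ?_, h3.imp_of_mem ?_⟩
      · simp only [hpx x (h1 x hx), Function.update_self]
        exact Nat.lt_succ_of_le (h5 x (h1 x hx))
      · intro x y hx hy hxy
        simpa only [hpx x (h1 x hx), hpx y (h1 y hy)] using hxy
    · simp only [Finset.mem_insert]
      rintro x (rfl | hx)
      · simp
      · rw [hpx x hx]; exact h4 x hx
    · simp only [Finset.mem_insert, Finset.card_insert_of_notMem hw]
      rintro x (rfl | hx)
      · simp
      · rw [hpx x hx]; exact (h5 x hx).trans (Nat.le_succ _)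
    · simp only [Finset.mem_insert]
      rintro x (rfl | hx) y (rfl | hy) hxy
      · rfl
      · rw [hpx y hy, Function.update_self] at hxy; have := h5 y hy; omega
      · rw [hpx x hx, Function.update_self] at hxy; have := h5 x hx; omega
      · rw [hpx y hy, hpx x hx] at hxy; exact h6 x hx y hy hxy
    · simp only [Finset.mem_insert]
      rintro x (rfl | hx)
      · simp [h8 x hw]
      · rw [h7 x hx]; simp [ne x hx]
    · intro x hx
      simp only [Finset.mem_insert, not_or] at hx
      exact h8 x hx.2
    · exact h9
    · exact h10
    · intro x y hxy
      by_cases hy : y = w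
      · subst hy
        simp only [Function.update_self, Option.some.injEq] at hxy
        subst hxy
        simp [hR, hvv]
      · simp only [Function.update_of_ne hy] at hxy
        obtain ⟨ha, hb, hc⟩ := h11 x y hxy
        exact ⟨ha, Finset.mem_insert_of_mem hb, Finset.mem_insert_of_mem hc⟩
    · intro x y hxy
      by_cases hy : y = w
      · subst hy
        simp only [Function.update_self, Option.some.injEq] at hxy
        subst hxy
        simp only [hpx _ hvv, Function.update_self]
        exact Nat.lt_succ_of_le (h5 _ hvv)
      · simp only [Function.update_of_ne hy] at hxy
        simp only [hpx x (h11 x y hxy).2.1, hpx y (h11 x y hxy).2.2]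
        exact h11' x y hxy
    · simp only [Finset.mem_insert]
      rintro x (rfl | hx) y (rfl | hy)
      · simp [Ancestor.refl]
      · rw [hpx y hy, Function.update_self, hanc x y hy]
        have := h5 y hy
        exact ⟨fun h => absurd h (ancw' y hy), fun h => by omega⟩
      -- the ancestors of the new node are the node itself and the nodes on the stack
      · rw [hpx x hx, Function.update_self, h8 y hw, hancw, h12 x hx v hvv, hvtop]
        have := h5 x hx
        simp only [ne x hx, false_or, top_le_iff]
        constructor
        · rintro ⟨_, h⟩
          exact ⟨by omega, h⟩
        · rintro ⟨_, h⟩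
          exact ⟨hstack x ((h7 x hx).1 h), h⟩
      · rw [hpx y hy, hpx x hx, hanc x y hy]; exact h12 x hx y hy
    · simp only [Finset.mem_insert]
      rintro x (rfl | hx) y (rfl | hy) hxy
      · simp
      · rw [hpx y hy, Function.update_self]
        have := h5 y hy
        omega
      -- the node `x` has an arc to a node that was not visited, so it is not finished
      · have : x ∈ v :: s := by
          by_contra hc
          exact hw (h14 x hx hc _ hxy)
        rw [(h7 x hx).2 this]
        simp
      · rw [hpx y hy, hpx x hx]; exact h13 x hx y hy hxy
    · simp only [Finset.mem_insert]
      rintro x (rfl | hx) hxs y hxy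
      · simp at hxs
      · exact .inr (h14 x hx (fun h => hxs (List.mem_cons_of_mem _ h)) y hxy)
  | retreat vis π pre post k s v hR =>
    obtain ⟨h1, h2, h3, h4, h5, h6, h7, h8, h9, h10, h11, h11', h12, h13, h14⟩ := hs
    simp only at h1 h2 h3 h4 h5 h6 h7 h8 h9 h10 h11 h11' h12 h13 h14
    have hvv : v ∈ vis := h1 v (by simp)
    have hvtop : post v = ⊤ := (h7 v hvv).2 (by simp)
    have hstack : ∀ x ∈ s, pre x < pre v := (List.pairwise_cons.1 h3).1
    have hvs : v ∉ s := fun h => lt_irrefl _ (hstack v h)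
    have hp : ∀ x, x ≠ v → Function.update post v (k : ℕ∞) x = post x :=
      fun x hx => Function.update_of_ne hx _ _
    have hcmp : ∀ x, x ≠ v → post x = ⊤ ∨ post x < k := by
      intro x _
      by_cases h : post x = ⊤
      exacts [.inl h, .inr (h9 x h)]
    constructor
    · exact fun x hx => h1 x (List.mem_cons_of_mem _ hx)
    · cases s with
      | nil => trivial
      | cons w s => exact h2.2
    · exact (List.pairwise_cons.1 h3).2
    · exact h4
    · exact h5
    · exact h6
    · intro x hx
      by_cases hxv : x = v
      · subst hxv; simp [hvs]
      · simp only [hp x hxv, h7 x hx, List.mem_cons, hxv, false_or]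
    · intro x hx
      have : x ≠ v := by rintro rfl; exact hx hvv
      simp only [hp x this]
      exact h8 x hx
    · intro x hx
      simp only at hx ⊢
      by_cases hxv : x = v
      · subst hxv
        simp only [Function.update_self]
        exact_mod_cast Nat.lt_succ_self k
      · rw [hp x hxv] at hx ⊢
        exact (h9 x hx).trans (by exact_mod_cast Nat.lt_succ_self k)
    · intro x y hx hxy
      simp only at hx hxy
      by_cases hxv : x = v <;> by_cases hyv : y = v
      · rw [hxv, hyv]
      · subst hxv
        simp only [Function.update_self, hp y hyv] at hxy
        exact absurd (hxy ▸ h9 y (by rw [← hxy]; simp)) (lt_irrefl _)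
      · subst hyv
        simp only [Function.update_self, hp x hxv] at hxy
        exact absurd (hxy ▸ h9 x (by rw [hxy]; simp)) (lt_irrefl _)
      · rw [hp x hxv] at hx hxy
        rw [hp y hyv] at hxy
        exact h10 x y hx hxy
    · exact h11
    · exact h11'
    · intro x hx y hy
      simp only
      rw [h12 x hx y hy]
      refine and_congr_right fun hxy => ?_
      by_cases hxv : x = v <;> by_cases hyv : y = v
      · subst hxv hyv; simp
      · subst hxv
        simp only [Function.update_self, hp y hyv, hvtop, le_top, true_iff]
        refine (lt_of_le_of_lt le_rfl ?_ : post y < k).le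
        refine h9 y fun h => ?_
        rcases List.mem_cons.1 ((h7 y hy).1 h) with h | h
        · exact hyv h
        · exact absurd (hstack y h) (by omega)
      · subst hyv
        simp only [Function.update_self, hp x hxv, hvtop, top_le_iff]
        constructor
        · intro h; simp [h]
        · intro h
          by_contra hc
          exact absurd (h9 x hc) (not_lt.2 h)
      · rw [hp x hxv, hp y hyv]
    · rintro x hx y hy hxy ⟨hlt, hpo⟩
      simp only at hpo
      by_cases hxv : x = v <;> by_cases hyv : y = v
      · subst hxv hyv; exact lt_irrefl _ hlt
      -- the nodes that are finished after `v` are on the stack, hence discovered before `v`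
      · subst hxv
        simp only [Function.update_self, hp y hyv] at hpo
        rcases hcmp y hyv with h | h
        · rcases List.mem_cons.1 ((h7 y hy).1 h) with h | h
          · exact hyv h
          · exact absurd (hstack y h) hlt.not_gt
        · exact absurd h (not_lt.2 hpo.le)
      · subst hyv
        simp only [Function.update_self, hp x hxv] at hpo
        exact h13 x hx y hy hxy ⟨hlt, by rw [hvtop]; exact hpo.trans_le le_top⟩
      · rw [hp x hxv, hp y hyv] at hpo
        exact h13 x hx y hy hxy ⟨hlt, hpo⟩
    · intro x hx hxs y hxy
      by_cases hxv : x = v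
      · subst hxv; exact hR y hxy
      · exact h14 x hx (by simp [hxv, hxs]) y hxy

/-- A numbering of the forest `π` in the directed graph `R` as a depth-first search yields it:
ancestors are discovered first and finished last, and no arc leads from a node to one that is both
discovered and finished later. -/
structure IsNumbering [Fintype V] (R : V → V → Prop) (π : V → Option V) (pre : V → ℕ)
    (post : V → ℕ∞) : Prop where
  pre_pos : ∀ v, 1 ≤ pre v
  pre_le : ∀ v, pre v ≤ Fintype.card V
  pre_inj : ∀ v w, pre v = pre w → v = w
  post_ne_top : ∀ v, post v ≠ ⊤
  post_inj : ∀ v w, post v = post w → v = w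
  tree : ∀ v w, π w = some v → R v w
  tree_lt : ∀ v w, π w = some v → pre v < pre w
  anc : ∀ a v, Ancestor π a v ↔ pre a ≤ pre v ∧ post v ≤ post a
  arcs : ∀ u v, R u v → ¬ (pre u < pre v ∧ post u < post v)

theorem NumInv.isNumbering [DecidableEq V] [Fintype V] {R : V → V → Prop} {s : NumState V}
    (h : NumInv R s) (hv : s.visited = Finset.univ) (hs : s.stack = []) :
    IsNumbering R s.pred s.pre s.post where
  pre_pos v := h.pre_pos v (by simp [hv])
  pre_le v := by simpa [hv] using h.pre_le v (by simp [hv])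
  pre_inj v w := h.pre_inj v (by simp [hv]) w (by simp [hv])
  post_ne_top v := by simp [h.post_top v (by simp [hv]), hs]
  post_inj v w := h.post_inj v w (by simp [h.post_top v (by simp [hv]), hs])
  tree v w hw := (h.tree v w hw).1
  tree_lt v w hw := h.tree_lt v w hw
  anc a v := h.anc a (by simp [hv]) v (by simp [hv])
  arcs u v := h.arcs u (by simp [hv]) v (by simp [hv])

theorem IsDFSForest.exists_numbering [DecidableEq V] [Fintype V] {R : V → V → Prop}
    {π : V → Option V} (h : IsDFSForest R π) : ∃ pre post, IsNumbering R π pre post := by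
  have key : ∀ d, Relation.ReflTransGen (DFSStep R) ⟨∅, [], fun _ => none⟩ d →
      ∃ s : NumState V, s.toDFSState = d ∧ NumInv R s := by
    intro d hd
    induction hd with
    | refl => exact ⟨NumState.init V, rfl, NumInv.init R⟩
    | tail _ h ih =>
      obtain ⟨s, hs, hi⟩ := ih
      obtain ⟨s', hs', h'⟩ := h.exists_numStep s hs
      exact ⟨s', hs', hi.step h'⟩
  obtain ⟨s, hs, hi⟩ := key _ h
  have := hi.isNumbering (by rw [hs]) (by rw [hs])
  rw [hs] at this
  exact ⟨_, _, this⟩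

end Forest

/-! ### Proper cycles of a depth-first search forest -/

section Forest

variable {V : Type*}

/-- The node `x` climbs to its ancestor `a` along short backward arcs. -/
def Climbs (R : V → V → Prop) (π : V → Option V) (x a : V) : Prop :=
  Relation.ReflTransGen (ShortBackArc R π) x a

/-- The common form of the proper backward, forward and cross cycles: an arc `(i, j)` that is
neither a tree arc nor a short backward arc, a path `P` of short backward arcs from `j` to the first
common ancestor `a` of `i` and `j`, and the tree path `Q` from `a` to `i`. -/
structure ProperCycle (R : V → V → Prop) (π : V → Option V) (i j a : V) (P Q : List V) :
    Prop where
  arc : R i j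
  ne : i ≠ j
  not_tree : π j ≠ some i
  not_short : π i ≠ some j
  fca : FirstCommonAncestor π i j a
  up : IsPathFromTo (ShortBackArc R π) j a P
  down : IsPathFromTo (TreeArc π) a i Q

theorem IsPathFromTo.singleton (R : V → V → Prop) (x : V) : IsPathFromTo R x x [x] := by
  simp [IsPathFromTo]

theorem IsPathFromTo.cons {R : V → V → Prop} {x y z : V} {P : List V} (h : R x y)
    (hP : IsPathFromTo R y z P) : IsPathFromTo R x z (x :: P) := by
  obtain ⟨h1, h2, h3⟩ := hP
  cases P with
  | nil => simp at h1
  | cons w P =>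
    simp only [List.head?_cons, Option.some.injEq] at h1
    subst h1
    exact ⟨rfl, by simpa [List.getLast?_cons_cons] using h2, h3.cons_cons h⟩

theorem IsPathFromTo.concat {R : V → V → Prop} {x y z : V} {P : List V}
    (hP : IsPathFromTo R x y P) (h : R y z) : IsPathFromTo R x z (P ++ [z]) := by
  obtain ⟨h1, h2, h3⟩ := hP
  refine ⟨by simp [List.head?_append, h1], by simp, ?_⟩
  rw [List.isChain_append]
  refine ⟨h3, by simp, ?_⟩
  intro u hu v hv
  rw [h2] at hu
  simp at hu hv
  subst hu hv
  exact h

/-- A path is either trivial or has a first arc. -/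
theorem IsPathFromTo.cases {R : V → V → Prop} {x z : V} {P : List V}
    (hP : IsPathFromTo R x z P) :
    (x = z ∧ P = [x]) ∨ ∃ y P', P = x :: P' ∧ R x y ∧ IsPathFromTo R y z P' := by
  obtain ⟨h1, h2, h3⟩ := hP
  match P, h1, h2, h3 with
  | [w], h1, h2, h3 =>
    simp at h1 h2
    subst h1
    exact .inl ⟨h2, rfl⟩
  | w :: y :: P, h1, h2, h3 =>
    simp at h1
    subst h1
    rw [List.isChain_cons_cons] at h3
    exact .inr ⟨y, _, rfl, h3.1, rfl, by simpa [List.getLast?_cons_cons] using h2, h3.2⟩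

theorem IsPathFromTo.reflTransGen {R : V → V → Prop} {P : List V} : ∀ {x z : V},
    IsPathFromTo R x z P → Relation.ReflTransGen R x z ∧
      ∀ w ∈ P, Relation.ReflTransGen R x w ∧ Relation.ReflTransGen R w z := by
  induction P with
  | nil => intro x z h; simp [IsPathFromTo] at h
  | cons w P ih =>
    intro x z h
    rcases h.cases with ⟨rfl, hP⟩ | ⟨y, P', h, hR, h'⟩
    · rw [hP]
      simp [Relation.ReflTransGen.refl]
    · simp only [List.cons.injEq] at h
      obtain ⟨rfl, rfl⟩ := h
      obtain ⟨h1, h2⟩ := ih h'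
      have h0 := Relation.ReflTransGen.head hR h1
      refine ⟨h0, ?_⟩
      intro v hv
      rcases List.mem_cons.1 hv with rfl | hv
      · exact ⟨.refl, h0⟩
      · exact ⟨.head hR (h2 v hv).1, (h2 v hv).2⟩

theorem exists_path {R : V → V → Prop} {x z : V} (h : Relation.ReflTransGen R x z) :
    ∃ P, IsPathFromTo R x z P := by
  induction h using Relation.ReflTransGen.head_induction_on with
  | refl => exact ⟨_, .singleton R _⟩
  | head h _ ih =>
    obtain ⟨P, hP⟩ := ih
    exact ⟨_, hP.cons h⟩

theorem Climbs.ancestor {R : V → V → Prop} {π : V → Option V} {x a : V} (h : Climbs R π x a) :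
    Ancestor π a x := by
  unfold Climbs at h
  induction h using Relation.ReflTransGen.head_induction_on with
  | refl => exact .refl _ _
  | head h _ ih => exact .of_pred h.2 ih

variable [Fintype V] {R : V → V → Prop} {π : V → Option V} {pre : V → ℕ} {post : V → ℕ∞}

theorem IsNumbering.antisymm (h : IsNumbering R π pre post) {a b : V} (hab : Ancestor π a b)
    (hba : Ancestor π b a) : a = b :=
  h.pre_inj _ _ (le_antisymm ((h.anc _ _).1 hab).1 ((h.anc _ _).1 hba).1)

/-- If the head `x` of an arc `(q, x)` climbs to an ancestor of `q`, then the arc closes a proper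
cycle, unless it is a tree arc or a short backward arc. -/
theorem IsNumbering.exists_properCycle (h : IsNumbering R π pre post) {q x r : V}
    (hR : R q x) (hne : q ≠ x) (h1 : π x ≠ some q) (h2 : π q ≠ some x)
    (hx : Climbs R π x r) (hr : Ancestor π r q) : ∃ a P Q, ProperCycle R π q x a P Q := by
  classical
  obtain ⟨a, ha, hmax⟩ := Finset.exists_max_image
    (Finset.univ.filter fun a => Ancestor π a q ∧ Ancestor π a x) pre
    ⟨r, by simp [hr, hx.ancestor]⟩
  simp only [Finset.mem_filter, Finset.mem_univ, true_and] at ha hmax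
  have hfca : FirstCommonAncestor π q x a := by
    refine ⟨ha.1, ha.2, fun b hb1 hb2 => ?_⟩
    rcases hb1.total ha.1 with h3 | h3
    · exact h3
    · have : a = b := h.pre_inj _ _ (le_antisymm ((h.anc _ _).1 h3).1 (hmax b ⟨hb1, hb2⟩))
      exact this ▸ .refl _ _
  have hra := hfca.2.2 r hr hx.ancestor
  have hclimb : Climbs R π x a := by
    have key : ∀ y, Climbs R π y r → Ancestor π a y → Climbs R π y a := by
      intro y hy
      unfold Climbs at hy
      induction hy using Relation.ReflTransGen.head_induction_on with
      | refl => intro har; rw [h.antisymm har hra]; exact .refl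
      | head h' _ ih =>
        intro hay
        rcases ancestor_iff.1 hay with rfl | ⟨z, hz, haz⟩
        · exact .refl
        · have : some z = some _ := hz.symm.trans h'.2
          cases this
          exact .head h' (ih haz)
    exact key x hx ha.2
  obtain ⟨P, hP⟩ := exists_path hclimb
  obtain ⟨Q, hQ⟩ := exists_path ha.1
  exact ⟨a, P, Q, hR, hne, h1, h2, hfca, hP, hQ⟩

/-- If there is no proper cycle, then no circulation is possible: the set `S` of arcs stands for the
support of a circulation, which may pass each arc in one direction only.

From the node of the support that is finished last, follow short backward arcs of `S` against their
direction as long as possible. The arc of `S` that enters the node reached closes a proper cycle. -/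
theorem IsNumbering.no_circulation (h : IsNumbering R π pre post)
    (hno : ∀ i j a P Q, ¬ ProperCycle R π i j a P Q) {S : V → V → Prop}
    (hS : ∀ x y, S x y → R x y) (hasymm : ∀ x y, S x y → ¬ S y x)
    (hin : ∀ x y, S x y → ∃ z, S z x) (x y : V) : ¬ S x y := by
  classical
  intro hxy
  obtain ⟨r, hr, hmax⟩ := Finset.exists_max_image (Finset.univ.filter fun x => ∃ y, S x y) post
    ⟨x, by simpa using ⟨y, hxy⟩⟩
  simp only [Finset.mem_filter, Finset.mem_univ, true_and] at hr hmax
  have hirr : ∀ x y, S x y → x ≠ y := by rintro x y h1 rfl; exact hasymm _ _ h1 h1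
  -- `B` consists of the short backward arcs in `S`; the predecessor `p` of `r` in the support is a
  -- child of `r`, since an arc into the node that is finished last cannot close a proper cycle
  let B : V → V → Prop := fun u v => ShortBackArc R π u v ∧ S u v
  obtain ⟨s, hs⟩ := hr
  obtain ⟨p, hp⟩ := hin _ _ hs
  have hpr : Relation.TransGen B p r := by
    have hlt : post p < post r := lt_of_le_of_ne (hmax p ⟨_, hp⟩)
      fun he => hirr _ _ hp (h.post_inj _ _ he)
    have hpre : pre r ≤ pre p := by
      by_contra hc
      exact h.arcs p r (hS _ _ hp) ⟨by omega, hlt⟩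
    have hanc := (h.anc r p).2 ⟨hpre, hlt.le⟩
    by_cases hpi : π p = some r
    · exact .single ⟨⟨hS _ _ hp, hpi⟩, hp⟩
    · have hnt : π r ≠ some p := fun hc => absurd (h.tree_lt _ _ hc) (by omega)
      obtain ⟨a, P, Q, hC⟩ := h.exists_properCycle (hS _ _ hp) (hirr _ _ hp) hnt hpi
        Relation.ReflTransGen.refl hanc
      exact absurd hC (hno _ _ _ _ _)
  -- the node `x` is the one that is discovered last among those that reach `r` along `B`
  obtain ⟨x, hx, hxmax⟩ := Finset.exists_max_image
    (Finset.univ.filter fun x => Relation.TransGen B x r) pre ⟨p, by simpa using hpr⟩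
  simp only [Finset.mem_filter, Finset.mem_univ, true_and] at hx hxmax
  obtain ⟨z, hxz, -⟩ := (Relation.TransGen.head'_iff).1 hx
  have hclimb : Climbs R π x r :=
    hx.to_reflTransGen.lift id fun _ _ h => h.1
  obtain ⟨q, hq⟩ := hin _ _ hxz.2
  have hnt : π x ≠ some q := by
    intro hc
    have : some z = some q := hxz.1.2.symm.trans hc
    cases this
    exact hasymm _ _ hq hxz.2
  have hns : π q ≠ some x := by
    intro hc
    have h1 := hxmax q (Relation.TransGen.head ⟨⟨hS _ _ hq, hc⟩, hq⟩ hx)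
    exact absurd (h.tree_lt _ _ hc) (by omega)
  -- the arc `(q, x)` is neither a tree arc nor a short backward arc; it closes a proper cycle,
  -- since `x` climbs to `r`, and `r` is an ancestor of `q`
  have hrx := (h.anc r x).1 hclimb.ancestor
  have hqr : post q ≤ post r := hmax q ⟨_, hq⟩
  have hrq : Ancestor π r q := by
    refine (h.anc r q).2 ⟨?_, hqr⟩
    by_contra hc
    have hqx : post x ≤ post q := by
      by_contra hc'
      exact h.arcs q x (hS _ _ hq) ⟨by omega, not_le.1 hc'⟩
    have h1 := (h.anc q x).2 ⟨by omega, hqx⟩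
    rcases h1.total hclimb.ancestor with h2 | h2
    · have := h.post_inj _ _ (le_antisymm hqr ((h.anc _ _).1 h2).2)
      subst this
      omega
    · exact absurd ((h.anc _ _).1 h2).1 (by omega)
  obtain ⟨a, P, Q, hC⟩ := h.exists_properCycle (hS _ _ hq) (hirr _ _ hq) hnt hns hclimb hrq
  exact hno _ _ _ _ _ hC

theorem LongBackArc.properCycle (h : IsNumbering R π pre post) (hirr : ∀ v, ¬ R v v) {i j : V}
    {C : List V} (ha : LongBackArc R π i j) (hC : IsPathFromTo (TreeArc π) j i C) :
    ProperCycle R π i j j [j] C where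
  arc := ha.1
  ne := by rintro rfl; exact hirr _ ha.1
  not_tree hc := by
    have := h.tree_lt _ _ hc
    have := ((h.anc _ _).1 ha.2.1).1
    omega
  not_short := ha.2.2
  fca := ⟨ha.2.1, .refl _ _, fun _ _ h => h⟩
  up := .singleton _ _
  down := hC

theorem ForwardArc.properCycle (h : IsNumbering R π pre post) (hirr : ∀ v, ¬ R v v) {i j : V}
    {C : List V} (ha : ForwardArc R π i j) (hC : IsPathFromTo (ShortBackArc R π) j i C) :
    ProperCycle R π i j i C [i] where
  arc := ha.1
  ne := by rintro rfl; exact hirr _ ha.1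
  not_tree := ha.2.2
  not_short hc := by
    have := h.tree_lt _ _ hc
    have := ((h.anc _ _).1 ha.2.1).1
    omega
  fca := ⟨.refl _ _, ha.2.1, fun _ h _ => h⟩
  up := hC
  down := .singleton _ _

omit [Fintype V] in
theorem CrossArc.properCycle {i j a : V} {P Q : List V} (ha : CrossArc R π i j)
    (hf : FirstCommonAncestor π i j a) (hP : IsPathFromTo (ShortBackArc R π) j a P)
    (hQ : IsPathFromTo (TreeArc π) a i Q) : ProperCycle R π i j a P Q where
  arc := ha.1
  ne := by rintro rfl; exact ha.2.1 (.refl _ _)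
  not_tree hc := ha.2.1 (.of_pred hc (.refl _ _))
  not_short hc := ha.2.2 (.of_pred hc (.refl _ _))
  fca := hf
  up := hP
  down := hQ

theorem IsNumbering.eq_singleton_of_tree (h : IsNumbering R π pre post) {x : V} {Q : List V}
    (hQ : IsPathFromTo (TreeArc π) x x Q) : Q = [x] := by
  rcases hQ.cases with ⟨-, h1⟩ | ⟨y, Q', -, h1, h2⟩
  · exact h1
  · have := h.tree_lt _ _ h1
    have h3 : Ancestor π y x := h2.reflTransGen.1
    have := ((h.anc _ _).1 h3).1
    omega

theorem IsNumbering.eq_singleton_of_short (h : IsNumbering R π pre post) {x : V} {P : List V}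
    (hP : IsPathFromTo (ShortBackArc R π) x x P) : P = [x] := by
  rcases hP.cases with ⟨-, h1⟩ | ⟨y, P', -, h1, h2⟩
  · exact h1
  · have := h.tree_lt _ _ h1.2
    have h3 : Climbs R π y x := h2.reflTransGen.1
    have := ((h.anc _ _).1 h3.ancestor).1
    omega

theorem ProperCycle.isBackwardCycle (h : IsNumbering R π pre post) {i j a : V} {P Q : List V}
    (hC : ProperCycle R π i j a P Q) (hji : Ancestor π j i) :
    IsBackwardCycle R π (P ++ Q.tail) := by
  have ha : a = j := h.antisymm hC.fca.2.1 (hC.fca.2.2 j hji (.refl _ _))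
  subst ha
  have hP := h.eq_singleton_of_short hC.up
  subst hP
  refine ⟨i, a, ⟨hC.arc, hji, hC.not_short⟩, ?_⟩
  have hQ := hC.down
  rcases hQ.cases with ⟨-, h1⟩ | ⟨y, Q', h1, -, -⟩ <;> subst h1 <;> exact hQ

theorem ProperCycle.isForwardCycle (h : IsNumbering R π pre post) {i j a : V} {P Q : List V}
    (hC : ProperCycle R π i j a P Q) (hij : Ancestor π i j) :
    IsForwardCycle R π (P ++ Q.tail) := by
  have ha : a = i := h.antisymm hC.fca.1 (hC.fca.2.2 i (.refl _ _) hij)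
  subst ha
  have hQ := h.eq_singleton_of_tree hC.down
  subst hQ
  exact ⟨a, j, ⟨hC.arc, hij, hC.not_tree⟩, by simpa using hC.up⟩

omit [Fintype V] in
theorem ProperCycle.isCrossCycle {i j a : V} {P Q : List V} (hC : ProperCycle R π i j a P Q)
    (hij : ¬ Ancestor π i j) (hji : ¬ Ancestor π j i) : IsCrossCycle R π (P ++ Q.tail) :=
  ⟨i, j, a, P, Q, ⟨hC.arc, hij, hji⟩, hC.fca, hC.up, hC.down, rfl⟩

theorem IsNumbering.no_properCycle (h : IsNumbering R π pre post)
    (h1 : ∀ C, ¬ IsBackwardCycle R π C) (h2 : ∀ C, ¬ IsForwardCycle R π C)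
    (h3 : ∀ C, ¬ IsCrossCycle R π C) (i j a : V) (P Q : List V) : ¬ ProperCycle R π i j a P Q := by
  intro hC
  by_cases hji : Ancestor π j i
  · exact h1 _ (hC.isBackwardCycle h hji)
  by_cases hij : Ancestor π i j
  · exact h2 _ (hC.isForwardCycle h hij)
  exact h3 _ (hC.isCrossCycle hij hji)

/-- The arcs that a path traverses. -/
def pathArcs (P : List V) : List (V × V) := P.zip P.tail

omit [Fintype V] in
theorem pathArcs_rel {R : V → V → Prop} {P : List V} (h : P.IsChain R) {u v : V}
    (huv : (u, v) ∈ pathArcs P) : R u v ∧ u ∈ P ∧ v ∈ P.tail := by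
  induction P with
  | nil => simp [pathArcs] at huv
  | cons x P ih =>
    cases P with
    | nil => simp [pathArcs] at huv
    | cons y P =>
      rw [List.isChain_cons_cons] at h
      simp only [pathArcs, List.tail_cons, List.zip_cons_cons, List.mem_cons, Prod.mk.injEq] at huv
      rcases huv with ⟨rfl, rfl⟩ | huv
      · exact ⟨h.1, by simp, by simp⟩
      · obtain ⟨h1, h2, h3⟩ := ih h.2 huv
        exact ⟨h1, List.mem_cons_of_mem _ h2, List.mem_cons_of_mem _ h3⟩

omit [Fintype V] in
theorem pathArcs_nodup {P : List V} (h : P.Nodup) : (pathArcs P).Nodup := by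
  induction P with
  | nil => simp [pathArcs]
  | cons x P ih =>
    cases P with
    | nil => simp [pathArcs]
    | cons y P =>
      have h' := List.nodup_cons.1 h
      refine List.nodup_cons.2 ⟨fun hc => h'.1 ?_, ih h'.2⟩
      exact (List.of_mem_zip hc).1

omit [Fintype V] in
theorem cycleArcs_eq {R : V → V → Prop} {i j : V} {C : List V} (h : IsPathFromTo R j i C) :
    cycleArcs C = pathArcs C ++ [(i, j)] := by
  have key : ∀ (l : List V) (x y : V), (x :: l).getLast? = some i →
      (x :: l).zip (l ++ [y]) = (x :: l).zip l ++ [(i, y)] := by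
    intro l
    induction l with
    | nil => intro x y hx; simp at hx; simp [hx]
    | cons z l ih =>
      intro x y hx
      rw [List.getLast?_cons_cons] at hx
      simp only [List.cons_append, List.zip_cons_cons, ih z y hx]
  obtain ⟨h1, h2, -⟩ := h
  cases C with
  | nil => simp at h1
  | cons x l =>
    simp at h1
    subst h1
    simp only [cycleArcs, pathArcs, List.rotate_cons_succ, List.rotate_zero, List.tail_cons]
    exact key l x x h2

omit [Fintype V] in
theorem pathArcs_append {R R' : V → V → Prop} {Q : List V} {a i : V}
    (hQ : IsPathFromTo R' a i Q) : ∀ {P : List V} {j : V}, IsPathFromTo R j a P →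
    pathArcs (P ++ Q.tail) = pathArcs P ++ pathArcs Q := by
  intro P
  induction P with
  | nil => intro j h; simp [IsPathFromTo] at h
  | cons x P ih =>
    intro j hP
    rcases hP.cases with ⟨rfl, h⟩ | ⟨y, P', h, hR, h'⟩
    · simp only [List.cons.injEq] at h
      obtain ⟨rfl, rfl⟩ := h
      rcases hQ.cases with ⟨-, h1⟩ | ⟨y, Q', h1, -, -⟩ <;> subst h1 <;> simp [pathArcs]
    · simp only [List.cons.injEq] at h
      obtain ⟨rfl, rfl⟩ := h
      have := ih h'
      rcases h'.cases with ⟨rfl, h1⟩ | ⟨z, P', h1, -, -⟩ <;> subst h1 <;>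
        simp [pathArcs] at this ⊢ <;> exact this

section ProperCycle

variable {i j a : V} {P Q : List V}

omit [Fintype V] in
/-- The arcs of a proper cycle, split into the arc `(i, j)`, the ascent and the descent. -/
theorem ProperCycle.cycleArcs_perm (hC : ProperCycle R π i j a P Q) :
    (cycleArcs (P ++ Q.tail)).Perm ((i, j) :: (pathArcs P ++ pathArcs Q)) := by
  rw [cycleArcs_eq (R := fun _ _ => True) (i := i) (j := j), pathArcs_append hC.down hC.up]
  · exact List.perm_append_singleton _ _
  · obtain ⟨h1, h2, -⟩ := hC.up
    obtain ⟨h3, h4, -⟩ := hC.down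
    refine ⟨by simp [List.head?_append, h1], ?_, ?_⟩
    · rcases hC.down.cases with ⟨h5, h6⟩ | ⟨y, Q', h6, h7, h8⟩
      · subst h6; simp [h2, h5]
      · subst h6
        simp [List.getLast?_append, h8.2.1]
    · generalize P ++ Q.tail = C
      induction C with
      | nil => simp
      | cons x C ih => cases C <;> simp_all

omit [Fintype V] in
theorem ProperCycle.mem_up (hC : ProperCycle R π i j a P Q) {u v : V}
    (h : (u, v) ∈ pathArcs P) : R u v ∧ π u = some v ∧ Ancestor π u j ∧ Ancestor π a v := by
  obtain ⟨h1, h2, h3⟩ := pathArcs_rel hC.up.2.2 h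
  have h4 := hC.up.reflTransGen.2
  exact ⟨h1.1, h1.2, Climbs.ancestor (h4 u h2).1,
    Climbs.ancestor (h4 v (List.mem_of_mem_tail h3)).2⟩

omit [Fintype V] in
theorem ProperCycle.mem_down (hC : ProperCycle R π i j a P Q) {u v : V}
    (h : (u, v) ∈ pathArcs Q) : π v = some u ∧ Ancestor π v i ∧ Ancestor π a u := by
  obtain ⟨h1, h2, h3⟩ := pathArcs_rel hC.down.2.2 h
  have h4 := hC.down.reflTransGen.2
  exact ⟨h1, (h4 v (List.mem_of_mem_tail h3)).2, (h4 u h2).1⟩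

theorem ProperCycle.mem_cycleArcs (h : IsNumbering R π pre post)
    (hC : ProperCycle R π i j a P Q) {u v : V} (huv : (u, v) ∈ cycleArcs (P ++ Q.tail)) :
    R u v := by
  rw [hC.cycleArcs_perm.mem_iff] at huv
  simp only [List.mem_cons, Prod.mk.injEq, List.mem_append] at huv
  rcases huv with ⟨rfl, rfl⟩ | huv | huv
  · exact hC.arc
  · exact (hC.mem_up huv).1
  · exact h.tree _ _ (hC.mem_down huv).1

theorem ProperCycle.arcs_nodup (h : IsNumbering R π pre post) (hC : ProperCycle R π i j a P Q) :
    (cycleArcs (P ++ Q.tail)).Nodup := by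
  rw [hC.cycleArcs_perm.nodup_iff, List.nodup_cons, List.nodup_append]
  refine ⟨?_, pathArcs_nodup ?_, pathArcs_nodup ?_, ?_⟩
  · rw [List.mem_append]
    rintro (h1 | h1)
    · exact hC.not_short (hC.mem_up h1).2.1
    · exact hC.not_tree (hC.mem_down h1).1
  · have h1 : P.IsChain (fun u v => pre v < pre u) :=
      hC.up.2.2.imp fun u v huv => h.tree_lt _ _ huv.2
    have : IsTrans V (fun u v => pre v < pre u) := ⟨fun _ _ _ h1 h2 => h2.trans h1⟩
    exact h1.pairwise.imp fun hlt heq => by subst heq; exact lt_irrefl _ hlt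
  · have h1 : Q.IsChain (fun u v => pre u < pre v) :=
      hC.down.2.2.imp fun u v huv => h.tree_lt _ _ huv
    have : IsTrans V (fun u v => pre u < pre v) := ⟨fun _ _ _ h1 h2 => h1.trans h2⟩
    exact h1.pairwise.imp fun hlt heq => by subst heq; exact lt_irrefl _ hlt
  · rintro ⟨u, v⟩ h1 _ h2 rfl
    have h3 := h.tree_lt _ _ (hC.mem_up h1).2.1
    have h4 := h.tree_lt _ _ (hC.mem_down h2).1
    omega

/-- A proper cycle does not pass an arc in both directions. -/
theorem ProperCycle.arcs_asymm (h : IsNumbering R π pre post) (hC : ProperCycle R π i j a P Q)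
    {u v : V} (huv : (u, v) ∈ cycleArcs (P ++ Q.tail)) : (v, u) ∉ cycleArcs (P ++ Q.tail) := by
  have key : ∀ u v, (u, v) ∈ pathArcs P → (v, u) ∉ pathArcs Q := by
    intro u v h1 h2
    obtain ⟨-, h3, h4, h5⟩ := hC.mem_up h1
    obtain ⟨-, h6, -⟩ := hC.mem_down h2
    have h7 := ((h.anc _ _).1 (hC.fca.2.2 u h6 h4)).1
    have h8 := ((h.anc _ _).1 h5).1
    have h9 := h.tree_lt _ _ h3
    omega
  rw [hC.cycleArcs_perm.mem_iff] at huv ⊢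
  simp only [List.mem_cons, Prod.mk.injEq, List.mem_append, not_or] at huv ⊢
  have hne := hC.ne
  rcases huv with ⟨rfl, rfl⟩ | huv | huv
  · exact ⟨fun hc => hne hc.2, fun hc => hC.not_tree (hC.mem_up hc).2.1,
      fun hc => hC.not_short (hC.mem_down hc).1⟩
  · obtain ⟨-, h3, -, -⟩ := hC.mem_up huv
    refine ⟨?_, fun hc => ?_, key _ _ huv⟩
    · rintro ⟨rfl, rfl⟩
      exact hC.not_tree h3
    · have h4 := h.tree_lt _ _ h3
      have h5 := h.tree_lt _ _ (hC.mem_up hc).2.1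
      omega
  · obtain ⟨h3, -, -⟩ := hC.mem_down huv
    refine ⟨?_, fun hc => key _ _ hc huv, fun hc => ?_⟩
    · rintro ⟨rfl, rfl⟩
      exact hC.not_short h3
    · have h4 := h.tree_lt _ _ h3
      have h5 := h.tree_lt _ _ (hC.mem_down hc).1
      omega

end ProperCycle

end Forest

section Flows

variable {n m : ℕ}

/-! ### Integer flows and the optimality conditions -/

/-- The part of admissibility that the algorithm relies on: no two arcs join the same two nodes,
and there are no loops. -/
structure Network.IsSimple (N : Network n m) : Prop where
  simple : ∀ a a' : Fin m, N.tail a = N.tail a' → N.head a = N.head a' → a = a'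
  no_antiparallel : ∀ a a' : Fin m, ¬ (N.tail a = N.head a' ∧ N.head a = N.tail a')

/-- The net outflow of `x` at the node `i`. -/
def Network.div {A : Type*} [AddCommGroup A] (N : Network n m) (x : Fin m → A) (i : Fin n) : A :=
  (∑ a with N.tail a = i, x a) - (∑ a with N.head a = i, x a)

/-- Feasible integer flows. -/
structure Network.IntFlow (N : Network n m) (f : Fin m → ℤ) : Prop where
  lo_le : ∀ a, N.lo a ≤ f a
  le_up : ∀ a, f a ≤ N.up a
  balance : ∀ i, N.div f i = N.b i

/-- The feasible integer flows that agree with `f` on the arcs of non-zero reduced cost. -/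
def Network.flowsLike (N : Network n m) (cbar : Fin m → ℝ) (f : Fin m → ℤ) :
    Set (Fin m → ℤ) :=
  {g | N.IntFlow g ∧ ∀ a, cbar a ≠ 0 → g a = f a}

theorem Network.Admissible.isSimple {N : Network n m} (h : N.Admissible) : N.IsSimple :=
  ⟨h.simple, h.no_antiparallel⟩

theorem Network.intFlow_iff {N : Network n m} {f : Fin m → ℤ} :
    N.IntFlow f ↔ N.IsFlow (fun a => (f a : ℝ)) := by
  constructor
  · rintro ⟨h1, h2, h3⟩
    refine ⟨fun a => by exact_mod_cast h1 a, fun a => by exact_mod_cast h2 a, fun i => ?_⟩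
    rw [← h3 i]
    simp [Network.div]
  · rintro ⟨h1, h2, h3⟩
    refine ⟨fun a => by exact_mod_cast h1 a, fun a => by exact_mod_cast h2 a, fun i => ?_⟩
    have := h3 i
    simp only [Network.div]
    exact_mod_cast this

theorem Network.flowsLike_finite (N : Network n m) (cbar : Fin m → ℝ) (f : Fin m → ℤ) :
    (N.flowsLike cbar f).Finite :=
  (Set.finite_Icc N.lo N.up).subset fun _ hg => ⟨hg.1.lo_le, hg.1.le_up⟩

/-- Passing to reduced costs changes the cost of all flows by the same amount. -/
theorem Network.sum_reducedCost (N : Network n m) (y : Fin n → ℝ) {x : Fin m → ℝ}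
    (hx : N.IsFlow x) : ∑ a, N.reducedCost y a * x a = N.cost x + ∑ i, y i * N.b i := by
  have h1 : ∑ i, y i * N.b i = ∑ a, y (N.tail a) * x a - ∑ a, y (N.head a) * x a := by
    rw [← Finset.sum_fiberwise Finset.univ N.tail, ← Finset.sum_fiberwise Finset.univ N.head,
      ← Finset.sum_sub_distrib]
    refine Finset.sum_congr rfl fun i _ => ?_
    rw [← hx.balance i, mul_sub, Finset.mul_sum, Finset.mul_sum]
    congr 1 <;> refine Finset.sum_congr rfl fun a ha => ?_ <;>
      simp only [Finset.mem_filter, Finset.mem_univ, true_and] at ha <;> rw [ha]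
  rw [h1, Network.cost, ← Finset.sum_sub_distrib, ← Finset.sum_add_distrib]
  refine Finset.sum_congr rfl fun a _ => ?_
  simp only [Network.reducedCost]
  ring

/-- For an optimal potential, the optimal flows are the flows that agree on the arcs of non-zero
reduced cost with an optimal flow `x` that satisfies complementary slackness. -/
theorem Network.isOptimal_iff {N : Network n m} {y : Fin n → ℝ} {x : Fin m → ℝ} (hx : N.IsOptimal x)
    (hcs : ∀ a, (0 < N.reducedCost y a → x a = N.lo a) ∧ (N.reducedCost y a < 0 → x a = N.up a))
    {x' : Fin m → ℝ} (hx' : N.IsFlow x') :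
    N.IsOptimal x' ↔ ∀ a, N.reducedCost y a ≠ 0 → x' a = x a := by
  have hle : ∀ a ∈ Finset.univ, N.reducedCost y a * x a ≤ N.reducedCost y a * x' a := by
    intro a _
    rcases lt_trichotomy (N.reducedCost y a) 0 with h | h | h
    · rw [(hcs a).2 h]
      exact mul_le_mul_of_nonpos_left (hx'.le_up a) h.le
    · simp [h]
    · rw [(hcs a).1 h]
      exact mul_le_mul_of_nonneg_left (hx'.lo_le a) h.le
  have hc : N.cost x' = N.cost x ↔
      ∑ a, N.reducedCost y a * x a = ∑ a, N.reducedCost y a * x' a := by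
    rw [N.sum_reducedCost y hx.1, N.sum_reducedCost y hx']
    constructor <;> intro h <;> linarith
  have hopt : N.IsOptimal x' ↔ N.cost x' = N.cost x := by
    constructor
    · intro h
      exact le_antisymm (h.2 _ hx.1) (hx.2 _ hx')
    · intro h
      exact ⟨hx', fun z hz => h ▸ hx.2 z hz⟩
  rw [hopt, hc, Finset.sum_eq_sum_iff_of_le hle]
  constructor
  · intro h a ha
    exact (mul_left_cancel₀ ha (h a (Finset.mem_univ a))).symm
  · intro h a _
    by_cases ha : N.reducedCost y a = 0
    · simp [ha]
    · rw [h a ha]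

theorem Network.isOptInt_iff {N : Network n m} {y : Fin n → ℝ} (hy : N.IsOptPotential y)
    {f : Fin m → ℤ} (hf : N.IsOptInt f) (g : Fin m → ℤ) :
    N.IsOptInt g ↔ g ∈ N.flowsLike (N.reducedCost y) f := by
  obtain ⟨x, hx, hcs⟩ := hy
  have hf' := (Network.isOptimal_iff hx hcs hf.1).1 hf
  simp only [Network.flowsLike, Set.mem_ofPred_eq, Network.intFlow_iff]
  constructor
  · intro hg
    have hg' := (Network.isOptimal_iff hx hcs hg.1).1 hg
    refine ⟨hg.1, fun a ha => ?_⟩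
    have := (hg' a ha).trans (hf' a ha).symm
    exact_mod_cast this
  · rintro ⟨h1, h2⟩
    refine (Network.isOptimal_iff hx hcs h1).2 fun a ha => ?_
    rw [h2 a ha]
    exact hf' a ha

/-! ### Augmentation along proper cycles -/

/-- The unit flow along the network arc between `p.1` and `p.2`: `1` on the arc `(p.1, p.2)` and
`-1` on the arc `(p.2, p.1)`. -/
def Network.arcUnit (N : Network n m) (p : Fin n × Fin n) (a : Fin m) : ℤ :=
  (if N.tail a = p.1 ∧ N.head a = p.2 then 1 else 0) -
    (if N.head a = p.1 ∧ N.tail a = p.2 then 1 else 0)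

theorem Network.div_add (N : Network n m) (x x' : Fin m → ℤ) (i : Fin n) :
    N.div (x + x') i = N.div x i + N.div x' i := by
  simp only [Network.div, Pi.add_apply, Finset.sum_add_distrib]
  ring

theorem Network.div_sub (N : Network n m) (x x' : Fin m → ℤ) (i : Fin n) :
    N.div (x - x') i = N.div x i - N.div x' i := by
  simp only [Network.div, Pi.sub_apply, Finset.sum_sub_distrib]
  ring

theorem Network.div_single (N : Network n m) (a : Fin m) (z : ℤ) (i : Fin n) :
    N.div (Pi.single a z) i =
      (if N.tail a = i then z else 0) - (if N.head a = i then z else 0) := by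
  simp [Network.div, Pi.single_apply]

theorem Network.IsSimple.arcUnit_forward {N : Network n m} (hN : N.IsSimple) (a : Fin m) :
    N.arcUnit (N.tail a, N.head a) = Pi.single a 1 := by
  ext a'
  by_cases h : a' = a
  · subst h
    have := hN.no_antiparallel a' a'
    simp only [not_and'] at this
    simp only [Network.arcUnit, and_self, if_true, Pi.single_eq_same]
    rw [if_neg]
    · simp
    · rintro ⟨h1, h2⟩; exact this h1 h2
  · have h1 : ¬ (N.tail a' = N.tail a ∧ N.head a' = N.head a) :=
      fun h' => h (hN.simple _ _ h'.1 h'.2)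
    have h2 : ¬ (N.head a' = N.tail a ∧ N.tail a' = N.head a) :=
      fun h' => hN.no_antiparallel a' a ⟨h'.2, h'.1⟩
    simp [Network.arcUnit, h1, h2, h]

theorem Network.arcUnit_swap (N : Network n m) (u v : Fin n) :
    N.arcUnit (v, u) = - N.arcUnit (u, v) := by
  ext a
  simp only [Network.arcUnit, Pi.neg_apply, neg_sub]
  congr 1 <;> simp only [and_comm]

theorem Network.IsSimple.arcUnit_backward {N : Network n m} (hN : N.IsSimple) (a : Fin m) :
    N.arcUnit (N.head a, N.tail a) = Pi.single a (-1) := by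
  rw [N.arcUnit_swap, hN.arcUnit_forward, Pi.single_neg]

theorem Network.IsSimple.div_arcUnit {N : Network n m} (hN : N.IsSimple) {cbar : Fin m → ℝ}
    {f : Fin m → ℤ} {u v : Fin n} (h : N.ResArc cbar f u v) (i : Fin n) :
    N.div (N.arcUnit (u, v)) i = (if u = i then 1 else 0) - (if v = i then 1 else 0) := by
  obtain ⟨a, -, ⟨rfl, rfl, -⟩ | ⟨rfl, rfl, -⟩⟩ := h
  · rw [hN.arcUnit_forward, N.div_single]
  · rw [hN.arcUnit_backward, N.div_single]
    split_ifs <;> simp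

/-- The incidence vector of a cycle is the sum of the unit flows along its arcs. -/
theorem Network.chi_eq_sum (N : Network n m) {C : List (Fin n)} (h1 : (cycleArcs C).Nodup)
    (h2 : ∀ u v, (u, v) ∈ cycleArcs C → (v, u) ∉ cycleArcs C) (a : Fin m) :
    N.chi C a = ((cycleArcs C).map fun p => N.arcUnit p a).sum := by
  have key : ∀ L : List (Fin n × Fin n), (L.map fun p => N.arcUnit p a).sum =
      (L.count (N.tail a, N.head a) : ℤ) - L.count (N.head a, N.tail a) := by
    intro L
    induction L with
    | nil => simp
    | cons p L ih =>
      obtain ⟨u, v⟩ := p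
      rw [List.map_cons, List.sum_cons, ih]
      simp only [List.count_cons, Network.arcUnit, beq_iff_eq,
        Prod.mk.injEq, eq_comm (a := u), eq_comm (a := v)]
      push_cast
      ring
  rw [key, h1.count, h1.count, Network.chi]
  have := h2 (N.tail a) (N.head a)
  split_ifs <;> simp_all

theorem Network.div_sum_pathArcs {N : Network n m} (hN : N.IsSimple) {cbar : Fin m → ℝ}
    {f : Fin m → ℤ} {R : Fin n → Fin n → Prop} (i : Fin n)
    (hR : ∀ u v, R u v → N.ResArc cbar f u v) :
    ∀ {P : List (Fin n)} {x z : Fin n}, IsPathFromTo R x z P →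
      N.div (fun a => ((pathArcs P).map fun p => N.arcUnit p a).sum) i =
        (if x = i then 1 else 0) - (if z = i then 1 else 0) := by
  intro P
  induction P with
  | nil => intro x z h; simp [IsPathFromTo] at h
  | cons w P ih =>
    intro x z h
    rcases h.cases with ⟨rfl, hP⟩ | ⟨y, P', h, hxy, h'⟩
    · simp only [List.cons.injEq] at hP
      simp [hP, pathArcs, Network.div]
    · simp only [List.cons.injEq] at h
      obtain ⟨rfl, rfl⟩ := h
      have e : pathArcs (w :: P) = (w, y) :: pathArcs P := by
        rcases h'.cases with ⟨-, h1⟩ | ⟨z, P', h1, -, -⟩ <;> subst h1 <;> simp [pathArcs]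
      have e2 : (fun a => ((pathArcs (w :: P)).map fun p => N.arcUnit p a).sum) =
          N.arcUnit (w, y) + fun a => ((pathArcs P).map fun p => N.arcUnit p a).sum := by
        ext a; simp [e]
      rw [e2, N.div_add, ih h', hN.div_arcUnit (hR _ _ hxy)]
      ring

section Cycle

variable {N : Network n m} {cbar : Fin m → ℝ} {f : Fin m → ℤ} {π : Fin n → Option (Fin n)}
  {pre : Fin n → ℕ} {post : Fin n → ℕ∞} {i j a : Fin n} {P Q : List (Fin n)}

theorem Network.IsSimple.resArc_irrefl (hN : N.IsSimple) (v : Fin n) : ¬ N.ResArc cbar f v v := by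
  rintro ⟨a, -, ⟨h1, h2, -⟩ | ⟨h1, h2, -⟩⟩
  · exact hN.no_antiparallel a a ⟨h1.trans h2.symm, h2.trans h1.symm⟩
  · exact hN.no_antiparallel a a ⟨h2.trans h1.symm, h1.trans h2.symm⟩

theorem Network.IsSimple.resArc_forward (hN : N.IsSimple) {a : Fin m}
    (h : N.ResArc cbar f (N.tail a) (N.head a)) : cbar a = 0 ∧ f a < N.up a := by
  obtain ⟨a', h0, ⟨h1, h2, h3⟩ | ⟨h1, h2, h3⟩⟩ := h
  · cases hN.simple _ _ h1 h2
    exact ⟨h0, h3⟩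
  · exact absurd ⟨h2, h1⟩ (hN.no_antiparallel a' a)

theorem Network.IsSimple.resArc_backward (hN : N.IsSimple) {a : Fin m}
    (h : N.ResArc cbar f (N.head a) (N.tail a)) : cbar a = 0 ∧ N.lo a < f a := by
  obtain ⟨a', h0, ⟨h1, h2, h3⟩ | ⟨h1, h2, h3⟩⟩ := h
  · exact absurd ⟨h1, h2⟩ (hN.no_antiparallel a' a)
  · cases hN.simple _ _ h2 h1
    exact ⟨h0, h3⟩

theorem ProperCycle.augment_eq (hN : N.IsSimple) (h : IsNumbering (N.ResArc cbar f) π pre post)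
    (hC : ProperCycle (N.ResArc cbar f) π i j a P Q) :
    N.augment cbar f (P ++ Q.tail) = f + N.chi (P ++ Q.tail) := by
  ext b
  simp only [Network.augment, Pi.add_apply]
  split_ifs with hb
  · rfl
  · have : N.chi (P ++ Q.tail) b = 0 := by
      simp only [Network.chi]
      split_ifs with h1 h2
      · exact absurd (hN.resArc_forward (hC.mem_cycleArcs h h1)).1 hb
      · exact absurd (hN.resArc_backward (hC.mem_cycleArcs h h2)).1 hb
      · rfl
    simp [this]

/-- The augmentation along a proper cycle, as a sum over its three parts. -/
theorem ProperCycle.augment_eq_sum (hN : N.IsSimple)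
    (h : IsNumbering (N.ResArc cbar f) π pre post)
    (hC : ProperCycle (N.ResArc cbar f) π i j a P Q) :
    N.augment cbar f (P ++ Q.tail) = f + N.arcUnit (i, j) +
      (fun b => ((pathArcs P).map fun p => N.arcUnit p b).sum) +
      fun b => ((pathArcs Q).map fun p => N.arcUnit p b).sum := by
  rw [hC.augment_eq hN h]
  ext b
  simp only [Pi.add_apply]
  rw [N.chi_eq_sum (hC.arcs_nodup h) (fun u v => hC.arcs_asymm h),
    (hC.cycleArcs_perm.map _).sum_eq]
  simp
  ring

theorem ProperCycle.augment_mem (hN : N.IsSimple) (hf : N.IntFlow f)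
    (h : IsNumbering (N.ResArc cbar f) π pre post)
    (hC : ProperCycle (N.ResArc cbar f) π i j a P Q) :
    N.augment cbar f (P ++ Q.tail) ∈ N.flowsLike cbar f ∧ N.augment cbar f (P ++ Q.tail) ≠ f := by
  have hchi : ∀ b, (cbar b = 0 ∧ N.chi (P ++ Q.tail) b = 1 ∧ f b < N.up b) ∨
      (cbar b = 0 ∧ N.chi (P ++ Q.tail) b = -1 ∧ N.lo b < f b) ∨ N.chi (P ++ Q.tail) b = 0 := by
    intro b
    simp only [Network.chi]
    split_ifs with h1 h2
    · have := hN.resArc_forward (hC.mem_cycleArcs h h1)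
      simp [this]
    · have := hN.resArc_backward (hC.mem_cycleArcs h h2)
      simp [this]
    · simp
  refine ⟨⟨⟨fun b => ?_, fun b => ?_, fun k => ?_⟩, fun b hb => ?_⟩, fun hc => ?_⟩
  · rw [hC.augment_eq hN h, Pi.add_apply]
    have := hf.lo_le b
    rcases hchi b with h | h | h <;> omega
  · rw [hC.augment_eq hN h, Pi.add_apply]
    have := hf.le_up b
    rcases hchi b with h | h | h <;> omega
  · rw [hC.augment_eq_sum hN h, N.div_add, N.div_add, N.div_add, hN.div_arcUnit hC.arc,
      Network.div_sum_pathArcs hN k (fun u v (huv : ShortBackArc _ π u v) => huv.1) hC.up,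
      Network.div_sum_pathArcs hN k (fun u v (huv : TreeArc π u v) => h.tree _ _ huv) hC.down,
      hf.balance]
    ring
  · simp [Network.augment, hb]
  · rw [hC.augment_eq hN h] at hc
    have hc' : ∀ b, N.chi (P ++ Q.tail) b = 0 := fun b => by simpa using congrFun hc b
    have hmem : (i, j) ∈ cycleArcs (P ++ Q.tail) := by
      rw [hC.cycleArcs_perm.mem_iff]; simp
    obtain ⟨b, -, ⟨h1, h2, -⟩ | ⟨h1, h2, -⟩⟩ := hC.arc
    · have := hc' b
      simp [Network.chi, h1, h2, hmem] at this
    · have := hc' b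
      simp only [Network.chi, h1, h2, hmem] at this
      split_ifs at this
      simp_all

end Cycle

/-- A result of the search for another flow is another flow of the same kind; and if the search
fails, then there is no other one. -/
theorem FindAnotherOptimalFlow.spec {N : Network n m} {cbar : Fin m → ℝ} {f : Fin m → ℤ}
    (hN : N.IsSimple) (hf : N.IntFlow f) {o : Option (Fin m → ℤ)}
    (h : FindAnotherOptimalFlow N cbar f o) :
    (∀ g, o = some g → g ∈ N.flowsLike cbar f ∧ g ≠ f) ∧
      (o = none → N.flowsLike cbar f = {f}) := by
  cases h with
  | backward π C h1 h2 =>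
    obtain ⟨pre, post, hnum⟩ := h1.exists_numbering
    obtain ⟨i, j, h3, h4⟩ := h2
    have hC := h3.properCycle hnum hN.resArc_irrefl h4
    have e : [j] ++ C.tail = C := by
      rcases h4.cases with ⟨-, h1⟩ | ⟨y, Q', h1, -, -⟩ <;> subst h1 <;> rfl
    have := hC.augment_mem hN hf hnum
    rw [e] at this
    simpa using this
  | forward π C h1 _ h2 =>
    obtain ⟨pre, post, hnum⟩ := h1.exists_numbering
    obtain ⟨i, j, h3, h4⟩ := h2
    have hC := h3.properCycle hnum hN.resArc_irrefl h4
    have := hC.augment_mem hN hf hnum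
    simpa using this
  | cross π C h1 _ _ h2 =>
    obtain ⟨pre, post, hnum⟩ := h1.exists_numbering
    obtain ⟨i, j, a, P, Q, h3, h4, h5, h6, rfl⟩ := h2
    have hC := h3.properCycle h4 h5 h6
    have := hC.augment_mem hN hf hnum
    simpa using this
  | null π h1 h2 h3 h4 =>
    obtain ⟨pre, post, hnum⟩ := h1.exists_numbering
    refine ⟨by simp, fun _ => Set.eq_singleton_iff_unique_mem.2 ⟨⟨hf, fun _ _ => rfl⟩, ?_⟩⟩
    intro g hg
    by_contra hne
    -- the support of the circulation `g - f`
    let S : Fin n → Fin n → Prop := fun x y =>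
      ∃ a, (N.tail a = x ∧ N.head a = y ∧ f a < g a) ∨ (N.head a = x ∧ N.tail a = y ∧ g a < f a)
    have hS : ∀ x y, ¬ S x y := by
      refine hnum.no_circulation (hnum.no_properCycle h2 h3 h4) ?_ ?_ ?_
      · rintro x y ⟨a, h⟩
        refine ⟨a, ?_, ?_⟩
        · by_contra hc
          have := hg.2 a hc
          omega
        · have h1 := hg.1.lo_le a
          have h2 := hg.1.le_up a
          rcases h with ⟨h3, h4, h5⟩ | ⟨h3, h4, h5⟩
          · exact .inl ⟨h3, h4, by omega⟩
          · exact .inr ⟨h3, h4, by omega⟩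
      · rintro x y ⟨a, ⟨h1, h2, h3⟩ | ⟨h1, h2, h3⟩⟩ ⟨a', ⟨h4, h5, h6⟩ | ⟨h4, h5, h6⟩⟩
        · exact hN.no_antiparallel a a' ⟨h1.trans h5.symm, h2.trans h4.symm⟩
        · cases hN.simple a a' (h1.trans h5.symm) (h2.trans h4.symm); omega
        · cases hN.simple a a' (h2.trans h4.symm) (h1.trans h5.symm); omega
        · exact hN.no_antiparallel a a' ⟨h2.trans h4.symm, h1.trans h5.symm⟩
      · rintro x y ⟨b, hb⟩
        by_contra! hno
        -- without an entering arc, all terms of the net outflow of `g - f` at `x` have one sign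
        have hd : N.div (g - f) x = 0 := by rw [N.div_sub, hg.1.balance, hf.balance, sub_self]
        have h1 : ∀ a ∈ Finset.univ.filter (fun a => N.tail a = x), 0 ≤ (g - f) a := by
          intro a ha
          simp only [Finset.mem_filter, Finset.mem_univ, true_and] at ha
          by_contra hc
          exact hno (N.head a) ⟨a, .inr ⟨rfl, ha, by simpa using hc⟩⟩
        have h2 : ∀ a ∈ Finset.univ.filter (fun a => N.head a = x), (g - f) a ≤ 0 := by
          intro a ha
          simp only [Finset.mem_filter, Finset.mem_univ, true_and] at ha
          by_contra hc
          exact hno (N.tail a) ⟨a, .inl ⟨rfl, ha, by simpa using hc⟩⟩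
        have h3 := Finset.sum_nonneg h1
        have h4 := Finset.sum_nonpos h2
        rw [Network.div] at hd
        rcases hb with ⟨hb1, hb2, hb3⟩ | ⟨hb1, hb2, hb3⟩
        · have := (Finset.sum_eq_zero_iff_of_nonneg h1).1 (by omega) b (by simp [hb1])
          simp only [Pi.sub_apply] at this
          omega
        · have := (Finset.sum_eq_zero_iff_of_nonpos h2).1 (by omega) b (by simp [hb1])
          simp only [Pi.sub_apply] at this
          omega
    refine hne (funext fun a => ?_)
    by_contra hc
    rcases lt_or_gt_of_ne hc with h | h
    · exact hS _ _ ⟨a, .inr ⟨rfl, rfl, h⟩⟩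
    · exact hS _ _ ⟨a, .inl ⟨rfl, rfl, h⟩⟩

/-! ### Branching -/

section Branch

variable {N : Network n m} {cbar : Fin m → ℝ} {f g : Fin m → ℤ} {a : Fin m}

theorem Network.setUp_intFlow_iff {z : ℤ} {h : Fin m → ℤ} :
    (N.setUp a z).IntFlow h ↔ (∀ b, N.lo b ≤ h b) ∧ (∀ b, b ≠ a → h b ≤ N.up b) ∧ h a ≤ z ∧
      ∀ i, N.div h i = N.b i := by
  constructor
  · rintro ⟨h1, h2, h3⟩
    refine ⟨h1, fun b hb => ?_, ?_, h3⟩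
    · simpa [Network.setUp, Function.update_of_ne hb] using h2 b
    · simpa [Network.setUp] using h2 a
  · rintro ⟨h1, h2, h3, h4⟩
    refine ⟨h1, fun b => ?_, h4⟩
    by_cases hb : b = a
    · subst hb; simpa [Network.setUp] using h3
    · simpa [Network.setUp, Function.update_of_ne hb] using h2 b hb

theorem Network.setLo_intFlow_iff {z : ℤ} {h : Fin m → ℤ} :
    (N.setLo a z).IntFlow h ↔ (∀ b, b ≠ a → N.lo b ≤ h b) ∧ z ≤ h a ∧ (∀ b, h b ≤ N.up b) ∧
      ∀ i, N.div h i = N.b i := by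
  constructor
  · rintro ⟨h1, h2, h3⟩
    refine ⟨fun b hb => ?_, ?_, h2, h3⟩
    · simpa [Network.setLo, Function.update_of_ne hb] using h1 b
    · simpa [Network.setLo] using h1 a
  · rintro ⟨h1, h2, h3, h4⟩
    refine ⟨fun b => ?_, h3, h4⟩
    by_cases hb : b = a
    · subst hb; simpa [Network.setLo] using h2
    · simpa [Network.setLo, Function.update_of_ne hb] using h1 b hb

theorem Network.IntFlow.setUp_iff {z : ℤ} {h : Fin m → ℤ} (hz : z ≤ N.up a) :
    (N.setUp a z).IntFlow h ↔ N.IntFlow h ∧ h a ≤ z := by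
  rw [Network.setUp_intFlow_iff]
  constructor
  · rintro ⟨h1, h2, h3, h4⟩
    refine ⟨⟨h1, fun b => ?_, h4⟩, h3⟩
    by_cases hb : b = a
    · subst hb; omega
    · exact h2 b hb
  · rintro ⟨⟨h1, h2, h3⟩, h4⟩
    exact ⟨h1, fun b _ => h2 b, h4, h3⟩

theorem Network.IntFlow.setLo_iff {z : ℤ} {h : Fin m → ℤ} (hz : N.lo a ≤ z) :
    (N.setLo a z).IntFlow h ↔ N.IntFlow h ∧ z ≤ h a := by
  rw [Network.setLo_intFlow_iff]
  constructor
  · rintro ⟨h1, h2, h3, h4⟩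
    refine ⟨⟨fun b => ?_, h3, h4⟩, h2⟩
    by_cases hb : b = a
    · subst hb; omega
    · exact h1 b hb
  · rintro ⟨⟨h1, h2, h3⟩, h4⟩
    exact ⟨fun b _ => h1 b, h4, h2, h3⟩

/-- The flows of the call for `N` and `f` are divided between a call for `N₁` and `f` and a call for
`N₂` and `g`. -/
structure Splits (N : Network n m) (cbar : Fin m → ℝ) (f g : Fin m → ℤ) (N₁ N₂ : Network n m) :
    Prop where
  left : N₁.IntFlow f
  right : N₂.IntFlow g
  union : N.flowsLike cbar f = N₁.flowsLike cbar f ∪ N₂.flowsLike cbar g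
  disjoint : Disjoint (N₁.flowsLike cbar f) (N₂.flowsLike cbar g)

theorem Splits.up (hf : N.IntFlow f) (hg : g ∈ N.flowsLike cbar f) (h : f a < g a) :
    Splits N cbar f g (N.setUp a (f a)) (N.setLo a (f a + 1)) := by
  have hu : ∀ h, (N.setUp a (f a)).IntFlow h ↔ N.IntFlow h ∧ h a ≤ f a :=
    fun h => Network.IntFlow.setUp_iff (hf.le_up a)
  have hl : ∀ h, (N.setLo a (f a + 1)).IntFlow h ↔ N.IntFlow h ∧ f a + 1 ≤ h a :=
    fun h => Network.IntFlow.setLo_iff ((hf.lo_le a).trans (by omega))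
  refine ⟨(hu f).2 ⟨hf, le_rfl⟩, (hl g).2 ⟨hg.1, h⟩, ?_, ?_⟩
  · ext x
    simp only [Network.flowsLike, Set.mem_ofPred_eq, Set.mem_union, hu, hl]
    constructor
    · rintro ⟨h1, h2⟩
      by_cases hx : x a ≤ f a
      · exact .inl ⟨⟨h1, hx⟩, h2⟩
      · exact .inr ⟨⟨h1, by omega⟩, fun b hb => (h2 b hb).trans (hg.2 b hb).symm⟩
    · rintro (⟨⟨h1, h2⟩, h3⟩ | ⟨⟨h1, h2⟩, h3⟩)
      · exact ⟨h1, h3⟩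
      · exact ⟨h1, fun b hb => (h3 b hb).trans (hg.2 b hb)⟩
  · rw [Set.disjoint_left]
    rintro x hx hx'
    have h1 := ((hu x).1 hx.1).2
    have h2 := ((hl x).1 hx'.1).2
    omega

theorem Splits.down (hf : N.IntFlow f) (hg : g ∈ N.flowsLike cbar f) (h : g a < f a) :
    Splits N cbar f g (N.setLo a (f a)) (N.setUp a (f a - 1)) := by
  have hl : ∀ h, (N.setLo a (f a)).IntFlow h ↔ N.IntFlow h ∧ f a ≤ h a :=
    fun h => Network.IntFlow.setLo_iff (hf.lo_le a)
  have hu : ∀ h, (N.setUp a (f a - 1)).IntFlow h ↔ N.IntFlow h ∧ h a ≤ f a - 1 :=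
    fun h => Network.IntFlow.setUp_iff (le_trans (by omega) (hf.le_up a))
  refine ⟨(hl f).2 ⟨hf, le_rfl⟩, (hu g).2 ⟨hg.1, by omega⟩, ?_, ?_⟩
  · ext x
    simp only [Network.flowsLike, Set.mem_ofPred_eq, Set.mem_union, hu, hl]
    constructor
    · rintro ⟨h1, h2⟩
      by_cases hx : f a ≤ x a
      · exact .inl ⟨⟨h1, hx⟩, h2⟩
      · exact .inr ⟨⟨h1, by omega⟩, fun b hb => (h2 b hb).trans (hg.2 b hb).symm⟩
    · rintro (⟨⟨h1, h2⟩, h3⟩ | ⟨⟨h1, h2⟩, h3⟩)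
      · exact ⟨h1, h3⟩
      · exact ⟨h1, fun b hb => (h3 b hb).trans (hg.2 b hb)⟩
  · rw [Set.disjoint_left]
    rintro x hx hx'
    have h1 := ((hl x).1 hx.1).2
    have h2 := ((hu x).1 hx'.1).2
    omega

theorem Splits.enumerates {N₁ N₂ : Network n m} (hs : Splits N cbar f g N₁ N₂)
    {L₁ L₂ : List (Fin m → ℤ)}
    (h1 : (f :: L₁).Nodup ∧ ∀ x, x ∈ f :: L₁ ↔ x ∈ N₁.flowsLike cbar f)
    (h2 : (g :: L₂).Nodup ∧ ∀ x, x ∈ g :: L₂ ↔ x ∈ N₂.flowsLike cbar g) :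
    (f :: g :: (L₁ ++ L₂)).Nodup ∧
      ∀ x, x ∈ f :: g :: (L₁ ++ L₂) ↔ x ∈ N.flowsLike cbar f := by
  have hp : (f :: g :: (L₁ ++ L₂)).Perm ((f :: L₁) ++ (g :: L₂)) := by
    rw [List.cons_append]
    exact (List.perm_middle.symm).cons f
  refine ⟨hp.nodup_iff.2 (List.nodup_append.2 ⟨h1.1, h2.1, ?_⟩), fun x => ?_⟩
  · rintro x hx y hy rfl
    exact Set.disjoint_left.1 hs.disjoint ((h1.2 x).1 hx) ((h2.2 x).1 hy)
  · rw [hp.mem_iff, List.mem_append, h1.2, h2.2, hs.union, Set.mem_union]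

theorem Splits.ncard_add {N₁ N₂ : Network n m} (hs : Splits N cbar f g N₁ N₂) :
    (N₁.flowsLike cbar f).ncard + (N₂.flowsLike cbar g).ncard = (N.flowsLike cbar f).ncard := by
  rw [hs.union, Set.ncard_union_eq hs.disjoint (N₁.flowsLike_finite _ _) (N₂.flowsLike_finite _ _)]

theorem Network.IntFlow.ncard_pos (hf : N.IntFlow f) : 1 ≤ (N.flowsLike cbar f).ncard :=
  (Set.ncard_pos (N.flowsLike_finite _ _)).2 ⟨f, hf, fun _ _ => rfl⟩

end Branch

/-- Every run of the algorithm enumerates the flows that agree with the given one on the arcs of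
non-zero reduced cost. -/
theorem FindAllOptimalFlows.enumerates {cbar : Fin m → ℝ} {N : Network n m} {f : Fin m → ℤ}
    {L : List (Fin m → ℤ)} (h : FindAllOptimalFlows cbar N f L) (hN : N.IsSimple)
    (hf : N.IntFlow f) :
    (f :: L).Nodup ∧ ∀ g, g ∈ f :: L ↔ g ∈ N.flowsLike cbar f := by
  induction h with
  | halt N f h =>
    rw [(h.spec hN hf).2 rfl]
    simp
  | branch_up N f g a L₁ L₂ h hlt _ _ ih₁ ih₂ =>
    have hs := Splits.up hf ((h.spec hN hf).1 g rfl).1 hlt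
    exact hs.enumerates (ih₁ ⟨hN.1, hN.2⟩ hs.left) (ih₂ ⟨hN.1, hN.2⟩ hs.right)
  | branch_down N f g a L₁ L₂ h hlt _ _ ih₁ ih₂ =>
    have hs := Splits.down hf ((h.spec hN hf).1 g rfl).1 hlt
    exact hs.enumerates (ih₁ ⟨hN.1, hN.2⟩ hs.left) (ih₂ ⟨hN.1, hN.2⟩ hs.right)

end Flows

/-! ### The depth-first search program

The memory of the enumeration program. Half-edges are numbered from `0` to `2m-1`: the half-edge `a`
passes the arc `a` forwards, the half-edge `m + a` passes it backwards.

* Integer arrays `0`, `1`, `2`: the stack of pending calls (flows, lower and upper capacities).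
* Integer arrays `3`, `4`, `5`: source, target and reversal of each half-edge.
* Integer arrays `6`, `7`: the lists of the half-edges that leave a node, as linked lists: the next
  half-edge, and the first half-edge of each node.
* Integer array `8`: whether a half-edge belongs to the residual graph.
* Integer arrays `9` to `14`, for each node: the rest of its list that is still to be searched, the
  number of its discovery (`0` before), the number of its completion, its predecessor, the half-edge
  that leads to it from its predecessor, and the highest ancestor to which it climbs along short
  backward arcs.
* Real arrays `0` and `1`: a node potential, and the reduced costs of the arcs.
* Variables: `0` is a loop counter; `1` is the number of pending calls; `2` is the position of the
  topmost one in the arrays; `3` is the active node of the search, `4` the next candidate for a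
  root, `5` and `6` are the numbers of discovered and of finished nodes; `7` and `8` are auxiliary;
  `9`, `10`, `11` are the half-edges found by the three scans; `12`, `13`, `14` serve the
  augmentation; `16` counts the rounds of the computation of a potential. -/

/-- The number of nodes, read from the input. -/
abbrev nE : IExpr := .inp 0 (.const 0)

/-- The number of arcs, read from the input. -/
abbrev mE : IExpr := .inp 0 (.const 1)

/-- The number of half-edges. -/
abbrev mmE : IExpr := .add mE mE

/-- `x := x + 1`. -/
def incr (x : ℕ) : Prog := .assign x (.add (.var x) (.const 1))

/-- Take the root candidate `4`: if it is not visited yet, start a new tree. -/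
def rootStep : Prog :=
  .seq (.cond (.eq (.arr 10 (.var 4)) (.const 0))
    (block [incr 5, .store 10 (.var 4) (.var 5), .store 12 (.var 4) (.const (-1)),
      .store 14 (.var 4) (.var 4), .assign 3 (.var 4)]) .skip) (incr 4)

/-- Finish the active node. -/
def retreatStep : Prog :=
  block [.store 11 (.var 3) (.var 6), incr 6, .assign 3 (.arr 12 (.var 3))]

/-- Discover the node `8` along the half-edge `7`. -/
def discoverStep : Prog :=
  block [incr 5, .store 10 (.var 8) (.var 5), .store 12 (.var 8) (.var 3),
    .store 13 (.var 8) (.var 7),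
    .cond (.eq (.arr 8 (.arr 5 (.var 7))) (.const 1)) (.store 14 (.var 8) (.arr 14 (.var 3)))
      (.store 14 (.var 8) (.var 8)),
    .assign 3 (.var 8)]

/-- Take the next half-edge of the active node. -/
def exploreStep : Prog :=
  block [.store 9 (.var 3) (.arr 6 (.var 7)), .assign 8 (.arr 4 (.var 7)),
    .cond (.conj (.eq (.arr 8 (.var 7)) (.const 1)) (.eq (.arr 10 (.var 8)) (.const 0)))
      discoverStep .skip]

/-- One iteration of the depth-first search. -/
def dfsBody : Prog :=
  .cond (.lt (.var 3) (.const 0)) rootStep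
    (.seq (.assign 7 (.arr 9 (.var 3)))
      (.cond (.lt (.var 7) (.const 0)) retreatStep exploreStep))

/-- There is an active node or a root candidate. -/
def dfsTest : BExpr := .neg (.conj (.lt (.var 3) (.const 0)) (.ile nE (.var 4)))

/-- The depth-first search. -/
def dfsProg : Prog :=
  block [.assign 3 (.const (-1)), .assign 4 (.const 0), .assign 5 (.const 0), .assign 6 (.const 0),
    .loop dfsTest dfsBody]

section DFS

variable {n M : ℕ}

@[simp] theorem update_cast {k : ℕ} (A : ℤ → ℤ) (w x : Fin k) (z : ℤ) :
    Function.update A ((w : ℕ) : ℤ) z ((x : ℕ) : ℤ) = if x = w then z else A ((x : ℕ) : ℤ) := by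
  simp [Function.update_apply, Fin.ext_iff]

/-- The directed graph of the half-edges in `res`. -/
def HRel (src tgt : Fin M → Fin n) (res : Fin M → Prop) (i j : Fin n) : Prop :=
  ∃ e, res e ∧ src e = i ∧ tgt e = j

/-- The code of an optional node: `-1` stands for `none`. -/
def nodeCode : Option (Fin n) → ℤ
  | none => -1
  | some v => ((v : ℕ) : ℤ)

/-- `l` is the linked list with the successor function `nx` that starts at `p`. -/
def Linked (nx : ℤ → ℤ) : ℤ → List (Fin M) → Prop
  | p, [] => p = -1
  | p, e :: l => p = ((e : ℕ) : ℤ) ∧ Linked nx (nx ((e : ℕ) : ℤ)) l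

/-- The memory holds the half-edges `Fin M`, with their sources, targets and reversals. -/
structure GraphAt (src tgt : Fin M → Fin n) (rev : Fin M → Fin M) (σ : State) : Prop where
  src : ∀ e : Fin M, σ.arr 3 ((e : ℕ) : ℤ) = ((src e : ℕ) : ℤ)
  tgt : ∀ e : Fin M, σ.arr 4 ((e : ℕ) : ℤ) = ((tgt e : ℕ) : ℤ)
  rev : ∀ e : Fin M, σ.arr 5 ((e : ℕ) : ℤ) = ((rev e : ℕ) : ℤ)

/-- The state of the search program represents the configuration `s` of the depth-first search of
the graph of the half-edges in `res`; the lists `rem v` are still to be searched, and the nodes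
below `r` are no longer candidates for roots. -/
structure SearchAt (src tgt : Fin M → Fin n) (res : Fin M → Prop) (s : NumState (Fin n))
    (rem : Fin n → List (Fin M)) (r : ℕ) (σ : State) : Prop where
  inv : NumInv (HRel src tgt res) s
  reach : Relation.ReflTransGen (DFSStep (HRel src tgt res)) ⟨∅, [], fun _ => none⟩ s.toDFSState
  count : s.stack.length + s.fin = s.visited.card
  active : σ.var 3 = nodeCode s.stack.head?
  cand : σ.var 4 = r
  cand_le : r ≤ n
  cand_visited : ∀ v : Fin n, (v : ℕ) < r → v ∈ s.visited
  preClock : σ.var 5 = s.visited.card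
  postClock : σ.var 6 = s.fin
  pre : ∀ v ∈ s.visited, σ.arr 10 ((v : ℕ) : ℤ) = s.pre v
  pre_zero : ∀ v : Fin n, v ∉ s.visited → σ.arr 10 ((v : ℕ) : ℤ) = 0
  post : ∀ v : Fin n, s.post v ≠ ⊤ → ∃ p : ℕ, s.post v = p ∧ σ.arr 11 ((v : ℕ) : ℤ) = p
  pred : ∀ v ∈ s.visited, σ.arr 12 ((v : ℕ) : ℤ) = nodeCode (s.pred v)
  edge : ∀ v w, s.pred w = some v →
    ∃ e : Fin M, σ.arr 13 ((w : ℕ) : ℤ) = ((e : ℕ) : ℤ) ∧ res e ∧ src e = v ∧ tgt e = w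
  top_pred : ∀ v w, s.pred w = some v → HRel src tgt res w v →
    σ.arr 14 ((w : ℕ) : ℤ) = σ.arr 14 ((v : ℕ) : ℤ)
  top_self : ∀ w ∈ s.visited, (∀ v, s.pred w = some v → ¬ HRel src tgt res w v) →
    σ.arr 14 ((w : ℕ) : ℤ) = ((w : ℕ) : ℤ)
  linked : ∀ v : Fin n, Linked (σ.arr 6) (σ.arr 9 ((v : ℕ) : ℤ)) (rem v)
  rem_src : ∀ v, ∀ e ∈ rem v, src e = v
  searched : ∀ e, res e → e ∈ rem (src e) ∨ tgt e ∈ s.visited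

/-- The number of iterations that the search may still need: each of them takes a candidate for a
root, takes a half-edge from a list, or finishes a node. -/
def searchCredit (s : NumState (Fin n)) (rem : Fin n → List (Fin M)) (r : ℕ) : ℕ :=
  (n - r) + (∑ v, (rem v).length) + (n - s.fin)

theorem sum_length_update (rem : Fin n → List (Fin M)) (v : Fin n) (e : Fin M) (l : List (Fin M))
    (h : rem v = e :: l) :
    ∑ w, (rem w).length = (∑ w, (Function.update rem v l w).length) + 1 := by
  rw [← Finset.add_sum_erase _ _ (Finset.mem_univ v),
    ← Finset.add_sum_erase _ (fun w => (Function.update rem v l w).length) (Finset.mem_univ v)]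
  have : ∑ w ∈ Finset.univ.erase v, (Function.update rem v l w).length =
      ∑ w ∈ Finset.univ.erase v, (rem w).length := by
    refine Finset.sum_congr rfl fun w hw => ?_
    rw [Function.update_of_ne (Finset.ne_of_mem_erase hw)]
  rw [this, h, Function.update_self, List.length_cons]
  omega

variable {src tgt : Fin M → Fin n} {rev : Fin M → Fin M} {res : Fin M → Prop} {I : Input}

/-- The candidate for a root is passed over, since it has been visited. -/
theorem SearchAt.root_visited {vis : Finset (Fin n)} {π : Fin n → Option (Fin n)}
    {pre : Fin n → ℕ} {post : Fin n → ℕ∞} {k : ℕ} {rem : Fin n → List (Fin M)} {r : ℕ} {σ : State}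
    (h : SearchAt src tgt res ⟨⟨vis, [], π⟩, pre, post, k⟩ rem r σ) (hr : r < n)
    (hv : (⟨r, hr⟩ : Fin n) ∈ vis) :
    SearchAt src tgt res ⟨⟨vis, [], π⟩, pre, post, k⟩ rem (r + 1) (σ.setVar 4 (r + 1)) := by
  obtain ⟨h1, h2, h3, h4, h5, h6, h7, h8, h9, h10, h11, h12, h13, h14, h15, h16, h17, h18, h19⟩ := h
  refine ⟨h1, h2, h3, by simpa using h4, by simp, hr, fun v hvr => ?_, by simpa using h8,
    by simpa using h9, h10, h11, h12, h13, h14, h15, h16, h17, h18, h19⟩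
  rcases Nat.lt_succ_iff_lt_or_eq.1 hvr with h | h
  · exact h7 v h
  · have : v = ⟨r, hr⟩ := Fin.ext h
    exact this ▸ hv

/-- The candidate for a root starts a new tree. -/
theorem SearchAt.root_new {vis : Finset (Fin n)} {π : Fin n → Option (Fin n)}
    {pre : Fin n → ℕ} {post : Fin n → ℕ∞} {k : ℕ} {rem : Fin n → List (Fin M)} {r : ℕ}
    {σ σ' : State}
    (h : SearchAt src tgt res ⟨⟨vis, [], π⟩, pre, post, k⟩ rem r σ) (v : Fin n) (hr : (v : ℕ) = r)
    (hv : v ∉ vis)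
    (e3 : σ'.var 3 = ((v : ℕ) : ℤ)) (e4 : σ'.var 4 = r + 1) (e5 : σ'.var 5 = σ.var 5 + 1)
    (e6 : σ'.var 6 = σ.var 6) (a6 : σ'.arr 6 = σ.arr 6) (a9 : σ'.arr 9 = σ.arr 9)
    (a10 : σ'.arr 10 = Function.update (σ.arr 10) ((v : ℕ) : ℤ) (σ.var 5 + 1))
    (a11 : σ'.arr 11 = σ.arr 11)
    (a12 : σ'.arr 12 = Function.update (σ.arr 12) ((v : ℕ) : ℤ) (-1))
    (a13 : σ'.arr 13 = σ.arr 13)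
    (a14 : σ'.arr 14 = Function.update (σ.arr 14) ((v : ℕ) : ℤ) ((v : ℕ) : ℤ)) :
    SearchAt src tgt res ⟨⟨insert v vis, [v], π⟩, Function.update pre v (vis.card + 1), post, k⟩
      rem (r + 1) σ' := by
  have hstep := NumStep.root (R := HRel src tgt res) vis π pre post k v hv
  have hinv := h.inv.step hstep
  have hreach := h.reach.tail hstep.toStep
  obtain ⟨h1, h2, h3, h4, h5, h6, h7, h8, h9, h10, h11, h12, h13, h14, h15, h16, h17, h18, h19⟩ := h
  simp only at h2 h3 h4 h5 h6 h7 h8 h9 h10 h11 h12 h13 h14 h15 h16 h17 h18 h19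
  have htree := h1.tree
  simp only at htree
  have hπv : π v = none := by
    by_contra hc
    obtain ⟨y, hy⟩ := Option.ne_none_iff_exists'.1 hc
    exact hv (htree _ _ hy).2.2
  have ne : ∀ x ∈ vis, x ≠ v := by rintro x hx rfl; exact hv hx
  constructor
  · exact hinv
  · exact hreach
  · simp only [List.length_cons, List.length_nil, Finset.card_insert_of_notMem hv] at h3 ⊢
    omega
  · simp [e3, nodeCode]
  · simp [e4]
  · have := v.2; omega
  · intro w hw
    simp only [Finset.mem_insert]
    rcases Nat.lt_succ_iff_lt_or_eq.1 hw with h | h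
    · exact .inr (h7 w h)
    · exact .inl (Fin.ext (h.trans hr.symm))
  · simp [e5, h8, Finset.card_insert_of_notMem hv]
  · rw [e6, h9]
  · intro w hw
    rw [a10]
    by_cases hwv : w = v
    · subst hwv; simp [h8]
    · simp only [update_cast, hwv, if_false, Function.update_of_ne hwv]
      exact h10 w (by simpa [hwv] using hw)
  · intro w hw
    simp only [Finset.mem_insert, not_or] at hw
    rw [a10]
    simpa [hw.1] using h11 w hw.2
  · rw [a11]; exact h12
  · intro w hw
    rw [a12]
    by_cases hwv : w = v
    · subst hwv; simp [hπv, nodeCode]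
    · simp only [update_cast, hwv, if_false]
      exact h13 w (by simpa [hwv] using hw)
  · rw [a13]; exact h14
  · intro x w hxw hR
    have := htree _ _ hxw
    rw [a14]
    simp only [update_cast, ne _ this.2.1, ne _ this.2.2, if_false]
    exact h15 x w hxw hR
  · intro w hw hno
    rw [a14]
    by_cases hwv : w = v
    · subst hwv; simp
    · simp only [update_cast, hwv, if_false]
      exact h16 w (by simpa [hwv] using hw) hno
  · rw [a6, a9]; exact h17
  · exact h18
  · intro e he
    rcases h19 e he with h | h
    · exact .inl h
    · exact .inr (Finset.mem_insert_of_mem h)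

/-- The list of the active node is exhausted, and the node is finished. -/
theorem SearchAt.retreat {vis : Finset (Fin n)} {π : Fin n → Option (Fin n)}
    {pre : Fin n → ℕ} {post : Fin n → ℕ∞} {k : ℕ} {rem : Fin n → List (Fin M)} {r : ℕ}
    {σ σ' : State}
    {v : Fin n} {st : List (Fin n)}
    (h : SearchAt src tgt res ⟨⟨vis, v :: st, π⟩, pre, post, k⟩ rem r σ)
    (hrem : rem v = [])
    (e3 : σ'.var 3 = σ.arr 12 ((v : ℕ) : ℤ)) (e4 : σ'.var 4 = σ.var 4) (e5 : σ'.var 5 = σ.var 5)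
    (e6 : σ'.var 6 = σ.var 6 + 1) (a6 : σ'.arr 6 = σ.arr 6) (a9 : σ'.arr 9 = σ.arr 9)
    (a10 : σ'.arr 10 = σ.arr 10)
    (a11 : σ'.arr 11 = Function.update (σ.arr 11) ((v : ℕ) : ℤ) (σ.var 6))
    (a12 : σ'.arr 12 = σ.arr 12) (a13 : σ'.arr 13 = σ.arr 13) (a14 : σ'.arr 14 = σ.arr 14) :
    SearchAt src tgt res ⟨⟨vis, st, π⟩, pre, Function.update post v (k : ℕ∞), k + 1⟩ rem r σ' := by
  have hdone : ∀ w, HRel src tgt res v w → w ∈ vis := by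
    rintro w ⟨e, he, rfl, rfl⟩
    simpa [hrem] using h.searched e he
  have hstep := NumStep.retreat vis π pre post k st v hdone
  have hinv := h.inv.step hstep
  have hreach := h.reach.tail hstep.toStep
  obtain ⟨h1, h2, h3, h4, h5, h6, h7, h8, h9, h10, h11, h12, h13, h14, h15, h16, h17, h18, h19⟩ := h
  simp only at h2 h3 h4 h5 h6 h7 h8 h9 h10 h11 h12 h13 h14 h15 h16 h17 h18 h19
  have hvv : v ∈ vis := h1.stack_sub v (by simp)
  have hpath := h1.path
  constructor
  · exact hinv
  · exact hreach
  · simp only [List.length_cons] at h3 ⊢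
    omega
  · rw [e3, h13 v hvv]
    cases st with
    | nil => simpa [IsRootPath] using congrArg nodeCode hpath
    | cons w st => exact congrArg nodeCode hpath.1
  · rw [e4, h5]
  · exact h6
  · exact h7
  · rw [e5, h8]
  · simp [e6, h9]
  · rw [a10]; exact h10
  · rw [a10]; exact h11
  · intro w hw
    rw [a11]
    by_cases hwv : w = v
    · subst hwv; exact ⟨k, by simp, by simp [h9]⟩
    · simp only [Function.update_of_ne hwv] at hw ⊢
      simp only [update_cast, hwv, if_false]
      exact h12 w hw
  · rw [a12]; exact h13
  · rw [a13]; exact h14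
  · rw [a14]; exact h15
  · rw [a14]; exact h16
  · rw [a6, a9]; exact h17
  · exact h18
  · exact h19

/-- A half-edge that does not lead to a new node is removed from its list. -/
theorem SearchAt.skip {s : NumState (Fin n)} {rem : Fin n → List (Fin M)} {r : ℕ} {σ σ' : State}
    {v : Fin n} {e : Fin M} {l : List (Fin M)} (h : SearchAt src tgt res s rem r σ)
    (hrem : rem v = e :: l) (hnew : res e → tgt e ∈ s.visited)
    (e3 : σ'.var 3 = σ.var 3) (e4 : σ'.var 4 = σ.var 4) (e5 : σ'.var 5 = σ.var 5)
    (e6 : σ'.var 6 = σ.var 6) (a6 : σ'.arr 6 = σ.arr 6)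
    (a9 : σ'.arr 9 = Function.update (σ.arr 9) ((v : ℕ) : ℤ) (σ.arr 6 ((e : ℕ) : ℤ)))
    (a10 : σ'.arr 10 = σ.arr 10) (a11 : σ'.arr 11 = σ.arr 11)
    (a12 : σ'.arr 12 = σ.arr 12) (a13 : σ'.arr 13 = σ.arr 13) (a14 : σ'.arr 14 = σ.arr 14) :
    SearchAt src tgt res s (Function.update rem v l) r σ' := by
  obtain ⟨h1, h2, h3, h4, h5, h6, h7, h8, h9, h10, h11, h12, h13, h14, h15, h16, h17, h18, h19⟩ := h
  refine ⟨h1, h2, h3, e3.trans h4, e4.trans h5, h6, h7, e5.trans h8, e6.trans h9, a10 ▸ h10,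
    a10 ▸ h11, a11 ▸ h12, a12 ▸ h13, a13 ▸ h14, a14 ▸ h15, a14 ▸ h16, fun w => ?_,
    fun w x hx => ?_, fun x hx => ?_⟩
  · rw [a6, a9]
    by_cases hwv : w = v
    · subst hwv
      have := h17 w
      rw [hrem] at this
      simpa using this.2
    · simp only [update_cast, hwv, if_false, Function.update_of_ne hwv]
      exact h17 w
  · by_cases hwv : w = v
    · subst hwv
      rw [Function.update_self] at hx
      exact h18 w x (by rw [hrem]; exact List.mem_cons_of_mem _ hx)
    · rw [Function.update_of_ne hwv] at hx
      exact h18 w x hx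
  · rcases h19 x hx with h | h
    · by_cases hxv : src x = v
      · rw [hxv, hrem] at h
        rw [hxv, Function.update_self]
        rcases List.mem_cons.1 h with rfl | h
        · exact .inr (hnew hx)
        · exact .inl h
      · rw [Function.update_of_ne hxv]; exact .inl h
    · exact .inr h

/-- The search advances along the half-edge `e`. The new node climbs as high as the active one if
the reversal of `e` is residual, and does not climb otherwise. -/
theorem SearchAt.discover {vis : Finset (Fin n)} {π : Fin n → Option (Fin n)}
    {pre : Fin n → ℕ} {post : Fin n → ℕ∞} {k : ℕ} {rem : Fin n → List (Fin M)} {r : ℕ}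
    {σ σ' : State}
    {v : Fin n} {st : List (Fin n)} {e : Fin M}
    (h : SearchAt src tgt res ⟨⟨vis, v :: st, π⟩, pre, post, k⟩ rem r σ)
    (hrev : res e → (HRel src tgt res (tgt e) (src e) ↔ res (rev e)))
    (hev : src e = v) (hres : res e) (hnew : tgt e ∉ vis)
    (e3 : σ'.var 3 = ((tgt e : ℕ) : ℤ)) (e4 : σ'.var 4 = σ.var 4) (e5 : σ'.var 5 = σ.var 5 + 1)
    (e6 : σ'.var 6 = σ.var 6) (a6 : σ'.arr 6 = σ.arr 6) (a9 : σ'.arr 9 = σ.arr 9)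
    (a10 : σ'.arr 10 = Function.update (σ.arr 10) ((tgt e : ℕ) : ℤ) (σ.var 5 + 1))
    (a11 : σ'.arr 11 = σ.arr 11)
    (a12 : σ'.arr 12 = Function.update (σ.arr 12) ((tgt e : ℕ) : ℤ) ((v : ℕ) : ℤ))
    (a13 : σ'.arr 13 = Function.update (σ.arr 13) ((tgt e : ℕ) : ℤ) ((e : ℕ) : ℤ))
    (a14 : ∃ t, σ'.arr 14 = Function.update (σ.arr 14) ((tgt e : ℕ) : ℤ) t ∧
      (res (rev e) → t = σ.arr 14 ((v : ℕ) : ℤ)) ∧ (¬ res (rev e) → t = ((tgt e : ℕ) : ℤ))) :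
    SearchAt src tgt res ⟨⟨insert (tgt e) vis, tgt e :: v :: st,
      Function.update π (tgt e) (some v)⟩, Function.update pre (tgt e) (vis.card + 1), post, k⟩
      rem r σ' := by
  have hR : HRel src tgt res v (tgt e) := ⟨e, hres, hev, rfl⟩
  have hstep := NumStep.advance vis π pre post k st v (tgt e) hR hnew
  have hinv := h.inv.step hstep
  have hreach := h.reach.tail hstep.toStep
  obtain ⟨h1, h2, h3, h4, h5, h6, h7, h8, h9, h10, h11, h12, h13, h14, h15, h16, h17, h18, h19⟩ := h
  simp only at h2 h3 h4 h5 h6 h7 h8 h9 h10 h11 h12 h13 h14 h15 h16 h17 h18 h19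
  have htree := h1.tree
  simp only at htree
  have hvv : v ∈ vis := h1.stack_sub v (by simp)
  have ne : ∀ x ∈ vis, x ≠ tgt e := by rintro x hx rfl; exact hnew hx
  have hrev' := hrev hres
  rw [hev] at hrev'
  obtain ⟨t, a14, ht1, ht2⟩ := a14
  generalize hw : tgt e = w at *
  constructor
  · exact hinv
  · exact hreach
  · simp only [List.length_cons, Finset.card_insert_of_notMem hnew] at h3 ⊢
    omega
  · simp [e3, nodeCode]
  · rw [e4, h5]
  · exact h6
  · exact fun x hx => Finset.mem_insert_of_mem (h7 x hx)
  · simp [e5, h8, Finset.card_insert_of_notMem hnew]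
  · rw [e6, h9]
  · intro x hx
    rw [a10]
    by_cases hxw : x = w
    · subst hxw; simp [h8]
    · simp only [update_cast, hxw, if_false, Function.update_of_ne hxw]
      exact h10 x (by simpa [hxw] using hx)
  · intro x hx
    simp only [Finset.mem_insert, not_or] at hx
    rw [a10]
    simpa [hx.1] using h11 x hx.2
  · rw [a11]; exact h12
  · intro x hx
    rw [a12]
    by_cases hxw : x = w
    · subst hxw; simp [nodeCode]
    · simp only [update_cast, hxw, if_false, Function.update_of_ne hxw]
      exact h13 x (by simpa [hxw] using hx)
  · intro x y hxy
    rw [a13]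
    by_cases hyw : y = w
    · subst hyw
      simp only [Function.update_self, Option.some.injEq] at hxy
      subst hxy
      exact ⟨e, by simp, hres, hev, hw⟩
    · simp only [Function.update_of_ne hyw] at hxy
      simp only [update_cast, hyw, if_false]
      exact h14 x y hxy
  · intro x y hxy hyx
    rw [a14]
    by_cases hyw : y = w
    · subst hyw
      simp only [Function.update_self, Option.some.injEq] at hxy
      subst hxy
      simp only [update_cast, if_true, ne _ hvv, if_false]
      exact ht1 (hrev'.1 hyx)
    · simp only [Function.update_of_ne hyw] at hxy
      simp only [update_cast, hyw, ne _ (htree _ _ hxy).2.1, if_false]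
      exact h15 x y hxy hyx
  · intro x hx hno
    rw [a14]
    by_cases hxw : x = w
    · subst hxw
      simp only [Function.update_self, Option.some.injEq, forall_eq'] at hno
      simp only [update_cast, if_true]
      exact ht2 fun hc => hno (hrev'.2 hc)
    · simp only [Function.update_of_ne hxw] at hno
      simp only [update_cast, hxw, if_false]
      exact h16 x (by simpa [hxw] using hx) hno
  · rw [a6, a9]; exact h17
  · exact h18
  · intro x hx
    rcases h19 x hx with h | h
    · exact .inl h
    · exact .inr (Finset.mem_insert_of_mem h)

/-- The search advances along the first half-edge in the list of the active node. -/
theorem SearchAt.explore {vis : Finset (Fin n)} {π : Fin n → Option (Fin n)}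
    {pre : Fin n → ℕ} {post : Fin n → ℕ∞} {k : ℕ} {rem : Fin n → List (Fin M)} {r : ℕ}
    {σ σ' : State}
    {v : Fin n} {st : List (Fin n)} {e : Fin M} {l : List (Fin M)}
    (h : SearchAt src tgt res ⟨⟨vis, v :: st, π⟩, pre, post, k⟩ rem r σ)
    (hrev : res e → (HRel src tgt res (tgt e) (src e) ↔ res (rev e)))
    (hrem : rem v = e :: l) (hres : res e) (hnew : tgt e ∉ vis)
    (e3 : σ'.var 3 = ((tgt e : ℕ) : ℤ)) (e4 : σ'.var 4 = σ.var 4) (e5 : σ'.var 5 = σ.var 5 + 1)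
    (e6 : σ'.var 6 = σ.var 6) (a6 : σ'.arr 6 = σ.arr 6)
    (a9 : σ'.arr 9 = Function.update (σ.arr 9) ((v : ℕ) : ℤ) (σ.arr 6 ((e : ℕ) : ℤ)))
    (a10 : σ'.arr 10 = Function.update (σ.arr 10) ((tgt e : ℕ) : ℤ) (σ.var 5 + 1))
    (a11 : σ'.arr 11 = σ.arr 11)
    (a12 : σ'.arr 12 = Function.update (σ.arr 12) ((tgt e : ℕ) : ℤ) ((v : ℕ) : ℤ))
    (a13 : σ'.arr 13 = Function.update (σ.arr 13) ((tgt e : ℕ) : ℤ) ((e : ℕ) : ℤ))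
    (a14 : ∃ t, σ'.arr 14 = Function.update (σ.arr 14) ((tgt e : ℕ) : ℤ) t ∧
      (res (rev e) → t = σ.arr 14 ((v : ℕ) : ℤ)) ∧ (¬ res (rev e) → t = ((tgt e : ℕ) : ℤ))) :
    SearchAt src tgt res ⟨⟨insert (tgt e) vis, tgt e :: v :: st,
      Function.update π (tgt e) (some v)⟩, Function.update pre (tgt e) (vis.card + 1), post, k⟩
      (Function.update rem v l) r σ' := by
  have hsrc : src e = v := h.rem_src v e (by simp [hrem])
  -- the discovery of the node comes first, and the half-edge is removed from the list afterwards
  have h1 := h.discover (σ' := { σ' with arr := Function.update σ'.arr 9 (σ.arr 9) }) hrev hsrc hres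
    hnew e3 e4 e5 e6 (by simpa using a6) (by simp) (by simpa using a10) (by simpa using a11)
    (by simpa using a12) (by simpa using a13) (by simpa using a14)
  exact h1.skip hrem (fun _ => Finset.mem_insert_self _ _) rfl rfl rfl rfl (by simp)
    (by simp [a9, a6]) (by simp) (by simp) (by simp) (by simp) (by simp)

/-- One iteration of the search program performs at most one step of the depth-first search and
uses up at least one unit of the credit. -/
theorem dfsBody_spec (hn : I.int 0 0 = n)
    (hrev : ∀ e, res e → (HRel src tgt res (tgt e) (src e) ↔ res (rev e)))
    {s : NumState (Fin n)} {rem : Fin n → List (Fin M)} {r : ℕ} {σ : State}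
    (hg : GraphAt src tgt rev σ) (hres : ∀ e : Fin M, σ.arr 8 ((e : ℕ) : ℤ) = 1 ↔ res e)
    (h : SearchAt src tgt res s rem r σ) (ht : dfsTest.holds I σ) :
    HaltsIn I dfsBody σ dfsBody.cost (fun σ' => ∃ s' rem' r', SearchAt src tgt res s' rem' r' σ' ∧
      searchCredit s' rem' r' + 1 ≤ searchCredit s rem r) := by
  refine HaltsIn.of_wp ?_
  obtain ⟨⟨vis, st, π⟩, pre, post, k⟩ := s
  have hact := h.active
  cases st with
  | nil =>
    simp only [List.head?_nil, nodeCode] at hact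
    have hr : r < n := by
      simp only [dfsTest, BExpr.holds, BExpr.holds_lt, IExpr.eval, hact, hn, h.cand] at ht
      simp only [not_and, not_le] at ht
      exact_mod_cast ht (by norm_num)
    have hcand : σ.var 4 = (((⟨r, hr⟩ : Fin n) : ℕ) : ℤ) := h.cand
    have hcr : searchCredit ⟨⟨vis, [], π⟩, pre, post, k⟩ rem (r + 1) + 1 ≤
        searchCredit ⟨⟨vis, [], π⟩, pre, post, k⟩ rem r := by
      simp only [searchCredit]; omega
    simp only [dfsBody, rootStep, block, incr, Prog.wp, BExpr.holds_lt, BExpr.holds_eq, IExpr.eval,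
      hact, State.setVar_var]
    refine ⟨fun _ => ⟨fun h0 => ?_, fun h0 => ?_⟩, fun hc => absurd (by norm_num) hc⟩
    · have hv : (⟨r, hr⟩ : Fin n) ∉ vis := by
        intro hc
        have h1 := h.pre _ hc
        have h2 := h.inv.pre_pos _ hc
        simp only at h1 h2
        rw [← hcand, h0] at h1
        omega
      refine ⟨_, _, _, h.root_new ⟨r, hr⟩ rfl hv ?_ ?_ ?_ ?_ ?_ ?_ ?_ ?_ ?_ ?_ ?_, hcr⟩ <;>
        simp [hcand]
    · have hv : (⟨r, hr⟩ : Fin n) ∈ vis := by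
        by_contra hc
        exact h0 (by rw [hcand]; exact h.pre_zero _ hc)
      refine ⟨_, _, _, ?_, hcr⟩
      have := h.root_visited hr hv
      rw [← h.cand] at this
      exact this
  | cons v st =>
    simp only [List.head?_cons, nodeCode] at hact
    have hact0 : ¬ σ.var 3 < 0 := by rw [hact]; omega
    have hvv : v ∈ vis := h.inv.stack_sub v (by simp)
    have hlink := h.linked v
    simp only [dfsBody, Prog.wp, BExpr.holds_lt, IExpr.eval, hact0, false_imp_iff, true_and,
      not_false_eq_true, true_imp_iff, State.setVar_var, if_true]
    cases hrem : rem v with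
    | nil =>
      rw [hrem] at hlink
      simp only [Linked] at hlink
      rw [hact, hlink]
      refine ⟨fun _ => ?_, fun hc => absurd (by norm_num) hc⟩
      simp only [retreatStep, block, incr, Prog.wp, IExpr.eval, State.setVar_var,
        State.setVar_arr, State.setArr_arr, State.setArr_var]
      have hcnt := h.count
      have hcard := Finset.card_le_univ vis
      simp only [List.length_cons, Fintype.card_fin] at hcnt hcard
      refine ⟨_, _, _, h.retreat hrem ?_ ?_ ?_ ?_ ?_ ?_ ?_ ?_ ?_ ?_ ?_, ?_⟩
      all_goals first | (simp only [searchCredit]; omega) | simp [hact]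
    | cons e l =>
      rw [hrem] at hlink
      simp only [Linked] at hlink
      rw [hact, hlink.1]
      refine ⟨fun hc => absurd hc (by omega), fun _ => ?_⟩
      have hsrc : src e = v := h.rem_src v e (by simp [hrem])
      have hcr : searchCredit ⟨⟨vis, v :: st, π⟩, pre, post, k⟩ (Function.update rem v l) r + 1 ≤
          searchCredit ⟨⟨vis, v :: st, π⟩, pre, post, k⟩ rem r := by
        simp only [searchCredit]
        have := sum_length_update rem v e l hrem
        omega
      have hpz : σ.arr 10 ((tgt e : ℕ) : ℤ) = 0 ↔ tgt e ∉ vis := by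
        constructor
        · intro h0 hc
          have h1 := h.pre _ hc
          have h2 := h.inv.pre_pos _ hc
          simp only at h1 h2
          omega
        · exact fun hc => h.pre_zero _ hc
      simp only [exploreStep, discoverStep, block, incr, Prog.wp, IExpr.eval, BExpr.holds,
        BExpr.holds_eq, State.setVar_var, State.setVar_arr, State.setArr_arr, State.setArr_var]
      simp [hact, hg.tgt, hg.rev, hres, hpz]
      refine ⟨fun h1 h2 => ?_, fun h0 => ?_⟩
      · refine ⟨fun h3 => ?_, fun h3 => ?_⟩
        · refine ⟨⟨⟨insert (tgt e) vis, tgt e :: v :: st, Function.update π (tgt e) (some v)⟩,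
            Function.update pre (tgt e) (vis.card + 1), post, k⟩, Function.update rem v l, r, ?_,
            hcr⟩
          refine h.explore (hrev e) hrem h1 h2 ?_ ?_ ?_ ?_ ?_ ?_ ?_ ?_ ?_ ?_
            ⟨σ.arr 14 ((v : ℕ) : ℤ), ?_, fun _ => rfl, fun hc => absurd h3 hc⟩
          all_goals simp
        · refine ⟨⟨⟨insert (tgt e) vis, tgt e :: v :: st, Function.update π (tgt e) (some v)⟩,
            Function.update pre (tgt e) (vis.card + 1), post, k⟩, Function.update rem v l, r, ?_,
            hcr⟩
          refine h.explore (hrev e) hrem h1 h2 ?_ ?_ ?_ ?_ ?_ ?_ ?_ ?_ ?_ ?_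
            ⟨((tgt e : ℕ) : ℤ), ?_, fun hc => absurd hc h3, fun _ => rfl⟩
          all_goals simp
      · refine ⟨⟨⟨vis, v :: st, π⟩, pre, post, k⟩, Function.update rem v l, r, ?_, hcr⟩
        refine h.skip hrem h0 ?_ ?_ ?_ ?_ ?_ ?_ ?_ ?_ ?_ ?_ ?_
        all_goals simp

/-- The outcome of the search program: a depth-first search forest with its numbering, together
with the half-edges of the tree arcs and the highest ancestors to which the nodes climb. -/
structure ForestAt (src tgt : Fin M → Fin n) (res : Fin M → Prop) (π : Fin n → Option (Fin n))
    (pre : Fin n → ℕ) (post : Fin n → ℕ∞) (σ : State) : Prop where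
  forest : IsDFSForest (HRel src tgt res) π
  num : IsNumbering (HRel src tgt res) π pre post
  pre : ∀ v : Fin n, σ.arr 10 ((v : ℕ) : ℤ) = pre v
  post : ∀ v : Fin n, ∃ p : ℕ, post v = p ∧ σ.arr 11 ((v : ℕ) : ℤ) = p
  pred : ∀ v : Fin n, σ.arr 12 ((v : ℕ) : ℤ) = nodeCode (π v)
  edge : ∀ v w, π w = some v →
    ∃ e : Fin M, σ.arr 13 ((w : ℕ) : ℤ) = ((e : ℕ) : ℤ) ∧ res e ∧ src e = v ∧ tgt e = w
  top : ∀ v : Fin n, ∃ t : Fin n, σ.arr 14 ((v : ℕ) : ℤ) = ((t : ℕ) : ℤ) ∧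
    Climbs (HRel src tgt res) π v t ∧ ∀ a, Climbs (HRel src tgt res) π v a → Ancestor π t a

theorem SearchAt.forestAt {s : NumState (Fin n)} {rem : Fin n → List (Fin M)} {r : ℕ} {σ : State}
    (h : SearchAt src tgt res s rem r σ) (hv : s.visited = Finset.univ) (hs : s.stack = []) :
    ForestAt src tgt res s.pred s.pre s.post σ := by
  have hnum := h.inv.isNumbering hv hs
  have hall : ∀ v, v ∈ s.visited := fun v => by simp [hv]
  refine ⟨?_, hnum, fun v => h.pre v (hall v), fun v => h.post v (hnum.post_ne_top v),
    fun v => h.pred v (hall v), h.edge, ?_⟩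
  · have := h.reach
    have e : s.toDFSState = ⟨Finset.univ, [], s.pred⟩ := by rw [← hv, ← hs]
    rwa [e] at this
  · have key : ∀ k, ∀ v, s.pre v ≤ k → ∃ t : Fin n, σ.arr 14 ((v : ℕ) : ℤ) = ((t : ℕ) : ℤ) ∧
        Climbs (HRel src tgt res) s.pred v t ∧
        ∀ a, Climbs (HRel src tgt res) s.pred v a → Ancestor s.pred t a := by
      intro k
      induction k with
      | zero => intro v hk; have := hnum.pre_pos v; omega
      | succ k ih =>
        intro v hk
        by_cases hc : ∃ u, s.pred v = some u ∧ HRel src tgt res v u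
        · obtain ⟨u, hu, hvu⟩ := hc
          obtain ⟨t, h1, h2, h3⟩ := ih u (by have := hnum.tree_lt _ _ hu; omega)
          refine ⟨t, by rw [h.top_pred u v hu hvu, h1], .head ⟨hvu, hu⟩ h2, fun a ha => ?_⟩
          rcases Relation.ReflTransGen.cases_head ha with rfl | ⟨u', hu', h4⟩
          · exact .of_pred hu h2.ancestor
          · have : some u' = some u := hu'.2.symm.trans hu
            cases this
            exact h3 a h4
        · push Not at hc
          refine ⟨v, h.top_self v (hall v) hc, .refl, fun a ha => ?_⟩
          rcases Relation.ReflTransGen.cases_head ha with rfl | ⟨u', hu', h4⟩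
          · exact .refl _ _
          · exact absurd hu'.1 (hc _ hu'.2)
    exact fun v => key _ v le_rfl

/-- The search program builds a depth-first search forest in linear time. -/
theorem dfsProg_spec (hn : I.int 0 0 = n)
    (hrev : ∀ e, res e → (HRel src tgt res (tgt e) (src e) ↔ res (rev e)))
    {σ : State} (hg : GraphAt src tgt rev σ)
    (hres : ∀ e : Fin M, σ.arr 8 ((e : ℕ) : ℤ) = 1 ↔ res e)
    {adj : Fin n → List (Fin M)}
    (hadj : ∀ v : Fin n, Linked (σ.arr 6) (σ.arr 9 ((v : ℕ) : ℤ)) (adj v))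
    (hmem : ∀ v e, e ∈ adj v ↔ src e = v) (hlen : ∑ v, (adj v).length = M)
    (hpre : ∀ v : Fin n, σ.arr 10 ((v : ℕ) : ℤ) = 0) :
    HaltsIn I dfsProg σ ((n + M + n) * (dfsBody.cost + dfsTest.steps + 1) + (dfsTest.steps + 9))
      (fun σ' => (∃ π pre post, ForestAt src tgt res π pre post σ') ∧ Keeps dfsProg σ σ') := by
  refine HaltsIn.keeps ?_
  let σ₀ := (((σ.setVar 3 (-1)).setVar 4 0).setVar 5 0).setVar 6 0
  have h0 : SearchAt src tgt res (NumState.init (Fin n)) adj 0 σ₀ := by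
    constructor
    · exact NumInv.init _
    · exact .refl
    all_goals simp [σ₀, NumState.init, nodeCode, hpre, hadj, hmem]
  set d := dfsBody.cost + dfsTest.steps + 1 with hd
  have hloop := HaltsIn.loop (I := I) (t := dfsTest) (p := dfsBody)
    (fun σ' b => Keeps (.loop dfsTest dfsBody) σ₀ σ' ∧ ∃ s rem r, SearchAt src tgt res s rem r σ' ∧
      searchCredit s rem r * d ≤ b) ?_ (σ := σ₀) (b := (n + M + n) * d)
      ⟨.refl _ _, _, _, _, h0, by simp [searchCredit, hlen, NumState.init]⟩
  · have h1 : HaltsIn I dfsProg σ _ _ := HaltsIn.seq_wp (HaltsIn.seq_wp (HaltsIn.seq_wp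
      (HaltsIn.seq_wp (p := .assign 6 (.const 0)) hloop)))
    refine h1.mono ?_ ?_
    · simp only [Prog.cost, IExpr.steps]
      omega
    · rintro σ' ⟨⟨b, -, s, rem, r, h, -⟩, ht⟩
      simp only [dfsTest, BExpr.holds, BExpr.holds_lt, IExpr.eval, hn, h.cand, not_not, h.active]
        at ht
      have hstack : s.stack = [] := by
        cases hs : s.stack with
        | nil => rfl
        | cons v st =>
          simp [hs, nodeCode] at ht
          omega
      have hvis : s.visited = Finset.univ :=
        Finset.eq_univ_iff_forall.2 fun v => h.cand_visited v (by have := v.2; omega)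
      exact ⟨_, _, _, h.forestAt hvis hstack⟩
  · rintro σ' b ⟨hk, s, rem, r, h, hb⟩ ht
    have hg' : GraphAt src tgt rev σ' := by
      refine ⟨?_, ?_, ?_⟩
      · rw [hk.arr 3 rfl]; exact hg.src
      · rw [hk.arr 4 rfl]; exact hg.tgt
      · rw [hk.arr 5 rfl]; exact hg.rev
    have hres' : ∀ e : Fin M, σ'.arr 8 ((e : ℕ) : ℤ) = 1 ↔ res e := by
      rw [hk.arr 8 rfl]; exact hres
    have hbody := dfsBody_spec hn hrev hg' hres' h ht
    have hpos : 1 ≤ searchCredit s rem r := by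
      obtain ⟨_, _, _, _, s', rem', r', _, hc⟩ := hbody
      omega
    obtain ⟨c, hc⟩ := Nat.exists_eq_add_of_le' hpos
    refine ⟨dfsBody.cost, c * d, ?_, hbody.keeps.mono le_rfl ?_⟩
    · rw [hc, Nat.add_mul] at hb
      omega
    · rintro σ'' ⟨⟨s', rem', r', h', hc'⟩, hk'⟩
      exact ⟨hk.trans hk'.loop, s', rem', r', h', Nat.mul_le_mul_right _ (by omega)⟩

end DFS

/-! ### The search for a proper cycle -/

/-- The test whether the node `x` is an ancestor of the node `y`. -/
def ancTest (x y : IExpr) : BExpr :=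
  .conj (.ile (.arr 10 x) (.arr 10 y)) (.ile (.arr 11 y) (.arr 11 x))

/-- The source of the half-edge `0`. -/
abbrev srcE : IExpr := .arr 3 (.var 0)

/-- The target of the half-edge `0`. -/
abbrev tgtE : IExpr := .arr 4 (.var 0)

/-- The test whether the half-edge `0` closes a proper cycle: it is residual, neither a short
backward arc nor a tree arc, and the highest ancestor to which its target climbs is an ancestor of
its source. -/
def cycleTest : BExpr :=
  .conj (.eq (.arr 8 (.var 0)) (.const 1)) (.conj (.neg (.eq (.arr 12 srcE) tgtE))
    (.conj (.neg (.eq (.arr 12 tgtE) srcE)) (ancTest (.arr 14 tgtE) srcE)))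

/-- Search the half-edges for one that satisfies the test `t`; the result is stored in the variable
`x`, with `-1` for failure. -/
def scan (x : ℕ) (t : BExpr) : Prog :=
  .seq (.assign x (.const (-1))) (forLoop 0 mmE (.cond t (.assign x (.var 0)) .skip))

/-- Search for a half-edge that closes a proper backward cycle, a proper forward cycle, or any
proper cycle, in this order. -/
def scansProg : Prog :=
  .seq (scan 9 (.conj cycleTest (ancTest tgtE srcE)))
    (.seq (scan 10 (.conj cycleTest (ancTest srcE tgtE)))
      (.seq (scan 11 cycleTest)
        (.cond (.ile (.const 0) (.var 9)) (.assign 12 (.var 9))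
          (.cond (.ile (.const 0) (.var 10)) (.assign 12 (.var 10)) (.assign 12 (.var 11))))))

section Scan

variable {n M : ℕ} {I : Input}

/-- The variable `x` holds a half-edge that satisfies `T`, or `-1` if there is none. -/
def Found (x : ℕ) (T : Fin M → Prop) (σ : State) : Prop :=
  (σ.var x = -1 ∧ ∀ e, ¬ T e) ∨ ∃ e : Fin M, σ.var x = ((e : ℕ) : ℤ) ∧ T e

theorem scan_spec {x : ℕ} (hx : (0 != x) = true) {t : BExpr} {σ : State}
    (hM : I.int 0 1 + I.int 0 1 = M) {T : Fin M → Prop}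
    (hT : ∀ σ', σ'.arr = σ.arr → ∀ e : Fin M, σ'.var 0 = ((e : ℕ) : ℤ) → (t.holds I σ' ↔ T e)) :
    HaltsIn I (scan x t) σ (2 + (M + 1) * (t.steps + 1 + 3 + 5 + 10))
      (fun σ' => Found x T σ' ∧ Keeps (scan x t) σ σ') := by
  have hx0 : x ≠ 0 := by rintro rfl; simp at hx
  refine HaltsIn.keeps ?_
  have := HaltsIn.seq_wp (p := .assign x (.const (-1))) (I := I) (σ := σ)
    (HaltsIn.forLoop (I := I) (x := 0) (bnd := mmE) (body := .cond t (.assign x (.var 0)) .skip)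
      (σ₀ := σ.setVar x (-1)) M
      (fun i σ' => (σ'.var x = -1 ∧ ∀ e : Fin M, (e : ℕ) < i → ¬ T e) ∨
        ∃ e : Fin M, σ'.var x = ((e : ℕ) : ℤ) ∧ T e) (t.steps + 1 + 3) ?_ ?_ ?_ ?_)
  · refine this.mono (le_of_eq ?_) ?_
    · simp only [Prog.cost, IExpr.steps]
    · rintro σ' ⟨h | h, -⟩
      · exact .inl ⟨h.1, fun e => h.2 e e.2⟩
      · exact .inr h
  · simp only [Prog.keepsVar, Bool.and_true, bne_iff_ne]
    exact hx0
  · intro σ'; simpa using hM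
  · left; simp [hx0]
  · intro i hi σ' hk hv hinv
    have harr : σ'.arr = σ.arr := funext fun k => hk.arr k rfl
    have ht := hT σ' harr ⟨i, hi⟩ hv
    refine (HaltsIn.of_wp (p := .cond t (.assign x (.var 0)) .skip) ?_).mono le_rfl fun _ h => h
    simp only [Prog.wp, IExpr.eval]
    refine ⟨fun h => .inr ⟨⟨i, hi⟩, by simp [hv, hx0], ht.1 h⟩, fun h => ?_⟩
    rcases hinv with ⟨h1, h2⟩ | ⟨e, h1, h2⟩
    · refine .inl ⟨by simpa [hx0] using h1, fun e he => ?_⟩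
      rcases Nat.lt_succ_iff_lt_or_eq.1 he with h' | h'
      · exact h2 e h'
      · have : e = ⟨i, hi⟩ := Fin.ext h'
        exact this ▸ fun hc => h (ht.2 hc)
    · exact .inr ⟨e, by simpa [hx0] using h1, h2⟩

end Scan

section Search

variable {n M : ℕ} {src tgt : Fin M → Fin n} {rev : Fin M → Fin M} {res : Fin M → Prop} {I : Input}
  {π : Fin n → Option (Fin n)} {pre : Fin n → ℕ} {post : Fin n → ℕ∞}

theorem ForestAt.congr {σ σ' : State} (h : ForestAt src tgt res π pre post σ)
    (h' : ∀ k ∈ ([10, 11, 12, 13, 14] : List ℕ), σ'.arr k = σ.arr k) :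
    ForestAt src tgt res π pre post σ' := by
  simp only [List.mem_cons, List.not_mem_nil, or_false, forall_eq_or_imp, forall_eq] at h'
  obtain ⟨e1, e2, e3, e4, e5⟩ := h'
  obtain ⟨h1, h2, h3, h4, h5, h6, h7⟩ := h
  exact ⟨h1, h2, e1 ▸ h3, e2 ▸ h4, e3 ▸ h5, e4 ▸ h6, e5 ▸ h7⟩

theorem GraphAt.congr {σ σ' : State} (h : GraphAt src tgt rev σ)
    (h' : ∀ k ∈ ([3, 4, 5] : List ℕ), σ'.arr k = σ.arr k) : GraphAt src tgt rev σ' := by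
  simp only [List.mem_cons, List.not_mem_nil, or_false, forall_eq_or_imp, forall_eq] at h'
  obtain ⟨e1, e2, e3⟩ := h'
  exact ⟨e1 ▸ h.src, e2 ▸ h.tgt, e3 ▸ h.rev⟩

theorem ForestAt.of_keeps {σ σ' : State} {p : Prog} (h : ForestAt src tgt res π pre post σ)
    (hk : Keeps p σ σ') (hp : (([10, 11, 12, 13, 14] : List ℕ).all fun k => p.keepsArr k) = true) :
    ForestAt src tgt res π pre post σ' :=
  h.congr fun k hk' => hk.arr k (List.all_eq_true.1 hp k hk')

theorem GraphAt.of_keeps {σ σ' : State} {p : Prog} (h : GraphAt src tgt rev σ)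
    (hk : Keeps p σ σ') (hp : (([3, 4, 5] : List ℕ).all fun k => p.keepsArr k) = true) :
    GraphAt src tgt rev σ' :=
  h.congr fun k hk' => hk.arr k (List.all_eq_true.1 hp k hk')

theorem ForestAt.ancTest_iff {σ : State} (h : ForestAt src tgt res π pre post σ) {x y : IExpr}
    {u v : Fin n} (hx : x.eval I σ = ((u : ℕ) : ℤ)) (hy : y.eval I σ = ((v : ℕ) : ℤ)) :
    (ancTest x y).holds I σ ↔ Ancestor π u v := by
  obtain ⟨p, hp, hp'⟩ := h.post u
  obtain ⟨q, hq, hq'⟩ := h.post v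
  simp only [ancTest, BExpr.holds, IExpr.eval, hx, hy, h.pre, hp', hq', h.num.anc, hp, hq,
    Nat.cast_le]

theorem nodeCode_eq_iff (o : Option (Fin n)) (v : Fin n) :
    nodeCode o = ((v : ℕ) : ℤ) ↔ o = some v := by
  cases o with
  | none => simp only [nodeCode, reduceCtorEq]
  | some u => simp [nodeCode, Fin.ext_iff]

/-- The half-edge `e` closes a proper cycle. -/
def Closes (src tgt : Fin M → Fin n) (res : Fin M → Prop) (π : Fin n → Option (Fin n))
    (e : Fin M) : Prop :=
  res e ∧ ∃ a P Q, ProperCycle (HRel src tgt res) π (src e) (tgt e) a P Q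

theorem ForestAt.cycleTest_iff {σ : State} (h : ForestAt src tgt res π pre post σ)
    (hg : GraphAt src tgt rev σ) (hres : ∀ e : Fin M, σ.arr 8 ((e : ℕ) : ℤ) = 1 ↔ res e)
    (hirr : ∀ v, ¬ HRel src tgt res v v)
    {e : Fin M} (he : σ.var 0 = ((e : ℕ) : ℤ)) :
    cycleTest.holds I σ ↔ Closes src tgt res π e := by
  obtain ⟨t, ht, hclimb, hmax⟩ := h.top (tgt e)
  have h1 : (IExpr.arr 14 tgtE).eval I σ = ((t : ℕ) : ℤ) := by simp [he, hg.tgt, ht]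
  have h2 : srcE.eval I σ = ((src e : ℕ) : ℤ) := by simp [he, hg.src]
  have h3 := h.ancTest_iff h1 h2
  simp only [cycleTest, BExpr.holds, BExpr.holds_eq, IExpr.eval, he, hg.src, hg.tgt, hres, h.pred,
    nodeCode_eq_iff, h3, Closes]
  refine and_congr_right fun hre => ⟨?_, ?_⟩
  · rintro ⟨h4, h5, h6⟩
    refine h.num.exists_properCycle ⟨e, hre, rfl, rfl⟩ (fun hc => ?_) h5 h4 hclimb h6
    exact hirr (src e) ⟨e, hre, rfl, hc.symm⟩
  · rintro ⟨a, P, Q, hC⟩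
    exact ⟨hC.not_short, hC.not_tree,
      (hmax a hC.up.reflTransGen.1).trans hC.fca.1⟩

theorem IsBackwardCycle.exists_closes (h : IsNumbering (HRel src tgt res) π pre post)
    (hirr : ∀ v, ¬ HRel src tgt res v v) {C : List (Fin n)}
    (hC : IsBackwardCycle (HRel src tgt res) π C) :
    ∃ e, Closes src tgt res π e ∧ Ancestor π (tgt e) (src e) := by
  obtain ⟨i, j, h1, h2⟩ := hC
  obtain ⟨e, he, rfl, rfl⟩ := h1.1
  exact ⟨e, ⟨he, _, _, _, h1.properCycle h hirr h2⟩, h1.2.1⟩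

theorem IsForwardCycle.exists_closes (h : IsNumbering (HRel src tgt res) π pre post)
    (hirr : ∀ v, ¬ HRel src tgt res v v) {C : List (Fin n)}
    (hC : IsForwardCycle (HRel src tgt res) π C) :
    ∃ e, Closes src tgt res π e ∧ Ancestor π (src e) (tgt e) := by
  obtain ⟨i, j, h1, h2⟩ := hC
  obtain ⟨e, he, rfl, rfl⟩ := h1.1
  exact ⟨e, ⟨he, _, _, _, h1.properCycle h hirr h2⟩, h1.2.1⟩

theorem IsCrossCycle.exists_closes {C : List (Fin n)}
    (hC : IsCrossCycle (HRel src tgt res) π C) : ∃ e, Closes src tgt res π e := by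
  obtain ⟨i, j, a, P, Q, h1, h2, h3, h4, -⟩ := hC
  obtain ⟨e, he, rfl, rfl⟩ := h1.1
  exact ⟨e, he, _, _, _, h1.properCycle h2 h3 h4⟩

/-- The cycle `C` may be selected by the algorithm. -/
def Selectable (R : Fin n → Fin n → Prop) (π : Fin n → Option (Fin n)) (C : List (Fin n)) : Prop :=
  IsBackwardCycle R π C ∨ ((∀ C', ¬ IsBackwardCycle R π C') ∧ IsForwardCycle R π C) ∨
    ((∀ C', ¬ IsBackwardCycle R π C') ∧ (∀ C', ¬ IsForwardCycle R π C') ∧ IsCrossCycle R π C)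

/-- The outcome of the search for a proper cycle, in the variable `12`: either `-1`, if there is
none, or a half-edge such that all proper cycles that it closes may be selected. -/
def SearchOutcome (src tgt : Fin M → Fin n) (res : Fin M → Prop) (π : Fin n → Option (Fin n))
    (σ : State) : Prop :=
  (σ.var 12 = -1 ∧ (∀ C, ¬ IsBackwardCycle (HRel src tgt res) π C) ∧
    (∀ C, ¬ IsForwardCycle (HRel src tgt res) π C) ∧ ∀ C, ¬ IsCrossCycle (HRel src tgt res) π C) ∨
  ∃ e : Fin M, σ.var 12 = ((e : ℕ) : ℤ) ∧ Closes src tgt res π e ∧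
    ∀ a P Q, ProperCycle (HRel src tgt res) π (src e) (tgt e) a P Q →
      Selectable (HRel src tgt res) π (P ++ Q.tail)

theorem searchOutcome_of_found (h : IsNumbering (HRel src tgt res) π pre post)
    (hirr : ∀ v, ¬ HRel src tgt res v v) {σ : State}
    (h1 : Found 9 (fun e => Closes src tgt res π e ∧ Ancestor π (tgt e) (src e)) σ)
    (h2 : Found 10 (fun e => Closes src tgt res π e ∧ Ancestor π (src e) (tgt e)) σ)
    (h3 : Found 11 (fun e => Closes src tgt res π e) σ)
    (h12 : σ.var 12 = if 0 ≤ σ.var 9 then σ.var 9 else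
      if 0 ≤ σ.var 10 then σ.var 10 else σ.var 11) : SearchOutcome src tgt res π σ := by
  rcases h1 with ⟨h1, h1'⟩ | ⟨e, h1, h1'⟩
  swap
  · refine .inr ⟨e, by simp [h12, h1], h1'.1, fun a P Q hC => .inl (hC.isBackwardCycle h h1'.2)⟩
  have hb : ∀ C, ¬ IsBackwardCycle (HRel src tgt res) π C := fun C hC => by
    obtain ⟨e, he⟩ := hC.exists_closes h hirr
    exact h1' e he
  rcases h2 with ⟨h2, h2'⟩ | ⟨e, h2, h2'⟩
  swap
  · refine .inr ⟨e, by simp [h12, h1, h2], h2'.1,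
      fun a P Q hC => .inr (.inl ⟨hb, hC.isForwardCycle h h2'.2⟩)⟩
  have hf : ∀ C, ¬ IsForwardCycle (HRel src tgt res) π C := fun C hC => by
    obtain ⟨e, he⟩ := hC.exists_closes h hirr
    exact h2' e he
  rcases h3 with ⟨h3, h3'⟩ | ⟨e, h3, h3'⟩
  · refine .inl ⟨by simp [h12, h1, h2, h3], hb, hf, fun C hC => ?_⟩
    obtain ⟨e, he⟩ := hC.exists_closes
    exact h3' e he
  · refine .inr ⟨e, by simp [h12, h1, h2, h3], h3', fun a P Q hC => .inr (.inr ⟨hb, hf, ?_⟩)⟩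
    exact hC.isCrossCycle (fun hc => h2' e ⟨h3', hc⟩) (fun hc => h1' e ⟨h3', hc⟩)

theorem scansProg_spec {σ : State} (h : ForestAt src tgt res π pre post σ)
    (hg : GraphAt src tgt rev σ) (hres : ∀ e : Fin M, σ.arr 8 ((e : ℕ) : ℤ) = 1 ↔ res e)
    (hirr : ∀ v, ¬ HRel src tgt res v v) (hM : I.int 0 1 + I.int 0 1 = M) :
    HaltsIn I scansProg σ (1000 * (M + 1))
      (fun σ' => SearchOutcome src tgt res π σ' ∧ Keeps scansProg σ σ') := by
  refine HaltsIn.keeps ?_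
  have ht : ∀ σ', σ'.arr = σ.arr → ∀ e : Fin M, σ'.var 0 = ((e : ℕ) : ℤ) →
      (cycleTest.holds I σ' ↔ Closes src tgt res π e) ∧
      ((ancTest tgtE srcE).holds I σ' ↔ Ancestor π (tgt e) (src e)) ∧
      ((ancTest srcE tgtE).holds I σ' ↔ Ancestor π (src e) (tgt e)) := by
    intro σ' ha e he
    have h' := h.congr (σ' := σ') (by simp [ha])
    have hg' := hg.congr (σ' := σ') (by simp [ha])
    have h1 : srcE.eval I σ' = ((src e : ℕ) : ℤ) := by simp [he, hg'.src]
    have h2 : tgtE.eval I σ' = ((tgt e : ℕ) : ℤ) := by simp [he, hg'.tgt]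
    exact ⟨h'.cycleTest_iff hg' (by simpa [ha] using hres) hirr he, h'.ancTest_iff h2 h1,
      h'.ancTest_iff h1 h2⟩
  have s1 := scan_spec (I := I) (x := 9) (t := .conj cycleTest (ancTest tgtE srcE)) (σ := σ) rfl hM
    (T := fun e => Closes src tgt res π e ∧ Ancestor π (tgt e) (src e))
    (fun σ' ha e he => and_congr (ht σ' ha e he).1 (ht σ' ha e he).2.1)
  refine HaltsIn.chain s1 ?_ fun σ₁ ⟨f1, k1⟩ => ?_
  · simp only [cycleTest, ancTest, BExpr.steps, BExpr.eq, IExpr.steps]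
    omega
  have a1 : σ₁.arr = σ.arr := funext fun k => k1.arr k rfl
  have s2 := scan_spec (I := I) (x := 10) (t := .conj cycleTest (ancTest srcE tgtE)) (σ := σ₁)
    rfl hM (T := fun e => Closes src tgt res π e ∧ Ancestor π (src e) (tgt e))
    (fun σ' ha e he => and_congr (ht σ' (ha.trans a1) e he).1 (ht σ' (ha.trans a1) e he).2.2)
  refine HaltsIn.chain s2 ?_ fun σ₂ ⟨f2, k2⟩ => ?_
  · simp only [cycleTest, ancTest, BExpr.steps, BExpr.eq, IExpr.steps]
    omega
  have a2 : σ₂.arr = σ.arr := (funext fun k => k2.arr k rfl).trans a1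
  have s3 := scan_spec (I := I) (x := 11) (t := cycleTest) (σ := σ₂)
    rfl hM (T := fun e => Closes src tgt res π e)
    (fun σ' ha e he => (ht σ' (ha.trans a2) e he).1)
  refine HaltsIn.chain s3 ?_ fun σ₃ ⟨f3, k3⟩ => HaltsIn.of_wp_le ?_ ?_
  · simp only [cycleTest, ancTest, BExpr.steps, BExpr.eq, IExpr.steps]
    omega
  · simp only [cycleTest, ancTest, BExpr.steps, BExpr.eq, IExpr.steps, Prog.cost]
    omega
  have f1' : Found 9 (fun e => Closes src tgt res π e ∧ Ancestor π (tgt e) (src e)) σ₃ := by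
    simpa only [Found, k3.var 9 rfl, k2.var 9 rfl] using f1
  have f2' : Found 10 (fun e => Closes src tgt res π e ∧ Ancestor π (src e) (tgt e)) σ₃ := by
    simpa only [Found, k3.var 10 rfl] using f2
  have fin : ∀ z, (z = if 0 ≤ σ₃.var 9 then σ₃.var 9 else
      if 0 ≤ σ₃.var 10 then σ₃.var 10 else σ₃.var 11) →
      SearchOutcome src tgt res π (σ₃.setVar 12 z) := by
    intro z hz
    refine searchOutcome_of_found h.num hirr ?_ ?_ ?_ (by simpa using hz)
    · simpa [Found] using f1'
    · simpa [Found] using f2'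
    · simpa [Found] using f3
  simp only [Prog.wp, BExpr.holds, IExpr.eval]
  exact ⟨fun h9 => fin _ (by simp [h9]), fun h9 => ⟨fun h10 => fin _ (by simp [h9, h10]),
    fun h10 => fin _ (by simp [h9, h10])⟩⟩

end Search

/-! ### Augmentation in the memory -/

section Overlay

variable {m : ℕ}

/-- The array `A`, overwritten with the vector `g` from the position `B` on. -/
def overlay (A : ℤ → ℤ) (B : ℤ) (g : Fin m → ℤ) (z : ℤ) : ℤ :=
  if h : B ≤ z ∧ z < B + m then g ⟨(z - B).toNat, by omega⟩ else A z

@[simp] theorem overlay_at (A : ℤ → ℤ) (B : ℤ) (g : Fin m → ℤ) (a : Fin m) :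
    overlay A B g (B + ((a : ℕ) : ℤ)) = g a := by
  have := a.2
  rw [overlay, dif_pos (by omega)]
  congr 1
  ext
  simp

theorem overlay_of_lt (A : ℤ → ℤ) {B z : ℤ} (g : Fin m → ℤ) (h : z < B) :
    overlay A B g z = A z := by
  rw [overlay, dif_neg (by omega)]

theorem overlay_of_le (A : ℤ → ℤ) {B z : ℤ} (g : Fin m → ℤ) (h : B + m ≤ z) :
    overlay A B g z = A z := by
  rw [overlay, dif_neg (by omega)]

theorem overlay_eq_self {A : ℤ → ℤ} {B : ℤ} {g : Fin m → ℤ}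
    (h : ∀ a : Fin m, A (B + ((a : ℕ) : ℤ)) = g a) : overlay A B g = A := by
  ext z
  rw [overlay]
  split_ifs with hz
  · rw [← h]
    congr 1
    simp only
    omega
  · rfl

theorem update_overlay (A : ℤ → ℤ) (B : ℤ) (g : Fin m → ℤ) (a : Fin m) (z : ℤ) :
    Function.update (overlay A B g) (B + ((a : ℕ) : ℤ)) z =
      overlay A B (Function.update g a z) := by
  have ha := a.2
  ext w
  rw [Function.update_apply]
  split_ifs with h
  · rw [h, overlay_at, Function.update_self]
  · simp only [overlay]
    split_ifs with h'
    · rw [Function.update_of_ne]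
      intro hc
      have := congrArg Fin.val hc
      simp only at this
      omega
    · rfl

end Overlay

/-- Push one unit of flow along the half-edge `7`, in the topmost flow on the stack. -/
def pushProg : Prog :=
  .cond (.lt (.var 7) mE)
    (.store 0 (.add (.var 2) (.var 7)) (.add (.arr 0 (.add (.var 2) (.var 7))) (.const 1)))
    (.store 0 (.add (.var 2) (.sub (.var 7) mE))
      (.sub (.arr 0 (.add (.var 2) (.sub (.var 7) mE))) (.const 1)))

/-- Push one unit of flow along the cycle that the half-edge `12` closes: along the half-edge, then
up from its target to the first ancestor of its source, and finally down to its source (in reverse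
order). -/
def augmentProg : Prog :=
  .seq (block [.assign 13 (.arr 4 (.var 12)), .assign 14 (.arr 3 (.var 12)), .assign 7 (.var 12),
      pushProg])
    (.seq (.loop (.neg (ancTest (.var 13) (.var 14)))
        (block [.assign 7 (.arr 5 (.arr 13 (.var 13))), pushProg, .assign 13 (.arr 12 (.var 13))]))
      (.loop (.neg (.eq (.var 14) (.var 13)))
        (block [.assign 7 (.arr 13 (.var 14)), pushProg, .assign 14 (.arr 12 (.var 14))])))

section Augment

variable {n m : ℕ} {I : Input}

/-- The sources of the half-edges of a network. -/
def Network.hsrc (N : Network n m) : Fin (m + m) → Fin n := Fin.append N.tail N.head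

/-- The targets of the half-edges of a network. -/
def Network.htgt (N : Network n m) : Fin (m + m) → Fin n := Fin.append N.head N.tail

/-- The reversal of half-edges. -/
def hrev : Fin (m + m) → Fin (m + m) := Fin.append (Fin.natAdd m) (Fin.castAdd m)

/-- The state `σ` with the contents of the array `0` replaced by `A`. -/
def State.withFlow (σ : State) (A : ℤ → ℤ) : State := { σ with arr := Function.update σ.arr 0 A }

@[simp] theorem State.withFlow_var (σ : State) (A : ℤ → ℤ) : (σ.withFlow A).var = σ.var := rfl
@[simp] theorem State.withFlow_arr (σ : State) (A : ℤ → ℤ) (k : ℕ) :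
    (σ.withFlow A).arr k = if k = 0 then A else σ.arr k := Function.update_apply _ _ _ _

theorem pushProg_wp {N : Network n m} (hN : N.IsSimple) (hm : I.int 0 1 = m) {σ : State}
    {e : Fin (m + m)} (he : σ.var 7 = ((e : ℕ) : ℤ)) {A : ℤ → ℤ} {g : Fin m → ℤ}
    (hA : σ.arr 0 = overlay A (σ.var 2) g) {Q : State → Prop}
    (hQ : Q (σ.withFlow (overlay A (σ.var 2) (g + N.arcUnit (N.hsrc e, N.htgt e))))) :
    pushProg.wp I Q σ := by
  simp only [pushProg, Prog.wp, BExpr.holds_lt, IExpr.eval, he, hm]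
  induction e using Fin.addCases with
  | left a =>
    have ha := a.2
    refine ⟨fun _ => ?_, fun hc => absurd (by simp) hc⟩
    simp only [Network.hsrc, Network.htgt, Fin.append_left, hN.arcUnit_forward] at hQ
    have e1 : g + Pi.single a 1 = Function.update g a (g a + 1) := by
      ext b; by_cases hb : b = a
      · subst hb; simp
      · simp [hb]
    rw [e1, ← update_overlay, ← hA] at hQ
    have e2 : g a = σ.arr 0 (σ.var 2 + ((a : ℕ) : ℤ)) := by rw [hA]; simp
    rw [e2] at hQ
    exact hQ
  | right a =>
    refine ⟨fun hc => absurd hc (by simp), fun _ => ?_⟩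
    simp only [Network.hsrc, Network.htgt, Fin.append_right, hN.arcUnit_backward] at hQ
    have e1 : g + Pi.single a (-1) = Function.update g a (g a - 1) := by
      ext b; by_cases hb : b = a
      · subst hb; simp [sub_eq_add_neg]
      · simp [hb]
    rw [e1, ← update_overlay, ← hA] at hQ
    have e2 : g a = σ.arr 0 (σ.var 2 + ((a : ℕ) : ℤ)) := by rw [hA]; simp
    rw [e2] at hQ
    have e3 : (((Fin.natAdd m a : Fin (m + m)) : ℕ) : ℤ) - m = ((a : ℕ) : ℤ) := by simp
    rw [e3]
    exact hQ

/-- The flow along the arcs of a list of nodes. -/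
def Network.pathFlow (N : Network n m) (P : List (Fin n)) (a : Fin m) : ℤ :=
  ((pathArcs P).map fun p => N.arcUnit p a).sum

theorem Network.pathFlow_singleton (N : Network n m) (x : Fin n) : N.pathFlow [x] = 0 := by
  ext a; simp [Network.pathFlow, pathArcs]

theorem Network.pathFlow_concat (N : Network n m) {R : Fin n → Fin n → Prop} {x y z : Fin n}
    {P : List (Fin n)} (hP : IsPathFromTo R x y P) :
    N.pathFlow (P ++ [z]) = N.pathFlow P + N.arcUnit (y, z) := by
  have h : IsPathFromTo (fun _ _ => True) y z [y, z] :=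
    (IsPathFromTo.singleton _ z).cons trivial
  have e : pathArcs (P ++ [z]) = pathArcs P ++ [(y, z)] := pathArcs_append h hP
  ext a
  simp [Network.pathFlow, e]

theorem Network.pathFlow_cons (N : Network n m) {R : Fin n → Fin n → Prop} {x y z : Fin n}
    {P : List (Fin n)} (hP : IsPathFromTo R y z P) :
    N.pathFlow (x :: P) = N.pathFlow P + N.arcUnit (x, y) := by
  have e : pathArcs (x :: P) = (x, y) :: pathArcs P := by
    rcases hP.cases with ⟨-, h1⟩ | ⟨z, P', h1, -, -⟩ <;> subst h1 <;> simp [pathArcs]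
  ext a
  simp [Network.pathFlow, e, add_comm]

theorem hsrc_hrev (N : Network n m) (e : Fin (m + m)) : N.hsrc (hrev e) = N.htgt e := by
  induction e using Fin.addCases <;>
    simp only [Network.hsrc, Network.htgt, hrev, Fin.append_left, Fin.append_right]

theorem htgt_hrev (N : Network n m) (e : Fin (m + m)) : N.htgt (hrev e) = N.hsrc e := by
  induction e using Fin.addCases <;>
    simp only [Network.hsrc, Network.htgt, hrev, Fin.append_left, Fin.append_right]

end Augment

section Augment

variable {n m : ℕ} {I : Input} {N : Network n m} {res : Fin (m + m) → Prop}
  {π : Fin n → Option (Fin n)} {pre : Fin n → ℕ} {post : Fin n → ℕ∞}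

/-- Starting from an arc that closes a proper cycle, the program augments the flow along a proper
cycle. -/
theorem augmentProg_spec (hN : N.IsSimple) (hm : I.int 0 1 = m) {σ : State}
    (h : ForestAt N.hsrc N.htgt res π pre post σ) (hg : GraphAt N.hsrc N.htgt hrev σ)
    {e : Fin (m + m)} (he : σ.var 12 = ((e : ℕ) : ℤ)) (hc : Closes N.hsrc N.htgt res π e)
    {A : ℤ → ℤ} {g : Fin m → ℤ} (hA : σ.arr 0 = overlay A (σ.var 2) g) :
    HaltsIn I augmentProg σ (200 * (n + 1))
      (fun σ' => (∃ a P Q, ProperCycle (HRel N.hsrc N.htgt res) π (N.hsrc e) (N.htgt e) a P Q ∧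
        σ'.arr 0 = overlay A (σ.var 2)
          (g + N.arcUnit (N.hsrc e, N.htgt e) + N.pathFlow P + N.pathFlow Q)) ∧
        Keeps augmentProg σ σ') := by
  refine HaltsIn.keeps ?_
  obtain ⟨-, a, P₀, Q₀, hC⟩ := hc
  set i := N.hsrc e with hi
  set j := N.htgt e with hj
  have hnum := h.num
  -- after the arc itself
  have s1 : HaltsIn I (block [.assign 13 (.arr 4 (.var 12)), .assign 14 (.arr 3 (.var 12)),
      .assign 7 (.var 12), pushProg]) σ 60 (fun σ' =>
        (σ'.var 13 = ((j : ℕ) : ℤ) ∧ σ'.var 14 = ((i : ℕ) : ℤ) ∧ σ'.var 2 = σ.var 2 ∧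
        σ'.arr 0 = overlay A (σ.var 2) (g + N.arcUnit (i, j))) ∧ Keeps augmentProg σ σ') := by
    refine (HaltsIn.of_wp_le ?_ ?_ : HaltsIn I _ σ 60 (fun σ' =>
        (σ'.var 13 = ((j : ℕ) : ℤ) ∧ σ'.var 14 = ((i : ℕ) : ℤ) ∧ σ'.var 2 = σ.var 2 ∧
        σ'.arr 0 = overlay A (σ.var 2) (g + N.arcUnit (i, j))))).keeps.mono le_rfl
          fun σ' hk => ⟨hk.1, hk.2.seq_left⟩
    · simp only [block, pushProg, Prog.cost, IExpr.steps, BExpr.steps, BExpr.lt]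
      omega
    · simp only [block, Prog.wp]
      refine pushProg_wp hN hm (e := e) (A := A) (g := g) (by simp [he]) (by simpa using hA) ?_
      simp [he, hg.src, hg.tgt, ← hi, ← hj]
  refine HaltsIn.chain s1 (by omega) fun σ₁ ⟨⟨v13, v14, v2, a0⟩, k1⟩ => ?_
  -- the ascent; the credit is the number of the node, which decreases on the way up
  have s2 := HaltsIn.loop (I := I) (t := .neg (ancTest (.var 13) (.var 14)))
    (p := block [.assign 7 (.arr 5 (.arr 13 (.var 13))), pushProg, .assign 13 (.arr 12 (.var 13))])
    (fun σ' b => ∃ (x : Fin n) (P : List (Fin n)), σ'.var 13 = ((x : ℕ) : ℤ) ∧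
      σ'.var 14 = ((i : ℕ) : ℤ) ∧ σ'.var 2 = σ.var 2 ∧ Climbs (HRel N.hsrc N.htgt res) π x a ∧
      IsPathFromTo (ShortBackArc (HRel N.hsrc N.htgt res) π) j x P ∧
      σ'.arr 0 = overlay A (σ.var 2) (g + N.arcUnit (i, j) + N.pathFlow P) ∧
      Keeps augmentProg σ σ' ∧ pre x * 90 ≤ b) ?_ (σ := σ₁) (b := n * 90)
      ⟨j, [j], v13, v14, v2, hC.up.reflTransGen.1, .singleton _ _,
        by rw [a0, N.pathFlow_singleton, add_zero], k1,
        Nat.mul_le_mul_right _ (by simpa using hnum.pre_le j)⟩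
  swap
  · rintro σ' b ⟨x, P, w13, w14, w2, hx, hP, w0, hk, hb⟩ ht
    have h' := h.of_keeps hk rfl
    have hg' := hg.of_keeps hk rfl
    have hxi : ¬ Ancestor π x i := by
      rw [← h'.ancTest_iff (I := I) (x := .var 13) (y := .var 14) w13 w14]
      exact ht
    rcases Relation.ReflTransGen.cases_head hx with rfl | ⟨y, hxy, hy⟩
    · exact absurd hC.fca.1 hxi
    obtain ⟨e', he', -, hs, ht'⟩ := h'.edge _ _ hxy.2
    have hlt := hnum.tree_lt _ _ hxy.2
    refine ⟨60, pre y * 90, ?_, HaltsIn.mono (HaltsIn.keeps (HaltsIn.of_wp_le (Q := fun σ'' =>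
      σ''.var 13 = ((y : ℕ) : ℤ) ∧ σ''.var 14 = ((i : ℕ) : ℤ) ∧ σ''.var 2 = σ.var 2 ∧
      σ''.arr 0 = overlay A (σ.var 2) (g + N.arcUnit (i, j) + N.pathFlow (P ++ [y]))) ?_ ?_))
      le_rfl ?_⟩
    · simp only [ancTest, BExpr.steps, IExpr.steps]
      omega
    · simp only [block, pushProg, Prog.cost, IExpr.steps, BExpr.steps, BExpr.lt]
      omega
    · simp only [block, Prog.wp]
      refine pushProg_wp hN hm (e := hrev e') (A := A)
        (g := g + N.arcUnit (i, j) + N.pathFlow P) ?_ ?_ ?_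
      · simp [w13, he', hg'.rev]
      · simpa [w2] using w0
      · rw [hsrc_hrev, htgt_hrev, hs, ht', N.pathFlow_concat hP]
        simp [w13, w14, w2, h'.pred, hxy.2, nodeCode, add_assoc]
    · rintro σ'' ⟨⟨u13, u14, u2, u0⟩, hk'⟩
      exact ⟨y, _, u13, u14, u2, hy, hP.concat hxy, u0,
        hk.trans hk'.loop.seq_left.seq_right, le_rfl⟩
  refine HaltsIn.chain s2 ?_ ?_
  · simp only [ancTest, BExpr.steps, IExpr.steps]
    omega
  rintro σ₂ ⟨⟨b, x, P, v13, v14, v2, hx, hP, a0, k2, -⟩, ht⟩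
  have h₂ := h.of_keeps k2 rfl
  have hxi : Ancestor π x i := by
    rw [← h₂.ancTest_iff (I := I) (x := .var 13) (y := .var 14) v13 v14]
    exact not_not.1 ht
  have hxa : x = a := hnum.antisymm (hC.fca.2.2 x hxi (Climbs.ancestor hP.reflTransGen.1))
    hx.ancestor
  subst hxa
  -- the descent, in reverse order
  have s3 := HaltsIn.loop (I := I) (t := .neg (.eq (.var 14) (.var 13)))
    (p := block [.assign 7 (.arr 13 (.var 14)), pushProg, .assign 14 (.arr 12 (.var 14))])
    (fun σ' b => ∃ (y : Fin n) (Q : List (Fin n)), σ'.var 13 = ((x : ℕ) : ℤ) ∧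
      σ'.var 14 = ((y : ℕ) : ℤ) ∧ σ'.var 2 = σ.var 2 ∧ Ancestor π x y ∧
      IsPathFromTo (TreeArc π) y i Q ∧
      σ'.arr 0 = overlay A (σ.var 2) (g + N.arcUnit (i, j) + N.pathFlow P + N.pathFlow Q) ∧
      Keeps augmentProg σ σ' ∧ pre y * 90 ≤ b) ?_ (σ := σ₂) (b := n * 90)
      ⟨i, [i], v13, v14, v2, hxi, .singleton _ _,
        by rw [a0, N.pathFlow_singleton, add_zero], k2,
        Nat.mul_le_mul_right _ (by simpa using hnum.pre_le i)⟩
  swap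
  · rintro σ' b ⟨y, Q, w13, w14, w2, hy, hQ, w0, hk, hb⟩ ht
    have h' := h.of_keeps hk rfl
    have hyx : y ≠ x := by
      simp only [BExpr.holds, BExpr.holds_eq, IExpr.eval, w13, w14] at ht
      rintro rfl
      exact ht rfl
    rcases ancestor_iff.1 hy with rfl | ⟨z, hyz, hz⟩
    · exact absurd rfl hyx
    obtain ⟨e', he', -, hs, ht'⟩ := h'.edge _ _ hyz
    have hlt := hnum.tree_lt _ _ hyz
    refine ⟨60, pre z * 90, ?_, HaltsIn.mono (HaltsIn.keeps (HaltsIn.of_wp_le (Q := fun σ'' =>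
      σ''.var 13 = ((x : ℕ) : ℤ) ∧ σ''.var 14 = ((z : ℕ) : ℤ) ∧ σ''.var 2 = σ.var 2 ∧
      σ''.arr 0 = overlay A (σ.var 2)
        (g + N.arcUnit (i, j) + N.pathFlow P + N.pathFlow (z :: Q))) ?_ ?_)) le_rfl ?_⟩
    · simp only [BExpr.eq, BExpr.steps, IExpr.steps]
      omega
    · simp only [block, pushProg, Prog.cost, IExpr.steps, BExpr.steps, BExpr.lt]
      omega
    · simp only [block, Prog.wp]
      refine pushProg_wp hN hm (e := e') (A := A)
        (g := g + N.arcUnit (i, j) + N.pathFlow P + N.pathFlow Q) ?_ ?_ ?_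
      · simp [w14, he']
      · simpa [w2] using w0
      · rw [hs, ht', N.pathFlow_cons hQ]
        simp [w13, w14, w2, h'.pred, hyz, nodeCode, add_assoc]
    · rintro σ'' ⟨⟨u13, u14, u2, u0⟩, hk'⟩
      exact ⟨z, _, u13, u14, u2, hz, hQ.cons hyz, u0,
        hk.trans hk'.loop.seq_right.seq_right, le_rfl⟩
  refine s3.mono ?_ ?_
  · simp only [ancTest, BExpr.eq, BExpr.steps, IExpr.steps]
    omega
  · rintro σ₃ ⟨⟨b, y, Q, v13, v14, v2, hy, hQ, a0, k3, -⟩, ht⟩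
    simp only [BExpr.holds, BExpr.holds_eq, IExpr.eval, v13, v14, not_not] at ht
    have hyx : y = x := Fin.ext (by exact_mod_cast ht)
    subst hyx
    exact ⟨y, P, Q, ⟨hC.arc, hC.ne, hC.not_tree, hC.not_short, hC.fca, hP, hQ⟩, a0⟩

end Augment

/-! ### One call of the procedure -/

/-- The position of the arc `0` in the topmost call on the stack. -/
abbrev topE : IExpr := .add (.var 2) (.var 0)

/-- The position of the arc `e` in the block above the topmost one. -/
abbrev nextE (e : IExpr) : IExpr := .add (.add (.var 2) mE) e

/-- Determine the residual half-edges of the topmost call. -/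
def residualProg : Prog :=
  forLoop 0 mE (block
    [.cond (.lt (.arr 0 topE) (.arr 2 topE)) (.store 8 (.var 0) (.const 1))
      (.store 8 (.var 0) (.const 0)),
    .cond (.lt (.arr 1 topE) (.arr 0 topE)) (.store 8 (.add mE (.var 0)) (.const 1))
      (.store 8 (.add mE (.var 0)) (.const 0))])

/-- Reset the lists that are still to be searched, and mark all nodes as not visited. -/
def resetProg : Prog :=
  forLoop 0 nE (block [.store 9 (.var 0) (.arr 7 (.var 0)), .store 10 (.var 0) (.const 0)])

/-- Copy the topmost call. -/
def copyProg : Prog :=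
  forLoop 0 mE (block [.store 0 (nextE (.var 0)) (.arr 0 topE),
    .store 1 (nextE (.var 0)) (.arr 1 topE), .store 2 (nextE (.var 0)) (.arr 2 topE)])

/-- Print the flow of the topmost call. -/
def printProg : Prog := forLoop 0 mE (.emit (.arr 0 topE))

/-- Branch at the arc of the half-edge `12`: change its bounds in the two topmost calls, of which
the upper one holds the old flow and the lower one the new flow. -/
def boundsProg : Prog :=
  .cond (.lt (.var 12) mE)
    (block [.store 2 (nextE (.var 12)) (.arr 0 (nextE (.var 12))),
      .store 1 (.add (.var 2) (.var 12)) (.add (.arr 0 (nextE (.var 12))) (.const 1))])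
    (block [.assign 7 (.sub (.var 12) mE), .store 1 (nextE (.var 7)) (.arr 0 (nextE (.var 7))),
      .store 2 (.add (.var 2) (.var 7)) (.sub (.arr 0 (nextE (.var 7))) (.const 1))])

/-- Replace the topmost call by its two recursive calls, with the one for the old flow on top. -/
def branchProg : Prog :=
  .seq copyProg (.seq augmentProg (.seq printProg
    (block [boundsProg, incr 1, .assign 2 (.add (.var 2) mE)])))

/-- Remove the topmost call. -/
def popProg : Prog := block [.assign 1 (.sub (.var 1) (.const 1)), .assign 2 (.sub (.var 2) mE)]

/-- Execute the topmost call up to its recursive calls. -/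
def callProg : Prog :=
  .seq residualProg (.seq resetProg (.seq dfsProg (.seq scansProg
    (.cond (.ile (.const 0) (.var 12)) branchProg popProg))))

section Call

variable {n m : ℕ} {I : Input} {cbar : Fin m → ℝ}

open Classical in
/-- The lower capacities, with the value of the flow on the arcs of non-zero reduced cost, where
the flow may not be changed. -/
noncomputable def Network.effLo (N : Network n m) (cbar : Fin m → ℝ) (f : Fin m → ℤ) (a : Fin m) :
    ℤ := if cbar a = 0 then N.lo a else f a

open Classical in
/-- The upper capacities, with the value of the flow on the arcs of non-zero reduced cost, where
the flow may not be changed. -/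
noncomputable def Network.effUp (N : Network n m) (cbar : Fin m → ℝ) (f : Fin m → ℤ) (a : Fin m) :
    ℤ := if cbar a = 0 then N.up a else f a

/-- The memory holds the call of the procedure for the network `N` and the flow `f`, at the position
`B` of the stack. -/
structure CallAt (cbar : Fin m → ℝ) (N : Network n m) (f : Fin m → ℤ) (B : ℤ) (σ : State) :
    Prop where
  flow : ∀ a : Fin m, σ.arr 0 (B + ((a : ℕ) : ℤ)) = f a
  lo : ∀ a : Fin m, σ.arr 1 (B + ((a : ℕ) : ℤ)) = N.effLo cbar f a
  up : ∀ a : Fin m, σ.arr 2 (B + ((a : ℕ) : ℤ)) = N.effUp cbar f a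

/-- The residual half-edges. -/
def Network.hres (N : Network n m) (cbar : Fin m → ℝ) (f : Fin m → ℤ) : Fin (m + m) → Prop :=
  Fin.append (fun a => f a < N.effUp cbar f a) (fun a => N.effLo cbar f a < f a)

theorem Network.hRel_hres (N : Network n m) (f : Fin m → ℤ) :
    HRel N.hsrc N.htgt (N.hres cbar f) = N.ResArc cbar f := by
  have hu : ∀ a, f a < N.effUp cbar f a ↔ cbar a = 0 ∧ f a < N.up a := by
    intro a
    simp only [Network.effUp]
    split_ifs with h <;> simp [h]
  have hl : ∀ a, N.effLo cbar f a < f a ↔ cbar a = 0 ∧ N.lo a < f a := by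
    intro a
    simp only [Network.effLo]
    split_ifs with h <;> simp [h]
  ext i j
  constructor
  · rintro ⟨e, he, rfl, rfl⟩
    induction e using Fin.addCases with
    | left a =>
      simp only [Network.hres, Network.hsrc, Network.htgt, Fin.append_left, hu] at he ⊢
      exact ⟨a, he.1, .inl ⟨rfl, rfl, he.2⟩⟩
    | right a =>
      simp only [Network.hres, Network.hsrc, Network.htgt, Fin.append_right, hl] at he ⊢
      exact ⟨a, he.1, .inr ⟨rfl, rfl, he.2⟩⟩
  · rintro ⟨a, h0, ⟨rfl, rfl, h⟩ | ⟨rfl, rfl, h⟩⟩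
    · refine ⟨Fin.castAdd m a, ?_, ?_, ?_⟩ <;>
        simp only [Network.hres, Network.hsrc, Network.htgt, Fin.append_left, hu]
      exact ⟨h0, h⟩
    · refine ⟨Fin.natAdd m a, ?_, ?_, ?_⟩ <;>
        simp only [Network.hres, Network.hsrc, Network.htgt, Fin.append_right, hl]
      exact ⟨h0, h⟩

theorem Network.IsSimple.eq_hrev {N : Network n m} (hN : N.IsSimple) {e e' : Fin (m + m)}
    (h1 : N.hsrc e' = N.htgt e) (h2 : N.htgt e' = N.hsrc e) : e' = hrev e := by
  induction e using Fin.addCases <;> induction e' using Fin.addCases <;>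
    simp only [Network.hsrc, Network.htgt, hrev, Fin.append_left, Fin.append_right] at h1 h2 ⊢
  · exact absurd ⟨h1, h2⟩ (hN.no_antiparallel _ _)
  · rw [hN.simple _ _ h2 h1]
  · rw [hN.simple _ _ h1 h2]
  · exact absurd ⟨h2, h1⟩ (hN.no_antiparallel _ _)

theorem Network.IsSimple.hRel_rev {N : Network n m} (hN : N.IsSimple) (res : Fin (m + m) → Prop)
    (e : Fin (m + m)) : HRel N.hsrc N.htgt res (N.htgt e) (N.hsrc e) ↔ res (hrev e) := by
  constructor
  · rintro ⟨e', h1, h2, h3⟩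
    rwa [← hN.eq_hrev h2 h3]
  · exact fun h => ⟨hrev e, h, hsrc_hrev N e, htgt_hrev N e⟩

theorem residualProg_spec {N : Network n m} {f : Fin m → ℤ} (hm : I.int 0 1 = m) {σ : State}
    (h : CallAt cbar N f (σ.var 2) σ) :
    HaltsIn I residualProg σ (100 * (m + 1)) (fun σ' =>
      (∀ e : Fin (m + m), σ'.arr 8 ((e : ℕ) : ℤ) = 1 ↔ N.hres cbar f e) ∧
        Keeps residualProg σ σ') := by
  refine (HaltsIn.forLoop m (fun i σ' => ∀ a : Fin m, (a : ℕ) < i →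
    (σ'.arr 8 ((a : ℕ) : ℤ) = 1 ↔ f a < N.effUp cbar f a) ∧
    (σ'.arr 8 (m + ((a : ℕ) : ℤ)) = 1 ↔ N.effLo cbar f a < f a)) 60 rfl ?_ ?_ ?_).mono ?_ ?_
  · exact fun _ => hm
  · intro a ha; omega
  · intro i hi σ' hk hv hinv
    have h0 := h.flow ⟨i, hi⟩
    have h1 := h.lo ⟨i, hi⟩
    have h2 := h.up ⟨i, hi⟩
    simp only at h0 h1 h2
    rw [← hk.arr 0 rfl, ← hk.var 2 rfl] at h0
    rw [← hk.arr 1 rfl, ← hk.var 2 rfl] at h1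
    rw [← hk.arr 2 rfl, ← hk.var 2 rfl] at h2
    have key : ∀ (x y : ℤ) (A : ℤ → ℤ), (x = 1 ↔ f ⟨i, hi⟩ < N.effUp cbar f ⟨i, hi⟩) →
        (y = 1 ↔ N.effLo cbar f ⟨i, hi⟩ < f ⟨i, hi⟩) →
        A = Function.update (Function.update (σ'.arr 8) (i : ℤ) x) (m + (i : ℤ)) y →
        ∀ a : Fin m, (a : ℕ) < i + 1 →
          (A ((a : ℕ) : ℤ) = 1 ↔ f a < N.effUp cbar f a) ∧
          (A (m + ((a : ℕ) : ℤ)) = 1 ↔ N.effLo cbar f a < f a) := by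
      rintro x y A hx hy rfl a ha
      have ha' := a.2
      have hne : ((a : ℕ) : ℤ) ≠ m + (i : ℤ) := by omega
      have hne' : (m : ℤ) + ((a : ℕ) : ℤ) ≠ i := by omega
      rw [Function.update_of_ne hne]
      by_cases hai : (a : ℕ) = i
      · have : a = ⟨i, hi⟩ := Fin.ext hai
        subst this
        simpa using ⟨hx, hy⟩
      · have h3 : ((a : ℕ) : ℤ) ≠ i := by omega
        have h4 : (m : ℤ) + ((a : ℕ) : ℤ) ≠ m + (i : ℤ) := by omega
        rw [Function.update_of_ne h3, Function.update_of_ne h4, Function.update_of_ne hne']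
        exact hinv a (by omega)
    refine HaltsIn.of_wp_le ?_ ?_
    · simp only [block, Prog.cost, IExpr.steps, BExpr.steps, BExpr.lt]
      omega
    · simp only [block, Prog.wp, BExpr.holds_lt, IExpr.eval, hv, h0, h1, h2, State.setArr_arr,
        State.setArr_var, hm, if_true, State.setVar_arr,
        show (0 : ℕ) ≠ 8 by decide, show (1 : ℕ) ≠ 8 by decide, if_false]
      refine ⟨fun c1 => ⟨fun c2 => ?_, fun c2 => ?_⟩, fun c1 => ⟨fun c2 => ?_, fun c2 => ?_⟩⟩ <;>
        exact key _ _ _ (by simp [c1]) (by simp [c2]) rfl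
  · simp only [IExpr.steps]; omega
  · rintro σ' ⟨h1, hk⟩
    refine ⟨fun e => ?_, hk⟩
    induction e using Fin.addCases with
    | left a => simpa [Network.hres, Fin.append_left] using (h1 a a.2).1
    | right a =>
      simp only [Network.hres, Fin.append_right, Fin.val_natAdd, Nat.cast_add]
      exact (h1 a a.2).2

theorem resetProg_spec (hn : I.int 0 0 = n) {σ : State} :
    HaltsIn I resetProg σ (100 * (n + 1)) (fun σ' =>
      (∀ v : Fin n, σ'.arr 9 ((v : ℕ) : ℤ) = σ.arr 7 ((v : ℕ) : ℤ) ∧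
        σ'.arr 10 ((v : ℕ) : ℤ) = 0) ∧ Keeps resetProg σ σ') := by
  refine (HaltsIn.forLoop n (fun i σ' => ∀ v : Fin n, (v : ℕ) < i →
    σ'.arr 9 ((v : ℕ) : ℤ) = σ.arr 7 ((v : ℕ) : ℤ) ∧ σ'.arr 10 ((v : ℕ) : ℤ) = 0) 60 rfl
    ?_ ?_ ?_).mono ?_ ?_
  · exact fun _ => hn
  · intro v hv; omega
  · intro i hi σ' hk hv hinv
    refine HaltsIn.of_wp_le ?_ ?_
    · simp only [block, Prog.cost, IExpr.steps]
      omega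
    · intro v hvi
      by_cases hai : (v : ℕ) = i
      · simp [hv, hai, hk.arr 7 rfl]
      · have h3 : ((v : ℕ) : ℤ) ≠ i := by omega
        simpa [hv, Function.update_of_ne h3] using hinv v (by omega)
  · simp only [IExpr.steps]; omega
  · rintro σ' ⟨h1, hk⟩
    exact ⟨fun v => h1 v v.2, hk⟩

theorem copyProg_spec (hm : I.int 0 1 = m) {σ : State} :
    HaltsIn I copyProg σ (100 * (m + 1)) (fun σ' =>
      (∀ k < 3, (∀ a : Fin m, σ'.arr k (σ.var 2 + m + ((a : ℕ) : ℤ)) =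
        σ.arr k (σ.var 2 + ((a : ℕ) : ℤ))) ∧ ∀ z < σ.var 2 + m, σ'.arr k z = σ.arr k z) ∧
        Keeps copyProg σ σ') := by
  refine (HaltsIn.forLoop m (fun i σ' => ∀ k < 3, (∀ a : Fin m, (a : ℕ) < i →
      σ'.arr k (σ.var 2 + m + ((a : ℕ) : ℤ)) = σ.arr k (σ.var 2 + ((a : ℕ) : ℤ))) ∧
      ∀ z < σ.var 2 + m, σ'.arr k z = σ.arr k z) 60 rfl
    ?_ ?_ ?_).mono ?_ ?_
  · exact fun _ => hm
  · intro k hk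
    exact ⟨fun a ha => by omega, fun z _ => rfl⟩
  · intro i hi σ' hk hv hinv
    have h2 := hk.var 2 rfl
    refine HaltsIn.of_wp_le ?_ ?_
    · simp only [block, Prog.cost, IExpr.steps]
      omega
    · intro k hk3
      have hA : ∀ A : ℤ → ℤ, A = Function.update (σ'.arr k) (σ.var 2 + m + i)
          (σ'.arr k (σ.var 2 + i)) →
          (∀ a : Fin m, (a : ℕ) < i + 1 → A (σ.var 2 + m + ((a : ℕ) : ℤ)) =
            σ.arr k (σ.var 2 + ((a : ℕ) : ℤ))) ∧ ∀ z < σ.var 2 + m, A z = σ.arr k z := by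
        rintro A rfl
        obtain ⟨i1, i2⟩ := hinv k hk3
        refine ⟨fun a ha => ?_, fun z hz => ?_⟩
        · by_cases hai : (a : ℕ) = i
          · rw [hai, Function.update_self]
            exact i2 _ (by omega)
          · rw [Function.update_of_ne (by omega)]
            exact i1 a (by omega)
        · rw [Function.update_of_ne (by omega)]
          exact i2 z hz
      interval_cases k <;> exact hA _ (by simp [hv, h2, hm])
  · simp only [IExpr.steps]; omega
  · rintro σ' ⟨h1, hk⟩
    exact ⟨fun k h => ⟨fun a => (h1 k h).1 a a.2, (h1 k h).2⟩, hk⟩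

theorem printProg_spec (hm : I.int 0 1 = m) {σ : State} {g : Fin m → ℤ}
    (hg : ∀ a : Fin m, σ.arr 0 (σ.var 2 + ((a : ℕ) : ℤ)) = g a) :
    HaltsIn I printProg σ (100 * (m + 1)) (fun σ' =>
      σ'.out = σ.out ++ List.ofFn g ∧ Keeps printProg σ σ') := by
  refine (HaltsIn.forLoop m (fun i σ' => σ'.out = σ.out ++ (List.ofFn g).take i) 60 rfl
    ?_ ?_ ?_).mono ?_ ?_
  · exact fun _ => hm
  · simp
  · intro i hi σ' hk hv hinv
    refine HaltsIn.of_wp_le ?_ ?_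
    · simp only [Prog.cost, IExpr.steps]
      omega
    · have h1 := hg ⟨i, hi⟩
      simp only at h1
      simp only [Prog.wp, IExpr.eval, hv, hk.arr 0 rfl, hk.var 2 rfl, h1, State.setVar_out,
        State.append_out, hinv]
      rw [List.take_succ_eq_append_getElem (by simpa using hi)]
      simp
  · simp only [IExpr.steps]; omega
  · rintro σ' ⟨h1, hk⟩
    refine ⟨?_, hk⟩
    rw [h1, List.take_of_length_le (by simp)]

end Call

section Branches

variable {n m : ℕ} {cbar : Fin m → ℝ} {N : Network n m} {f g : Fin m → ℤ} {a : Fin m}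

/-- `N₁` and `N₂` are the networks of the two recursive calls of the procedure, called for `f`,
after it has found the flow `g`. -/
def Branches (N : Network n m) (f g : Fin m → ℤ) (N₁ N₂ : Network n m) : Prop :=
  ∃ a, (f a < g a ∧ N₁ = N.setUp a (f a) ∧ N₂ = N.setLo a (f a + 1)) ∨
    (g a < f a ∧ N₁ = N.setLo a (f a) ∧ N₂ = N.setUp a (f a - 1))

theorem Branches.splits {N₁ N₂ : Network n m} (h : Branches N f g N₁ N₂) (hf : N.IntFlow f)
    (hg : g ∈ N.flowsLike cbar f) : Splits N cbar f g N₁ N₂ := by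
  obtain ⟨a, ⟨h1, rfl, rfl⟩ | ⟨h1, rfl, rfl⟩⟩ := h
  · exact .up hf hg h1
  · exact .down hf hg h1

theorem Branches.same_graph {N₁ N₂ : Network n m} (h : Branches N f g N₁ N₂) :
    (N₁.tail = N.tail ∧ N₁.head = N.head) ∧ N₂.tail = N.tail ∧ N₂.head = N.head := by
  obtain ⟨a, ⟨-, rfl, rfl⟩ | ⟨-, rfl, rfl⟩⟩ := h <;> exact ⟨⟨rfl, rfl⟩, rfl, rfl⟩

theorem FindAllOptimalFlows.branch {N₁ N₂ : Network n m} {L₁ L₂ : List (Fin m → ℤ)}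
    (h : FindAnotherOptimalFlow N cbar f (some g)) (hb : Branches N f g N₁ N₂)
    (h1 : FindAllOptimalFlows cbar N₁ f L₁) (h2 : FindAllOptimalFlows cbar N₂ g L₂) :
    FindAllOptimalFlows cbar N f (g :: (L₁ ++ L₂)) := by
  obtain ⟨a, ⟨h3, rfl, rfl⟩ | ⟨h3, rfl, rfl⟩⟩ := hb
  · exact .branch_up _ _ _ a _ _ h h3 h1 h2
  · exact .branch_down _ _ _ a _ _ h h3 h1 h2

theorem Network.effLo_congr (h : ∀ b, cbar b ≠ 0 → g b = f b) :
    N.effLo cbar g = N.effLo cbar f := by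
  ext b
  simp only [Network.effLo]
  split_ifs with hb
  exacts [rfl, h b hb]

theorem Network.effUp_congr (h : ∀ b, cbar b ≠ 0 → g b = f b) :
    N.effUp cbar g = N.effUp cbar f := by
  ext b
  simp only [Network.effUp]
  split_ifs with hb
  exacts [rfl, h b hb]

theorem Network.effLo_setLo (h : cbar a = 0) (z : ℤ) :
    (N.setLo a z).effLo cbar f = Function.update (N.effLo cbar f) a z := by
  ext b
  by_cases hb : b = a
  · subst hb; simp [Network.effLo, Network.setLo, h]
  · simp [Network.effLo, Network.setLo, hb]

theorem Network.effUp_setUp (h : cbar a = 0) (z : ℤ) :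
    (N.setUp a z).effUp cbar f = Function.update (N.effUp cbar f) a z := by
  ext b
  by_cases hb : b = a
  · subst hb; simp [Network.effUp, Network.setUp, h]
  · simp [Network.effUp, Network.setUp, hb]

/-- A proper cycle that the half-edge `e` closes changes the flow on the arc of `e` by one unit. -/
theorem ProperCycle.augment_arc {π : Fin n → Option (Fin n)} {pre : Fin n → ℕ} {post : Fin n → ℕ∞}
    (hN : N.IsSimple) (h : IsNumbering (N.ResArc cbar f) π pre post) {e : Fin (m + m)} {c : Fin n}
    {P Q : List (Fin n)} (hC : ProperCycle (N.ResArc cbar f) π (N.hsrc e) (N.htgt e) c P Q) :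
    ∃ a, cbar a = 0 ∧
      (e = Fin.castAdd m a ∧ N.augment cbar f (P ++ Q.tail) a = f a + 1 ∨
        e = Fin.natAdd m a ∧ N.augment cbar f (P ++ Q.tail) a = f a - 1) := by
  have harc := hC.arc
  have hmem : (N.hsrc e, N.htgt e) ∈ cycleArcs (P ++ Q.tail) :=
    hC.cycleArcs_perm.mem_iff.2 (by simp)
  have hasymm := hC.arcs_asymm h hmem
  have heq := hC.augment_eq hN h
  induction e using Fin.addCases with
  | left a =>
    simp only [Network.hsrc, Network.htgt, Fin.append_left] at harc hmem
    exact ⟨a, (hN.resArc_forward harc).1, .inl ⟨rfl, by simp [heq, Network.chi, hmem]⟩⟩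
  | right a =>
    simp only [Network.hsrc, Network.htgt, Fin.append_right] at harc hmem hasymm
    exact ⟨a, (hN.resArc_backward harc).1, .inr ⟨rfl, by
      simp [heq, Network.chi, hmem, hasymm, sub_eq_add_neg]⟩⟩

theorem Selectable.findAnother {π : Fin n → Option (Fin n)} {C : List (Fin n)}
    (h : Selectable (N.ResArc cbar f) π C) (hπ : IsDFSForest (N.ResArc cbar f) π) :
    FindAnotherOptimalFlow N cbar f (some (N.augment cbar f C)) := by
  rcases h with h | ⟨h1, h⟩ | ⟨h1, h2, h⟩
  · exact .backward π C hπ h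
  · exact .forward π C hπ h1 h
  · exact .cross π C hπ h1 h2 h

end Branches

section Call

variable {n m : ℕ} {I : Input} {cbar : Fin m → ℝ} {N : Network n m} {f g : Fin m → ℤ}

theorem CallAt.congr {B : ℤ} {σ σ' : State} (h : CallAt cbar N f B σ)
    (h' : ∀ k < 3, ∀ z, B ≤ z → z < B + m → σ'.arr k z = σ.arr k z) : CallAt cbar N f B σ' := by
  constructor <;> intro a <;> rw [h' _ (by omega) _ (by omega) (by omega)]
  exacts [h.flow a, h.lo a, h.up a]

/-- The static part of the memory: the half-edges, and the lists of those that leave a node. -/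
structure StaticAt (N : Network n m) (σ : State) : Prop where
  graph : GraphAt N.hsrc N.htgt hrev σ
  lists : ∃ adj : Fin n → List (Fin (m + m)),
    (∀ v : Fin n, Linked (σ.arr 6) (σ.arr 7 ((v : ℕ) : ℤ)) (adj v)) ∧
    (∀ v e, e ∈ adj v ↔ N.hsrc e = v) ∧ ∑ v, (adj v).length = m + m

theorem StaticAt.of_keeps {σ σ' : State} {p : Prog} (h : StaticAt N σ) (hk : Keeps p σ σ')
    (hp : (([3, 4, 5, 6, 7] : List ℕ).all fun k => p.keepsArr k) = true) : StaticAt N σ' := by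
  have hp' := List.all_eq_true.1 hp
  refine ⟨h.graph.congr fun k hk' => hk.arr k (hp' k ?_), ?_⟩
  · simp only [List.mem_cons, List.not_mem_nil, or_false] at hk' ⊢
    tauto
  · rw [hk.arr 6 (hp' 6 (by simp)), hk.arr 7 (hp' 7 (by simp))]
    exact h.lists

theorem StaticAt.congr_network {N' : Network n m} {σ : State} (h : StaticAt N σ)
    (h1 : N'.tail = N.tail) (h2 : N'.head = N.head) : StaticAt N' σ := by
  have e1 : N'.hsrc = N.hsrc := by simp only [Network.hsrc, h1, h2]
  have e2 : N'.htgt = N.htgt := by simp only [Network.htgt, h1, h2]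
  exact ⟨e1 ▸ e2 ▸ h.graph, e1 ▸ h.lists⟩

/-- The topmost call, started in the state `σ`, has been replaced by its two recursive calls, and
the flow `g` has been printed. -/
structure BranchAt (cbar : Fin m → ℝ) (f g : Fin m → ℤ) (N₁ N₂ : Network n m) (σ σ' : State) :
    Prop where
  upper : CallAt cbar N₁ f (σ.var 2 + m) σ'
  lower : CallAt cbar N₂ g (σ.var 2) σ'
  rest : ∀ k < 3, ∀ z < σ.var 2, σ'.arr k z = σ.arr k z
  count : σ'.var 1 = σ.var 1 + 1
  top : σ'.var 2 = σ.var 2 + m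
  out : σ'.out = σ.out ++ List.ofFn g

theorem boundsProg_spec (hm : I.int 0 1 = m) {σ : State} {e : Fin (m + m)} {a : Fin m}
    (he : σ.var 12 = ((e : ℕ) : ℤ)) (ha : cbar a = 0) (hfg : ∀ b, cbar b ≠ 0 → g b = f b)
    (hea : e = Fin.castAdd m a ∧ f a < g a ∨ e = Fin.natAdd m a ∧ g a < f a)
    (hflow : ∀ b : Fin m, σ.arr 0 (σ.var 2 + ((b : ℕ) : ℤ)) = g b)
    (hlo : ∀ b : Fin m, σ.arr 1 (σ.var 2 + ((b : ℕ) : ℤ)) = N.effLo cbar f b)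
    (hup : ∀ b : Fin m, σ.arr 2 (σ.var 2 + ((b : ℕ) : ℤ)) = N.effUp cbar f b)
    (h : CallAt cbar N f (σ.var 2 + m) σ) :
    HaltsIn I (block [boundsProg, incr 1, .assign 2 (.add (.var 2) mE)]) σ 100 (fun σ' =>
      ∃ N₁ N₂, Branches N f g N₁ N₂ ∧ CallAt cbar N₁ f (σ.var 2 + m) σ' ∧
        CallAt cbar N₂ g (σ.var 2) σ' ∧ (∀ k < 3, ∀ z < σ.var 2, σ'.arr k z = σ.arr k z) ∧
        σ'.var 1 = σ.var 1 + 1 ∧ σ'.var 2 = σ.var 2 + m) := by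
  have ham := a.2
  have hfa := h.flow a
  -- the two blocks on the stack are disjoint, so that a store to one of them keeps the other
  have upd1 : ∀ (A : ℤ → ℤ) (x : Fin m → ℤ) (B z : ℤ), (∀ b : Fin m, A (B + ((b : ℕ) : ℤ)) = x b) →
      ∀ b : Fin m, Function.update A (B + ((a : ℕ) : ℤ)) z (B + ((b : ℕ) : ℤ)) =
        Function.update x a z b := by
    intro A x B z hA b
    by_cases hb : b = a
    · subst hb; simp
    · have : (b : ℕ) ≠ a := fun hc => hb (Fin.ext hc)
      rw [Function.update_of_ne hb, Function.update_of_ne (by omega), hA]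
  have upd2 : ∀ (A : ℤ → ℤ) (B B' z : ℤ) (b : Fin m), (B + m ≤ B' ∨ B' + m ≤ B) →
      Function.update A (B + ((a : ℕ) : ℤ)) z (B' + ((b : ℕ) : ℤ)) = A (B' + ((b : ℕ) : ℤ)) := by
    intro A B B' z b hB
    have := b.2
    exact Function.update_of_ne (by omega) _ _
  refine HaltsIn.of_wp_le ?_ ?_
  · simp only [block, boundsProg, incr, Prog.cost, IExpr.steps, BExpr.steps, BExpr.lt]
    omega
  rcases hea with ⟨rfl, hlt⟩ | ⟨rfl, hlt⟩
  · simp only [block, boundsProg, incr, Prog.wp, BExpr.holds_lt, IExpr.eval, he, hm,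
      Fin.val_castAdd]
    refine ⟨fun _ => ?_, fun hc => absurd (by exact_mod_cast ham) hc⟩
    refine ⟨_, _, ⟨a, .inl ⟨hlt, rfl, rfl⟩⟩, ?_, ?_, ?_, ?_⟩
    · refine ⟨fun b => ?_, fun b => ?_, fun b => ?_⟩
      · simpa using h.flow b
      · rw [show (N.setUp a (f a)).effLo cbar f = N.effLo cbar f from rfl, ← h.lo b]
        simp [he, upd2]
      · rw [Network.effUp_setUp ha, ← upd1 _ _ _ _ h.up b]
        simp [he, hfa]
    · refine ⟨fun b => ?_, fun b => ?_, fun b => ?_⟩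
      · simpa using hflow b
      · rw [Network.effLo_setLo ha, Network.effLo_congr hfg, ← upd1 _ _ _ _ hlo b]
        simp [he, hfa]
      · rw [show (N.setLo a (f a + 1)).effUp cbar g = N.effUp cbar g from rfl,
          Network.effUp_congr hfg, ← hup b]
        simp [he, upd2]
    · intro k hk z hz
      have h1 : z ≠ σ.var 2 + ((a : ℕ) : ℤ) := by omega
      have h2 : z ≠ σ.var 2 + m + ((a : ℕ) : ℤ) := by omega
      interval_cases k <;> simp [he, h1, h2]
    · simp
  · simp only [block, boundsProg, incr, Prog.wp, BExpr.holds_lt, IExpr.eval, he, hm, Fin.val_natAdd]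
    refine ⟨fun hc => absurd hc (by omega), fun _ => ?_⟩
    refine ⟨_, _, ⟨a, .inr ⟨hlt, rfl, rfl⟩⟩, ?_, ?_, ?_, ?_⟩
    · refine ⟨fun b => ?_, fun b => ?_, fun b => ?_⟩
      · simpa using h.flow b
      · rw [Network.effLo_setLo ha, ← upd1 _ _ _ _ h.lo b]
        simp [hfa]
      · rw [show (N.setLo a (f a)).effUp cbar f = N.effUp cbar f from rfl, ← h.up b]
        simp [upd2]
    · refine ⟨fun b => ?_, fun b => ?_, fun b => ?_⟩
      · simpa using hflow b
      · rw [show (N.setUp a (f a - 1)).effLo cbar g = N.effLo cbar g from rfl,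
          Network.effLo_congr hfg, ← hlo b]
        simp [upd2]
      · rw [Network.effUp_setUp ha, Network.effUp_congr hfg, ← upd1 _ _ _ _ hup b]
        simp [hfa]
    · intro k hk z hz
      have h1 : z ≠ σ.var 2 + ((a : ℕ) : ℤ) := by omega
      have h2 : z ≠ σ.var 2 + m + ((a : ℕ) : ℤ) := by omega
      interval_cases k <;> simp [h1, h2]
    · simp

variable {π : Fin n → Option (Fin n)} {pre : Fin n → ℕ} {post : Fin n → ℕ∞}

/-- Starting from a half-edge that closes a proper cycle, the program pushes the two recursive
calls of the procedure. -/
theorem branchProg_spec (hN : N.IsSimple) (hf : N.IntFlow f) (hm : I.int 0 1 = m) {σ : State}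
    (hF : ForestAt N.hsrc N.htgt (N.hres cbar f) π pre post σ) (hG : GraphAt N.hsrc N.htgt hrev σ)
    (h : CallAt cbar N f (σ.var 2) σ) {e : Fin (m + m)} (he : σ.var 12 = ((e : ℕ) : ℤ))
    (hc : Closes N.hsrc N.htgt (N.hres cbar f) π e)
    (hsel : ∀ a P Q,
      ProperCycle (HRel N.hsrc N.htgt (N.hres cbar f)) π (N.hsrc e) (N.htgt e) a P Q →
      Selectable (HRel N.hsrc N.htgt (N.hres cbar f)) π (P ++ Q.tail)) :
    HaltsIn I branchProg σ (1000 * (n + m + 1)) (fun σ' =>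
      ∃ g N₁ N₂, FindAnotherOptimalFlow N cbar f (some g) ∧ Branches N f g N₁ N₂ ∧
        BranchAt cbar f g N₁ N₂ σ σ') := by
  refine HaltsIn.chain (copyProg_spec hm) (by omega) fun σ₁ ⟨hcopy, k₁⟩ => ?_
  have v12 := k₁.var 2 rfl
  have hlow : CallAt cbar N f (σ₁.var 2) σ₁ := by
    rw [v12]
    exact h.congr fun k hk z _ hz => (hcopy k hk).2 z (by omega)
  have hupp : CallAt cbar N f (σ₁.var 2 + m) σ₁ := by
    rw [v12]
    refine ⟨fun a => ?_, fun a => ?_, fun a => ?_⟩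
    · rw [(hcopy 0 (by omega)).1, h.flow]
    · rw [(hcopy 1 (by omega)).1, h.lo]
    · rw [(hcopy 2 (by omega)).1, h.up]
  refine HaltsIn.chain (augmentProg_spec hN hm (hF.of_keeps k₁ rfl) (hG.of_keeps k₁ rfl)
    ((k₁.var 12 rfl).trans he) hc (overlay_eq_self hlow.flow).symm) (by omega)
    fun σ₂ ⟨⟨c, P, Q, hC, ha0⟩, k₂⟩ => ?_
  have hsel' := hsel _ _ _ hC
  have hforest := hF.forest
  have hnum := hF.num
  rw [N.hRel_hres] at hC hsel' hforest hnum
  have hfind := hsel'.findAnother hforest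
  have hmem := ((hfind.spec hN hf).1 _ rfl).1
  obtain ⟨a, ha, hea⟩ := hC.augment_arc hN hnum
  have hgsum : N.augment cbar f (P ++ Q.tail) =
      f + N.arcUnit (N.hsrc e, N.htgt e) + N.pathFlow P + N.pathFlow Q := hC.augment_eq_sum hN hnum
  rw [← hgsum] at ha0
  generalize N.augment cbar f (P ++ Q.tail) = g at *
  have v22 := k₂.var 2 rfl
  have hg2 : ∀ b : Fin m, σ₂.arr 0 (σ₂.var 2 + ((b : ℕ) : ℤ)) = g b := by
    intro b
    rw [ha0, v22, overlay_at]
  refine HaltsIn.chain (printProg_spec hm hg2) (by omega) fun σ₃ ⟨hout, k₃⟩ => ?_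
  have v32 := k₃.var 2 rfl
  have k12 : ∀ k : ℕ, k ≠ 0 → k < 3 → σ₃.arr k = σ₁.arr k := by
    intro k h0 h3
    interval_cases k
    · exact absurd rfl h0
    · rw [k₃.arr 1 rfl, k₂.arr 1 rfl]
    · rw [k₃.arr 2 rfl, k₂.arr 2 rfl]
  have e0 : σ₃.arr 0 = overlay (σ₁.arr 0) (σ₁.var 2) g := (k₃.arr 0 rfl).trans ha0
  have e2 : σ₃.var 2 = σ₁.var 2 := v32.trans v22
  refine (boundsProg_spec (N := N) (f := f) (g := g) (cbar := cbar) (e := e) (a := a) hm ?_ ha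
    hmem.2 ?_ ?_ ?_ ?_ ?_).keeps.mono (by omega) ?_
  · rw [k₃.var 12 rfl, k₂.var 12 rfl, k₁.var 12 rfl, he]
  · exact hea.imp (fun h => ⟨h.1, by omega⟩) (fun h => ⟨h.1, by omega⟩)
  · intro b
    rw [e0, e2, overlay_at]
  · intro b
    rw [k12 1 (by omega) (by omega), e2, hlow.lo]
  · intro b
    rw [k12 2 (by omega) (by omega), e2, hlow.up]
  · rw [e2]
    refine hupp.congr fun k hk z hz _ => ?_
    by_cases h0 : k = 0
    · subst h0
      rw [e0, overlay_of_le _ _ hz]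
    · rw [k12 k h0 hk]
  · rintro σ₄ ⟨⟨N₁, N₂, hb, h1, h2, h3, h4, h5⟩, k₄⟩
    have e2' : σ₃.var 2 = σ.var 2 := e2.trans v12
    rw [e2'] at h1 h2 h3 h5
    refine ⟨g, N₁, N₂, hfind, hb, h1, h2, fun k hk z hz => ?_, ?_, h5, ?_⟩
    · rw [h3 k hk z hz, ← (hcopy k hk).2 z (by omega)]
      by_cases h0 : k = 0
      · subst h0
        rw [e0, overlay_of_lt _ _ (by omega)]
      · rw [k12 k h0 hk]
    · rw [h4, k₃.var 1 rfl, k₂.var 1 rfl, k₁.var 1 rfl]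
    · rw [k₄.out rfl, hout, k₂.out rfl, k₁.out rfl]

/-- The topmost call, started in the state `σ`, has been removed. -/
structure PopAt (m : ℕ) (σ σ' : State) : Prop where
  rest : ∀ k < 3, σ'.arr k = σ.arr k
  count : σ'.var 1 = σ.var 1 - 1
  top : σ'.var 2 = σ.var 2 - m
  out : σ'.out = σ.out

theorem dfs_iteration_cost : dfsBody.cost + dfsTest.steps + 1 ≤ 200 := by decide

/-- The topmost call is executed up to its recursive calls, in linear time. -/
theorem callProg_spec (hN : N.IsSimple) (hf : N.IntFlow f) (hn : I.int 0 0 = n)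
    (hm : I.int 0 1 = m) {σ : State} (hs : StaticAt N σ) (h : CallAt cbar N f (σ.var 2) σ) :
    HaltsIn I callProg σ (5000 * (n + m + 1)) (fun σ' =>
      ((FindAnotherOptimalFlow N cbar f none ∧ PopAt m σ σ') ∨
      ∃ g N₁ N₂, FindAnotherOptimalFlow N cbar f (some g) ∧ Branches N f g N₁ N₂ ∧
        BranchAt cbar f g N₁ N₂ σ σ') ∧ StaticAt N σ') := by
  suffices HaltsIn I callProg σ (5000 * (n + m + 1)) (fun σ' =>
      (FindAnotherOptimalFlow N cbar f none ∧ PopAt m σ σ') ∨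
      ∃ g N₁ N₂, FindAnotherOptimalFlow N cbar f (some g) ∧ Branches N f g N₁ N₂ ∧
        BranchAt cbar f g N₁ N₂ σ σ') from
    this.keeps.mono le_rfl fun σ' h' => ⟨h'.1, hs.of_keeps h'.2 rfl⟩
  have hM : I.int 0 1 + I.int 0 1 = ((m + m : ℕ) : ℤ) := by rw [hm]; push_cast; rfl
  have hirr : ∀ v, ¬ HRel N.hsrc N.htgt (N.hres cbar f) v v := by
    rw [N.hRel_hres]
    exact hN.resArc_irrefl
  refine HaltsIn.chain (residualProg_spec hm h) (by omega) fun σ₁ ⟨hres, k₁⟩ => ?_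
  have hs₁ := hs.of_keeps k₁ rfl
  refine HaltsIn.chain (resetProg_spec hn) (by omega) fun σ₂ ⟨hreset, k₂⟩ => ?_
  have hs₂ := hs₁.of_keeps k₂ rfl
  obtain ⟨adj, hl, hadj, hlen⟩ := hs₁.lists
  rw [← k₂.arr 6 rfl] at hl
  rw [← k₂.arr 8 rfl] at hres
  have hcost := dfs_iteration_cost
  have hT := Nat.mul_le_mul_left (n + (m + m) + n) hcost
  refine HaltsIn.chain (dfsProg_spec hn (fun e _ => hN.hRel_rev _ e) hs₂.graph hres
    (adj := adj) (fun v => ?_) hadj hlen fun v => (hreset v).2) (by omega)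
    fun σ₃ ⟨⟨π, pre, post, hF⟩, k₃⟩ => ?_
  · rw [(hreset v).1]
    exact hl v
  have hs₃ := hs₂.of_keeps k₃ rfl
  rw [← k₃.arr 8 rfl] at hres
  refine HaltsIn.chain (scansProg_spec hF hs₃.graph hres hirr hM) (by omega)
    fun σ₄ ⟨hout, k₄⟩ => ?_
  have hF₄ := hF.of_keeps k₄ rfl
  have hs₄ := hs₃.of_keeps k₄ rfl
  have harr : ∀ k < 3, σ₄.arr k = σ.arr k := by
    intro k hk
    interval_cases k
    · rw [k₄.arr 0 rfl, k₃.arr 0 rfl, k₂.arr 0 rfl, k₁.arr 0 rfl]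
    · rw [k₄.arr 1 rfl, k₃.arr 1 rfl, k₂.arr 1 rfl, k₁.arr 1 rfl]
    · rw [k₄.arr 2 rfl, k₃.arr 2 rfl, k₂.arr 2 rfl, k₁.arr 2 rfl]
  have e1 : σ₄.var 1 = σ.var 1 := by rw [k₄.var 1 rfl, k₃.var 1 rfl, k₂.var 1 rfl, k₁.var 1 rfl]
  have e2 : σ₄.var 2 = σ.var 2 := by rw [k₄.var 2 rfl, k₃.var 2 rfl, k₂.var 2 rfl, k₁.var 2 rfl]
  have eo : σ₄.out = σ.out := by rw [k₄.out rfl, k₃.out rfl, k₂.out rfl, k₁.out rfl]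
  refine (HaltsIn.cond (T := 1000 * (n + m + 1)) ?_ ?_).mono ?_ fun _ h => h
  · intro ht
    rcases hout with ⟨h12, -⟩ | ⟨e, he, hc, hsel⟩
    · simp [BExpr.holds, IExpr.eval, h12] at ht
    have hcall : CallAt cbar N f (σ₄.var 2) σ₄ := by
      rw [e2]
      exact h.congr fun k hk z _ _ => by rw [harr k hk]
    refine (branchProg_spec hN hf hm hF₄ hs₄.graph hcall he hc hsel).mono le_rfl ?_
    rintro σ' ⟨g, N₁, N₂, h1, h2, h3⟩
    obtain ⟨b1, b2, b3, b4, b5, b6⟩ := h3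
    rw [e2] at b1 b2 b3 b5
    exact .inr ⟨g, N₁, N₂, h1, h2, b1, b2, fun k hk z hz => by rw [b3 k hk z hz, harr k hk],
      by rw [b4, e1], b5, by rw [b6, eo]⟩
  · intro ht
    rcases hout with ⟨-, h1, h2, h3⟩ | ⟨e, he, -⟩
    · refine HaltsIn.of_wp_le ?_ (.inl ⟨?_, fun k hk => ?_, ?_, ?_, ?_⟩)
      · simp only [popProg, block, Prog.cost, IExpr.steps]
        omega
      · have hforest := hF.forest
        rw [N.hRel_hres] at h1 h2 h3 hforest
        exact .null π hforest h1 h2 h3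
      · simpa using harr k hk
      · simp [e1]
      · simp [e2, hm]
      · simpa using eo
    · simp [BExpr.holds, IExpr.eval, he] at ht
  · simp only [BExpr.steps, IExpr.steps, dfsTest, BExpr.lt]
    simp only [dfsTest, BExpr.steps, IExpr.steps, BExpr.lt] at hT
    omega

end Call

/-! ### The enumeration loop -/

/-- Execute the pending calls, until there are none left. -/
def enumProg : Prog := .loop (.ile (.const 1) (.var 1)) callProg

section Enumerate

variable {n m : ℕ} {I : Input} {cbar : Fin m → ℝ}

/-- The memory holds the pending calls `ws`; the first one is the topmost one. -/
def StackAt (cbar : Fin m → ℝ) : List (Network n m × (Fin m → ℤ)) → State → Prop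
  | [], _ => True
  | w :: ws, σ => CallAt cbar w.1 w.2 ((ws.length * m : ℕ) : ℤ) σ ∧ StackAt cbar ws σ

theorem StackAt.congr {ws : List (Network n m × (Fin m → ℤ))} {σ σ' : State}
    (h : StackAt cbar ws σ)
    (h' : ∀ k < 3, ∀ z < ((ws.length * m : ℕ) : ℤ), σ'.arr k z = σ.arr k z) :
    StackAt cbar ws σ' := by
  induction ws with
  | nil => trivial
  | cons w ws ih =>
    have e : (((w :: ws).length * m : ℕ) : ℤ) = ((ws.length * m : ℕ) : ℤ) + m := by
      rw [List.length_cons]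
      push_cast
      ring
    rw [e] at h'
    exact ⟨h.1.congr fun k hk z _ hz => h' k hk z hz,
      ih h.2 fun k hk z hz => h' k hk z (by omega)⟩

/-- The pending calls `ws` have runs that print the flows in the given list. -/
def Runs (cbar : Fin m → ℝ) : List (Network n m × (Fin m → ℤ)) → List (Fin m → ℤ) → Prop
  | [], L => L = []
  | w :: ws, L => ∃ L₁ L₂, FindAllOptimalFlows cbar w.1 w.2 L₁ ∧ Runs cbar ws L₂ ∧ L = L₁ ++ L₂

/-- The number of calls of the procedure that the pending calls give rise to, themselves included: a
call that enumerates `k` flows, including the given one, has a binary recursion tree with `k`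
leaves. -/
noncomputable def pendingCalls (cbar : Fin m → ℝ) (ws : List (Network n m × (Fin m → ℤ))) : ℕ :=
  (ws.map fun w => 2 * (w.1.flowsLike cbar w.2).ncard - 1).sum

theorem printed_concat (L : List (Fin m → ℤ)) (g : Fin m → ℤ) :
    printed (L ++ [g]) = printed L ++ List.ofFn g := by
  simp [printed]

/-- The invariant of the enumeration loop: the pending calls are those of a run of the procedure for
`N` and `f` that has printed the list `L₀`. -/
structure EnumAt (cbar : Fin m → ℝ) (N : Network n m) (f : Fin m → ℤ)
    (ws : List (Network n m × (Fin m → ℤ))) (L₀ : List (Fin m → ℤ)) (σ : State) : Prop where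
  static : StaticAt N σ
  calls : ∀ w ∈ ws, (w.1.tail = N.tail ∧ w.1.head = N.head) ∧ w.1.IntFlow w.2
  stack : StackAt cbar ws σ
  count : σ.var 1 = ws.length
  top : σ.var 2 + m = ((ws.length * m : ℕ) : ℤ)
  out : σ.out = printed (f :: L₀)
  runs : ∀ L, Runs cbar ws L → FindAllOptimalFlows cbar N f (L₀ ++ L)

/-- An iteration executes the topmost call, and the number of calls to come decreases by one. -/
theorem EnumAt.step {N : Network n m} (hN : N.IsSimple) {f : Fin m → ℤ} (hn : I.int 0 0 = n)
    (hm : I.int 0 1 = m) {w : Network n m × (Fin m → ℤ)} {ws : List (Network n m × (Fin m → ℤ))}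
    {L₀ : List (Fin m → ℤ)} {σ : State} (h : EnumAt cbar N f (w :: ws) L₀ σ) :
    HaltsIn I callProg σ (5000 * (n + m + 1)) (fun σ' => ∃ ws' L₀', EnumAt cbar N f ws' L₀' σ' ∧
      pendingCalls cbar ws' + 1 = pendingCalls cbar (w :: ws)) := by
  obtain ⟨⟨ht, hh⟩, hw⟩ := h.calls w (by simp)
  have hN' : w.1.IsSimple :=
    ⟨by rw [ht, hh]; exact hN.simple, by rw [ht, hh]; exact hN.no_antiparallel⟩
  have htop : σ.var 2 = ((ws.length * m : ℕ) : ℤ) := by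
    have := h.top
    rw [List.length_cons, Nat.succ_mul] at this
    push_cast at this ⊢
    omega
  have hcnt := h.count
  rw [List.length_cons] at hcnt
  push_cast at hcnt
  have hcall := h.stack.1
  rw [← htop] at hcall
  refine (callProg_spec hN' hw hn hm (h.static.congr_network ht hh) hcall).mono le_rfl ?_
  rintro σ' ⟨⟨hnone, hpop⟩ | ⟨g, N₁, N₂, hsome, hb, hbr⟩, hst⟩
  · refine ⟨ws, L₀, ⟨hst.congr_network ht.symm hh.symm, fun w hw => h.calls w (by simp [hw]),
      h.stack.2.congr fun k hk z _ => by rw [hpop.rest k hk], ?_, ?_, ?_, fun L hL => ?_⟩, ?_⟩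
    · rw [hpop.count, hcnt]
      ring
    · rw [hpop.top, htop]
      ring
    · rw [hpop.out, h.out]
    · exact h.runs L ⟨[], L, .halt _ _ hnone, hL, rfl⟩
    · have := (hnone.spec hN' hw).2 rfl
      simp only [pendingCalls, List.map_cons, List.sum_cons, this, Set.ncard_singleton]
      omega
  · obtain ⟨⟨t1, h1⟩, t2, h2⟩ := hb.same_graph
    have hg := ((hsome.spec hN' hw).1 g rfl).1
    have hsp := hb.splits hw hg
    refine ⟨(N₁, w.2) :: (N₂, g) :: ws, L₀ ++ [g], ⟨hst.congr_network ht.symm hh.symm, ?_,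
      ⟨?_, ?_, ?_⟩, ?_, ?_, ?_, ?_⟩, ?_⟩
    · simp only [List.mem_cons, forall_eq_or_imp]
      exact ⟨⟨⟨t1.trans ht, h1.trans hh⟩, hsp.left⟩, ⟨⟨t2.trans ht, h2.trans hh⟩, hsp.right⟩,
        fun w hw => h.calls w (by simp [hw])⟩
    · have := hbr.upper
      rw [htop] at this
      convert this using 2
      simp only [List.length_cons]
      push_cast
      ring
    · have := hbr.lower
      rwa [htop] at this
    · refine h.stack.2.congr fun k hk z hz => hbr.rest k hk z ?_
      rwa [htop]
    · rw [hbr.count, hcnt]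
      simp
    · rw [hbr.top, htop]
      simp only [List.length_cons]
      push_cast
      ring
    · rw [hbr.out, h.out, ← List.cons_append, printed_concat]
    · rintro L ⟨L₁, L', r1, ⟨L₂, L₃, r2, r3, rfl⟩, rfl⟩
      have := h.runs _ ⟨_, _, r1.branch hsome hb r2, r3, rfl⟩
      simpa using this
    · have e := hsp.ncard_add
      have p1 := hsp.left.ncard_pos (cbar := cbar)
      have p2 := hsp.right.ncard_pos (cbar := cbar)
      simp only [pendingCalls, List.map_cons, List.sum_cons, ← e]
      omega

/-- The enumeration loop prints the flows of some run of the algorithm; its running time is linear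
per flow. -/
theorem enumProg_spec {N : Network n m} (hN : N.IsSimple) {f : Fin m → ℤ} (hf : N.IntFlow f)
    (hn : I.int 0 0 = n) (hm : I.int 0 1 = m) {σ : State} (hs : StaticAt N σ)
    (h : CallAt cbar N f 0 σ) (h1 : σ.var 1 = 1) (h2 : σ.var 2 = 0) (ho : σ.out = List.ofFn f) :
    HaltsIn I enumProg σ (20000 * ((N.flowsLike cbar f).ncard * (n + m + 1))) (fun σ' =>
      ∃ L, FindAllOptimalFlows cbar N f L ∧ σ'.out = printed (f :: L)) := by
  obtain ⟨c, hc⟩ : ∃ c, c = 5000 * (n + m + 1) := ⟨_, rfl⟩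
  refine (HaltsIn.loop (fun σ b => ∃ ws L₀, EnumAt cbar N f ws L₀ σ ∧
    b = pendingCalls cbar ws * (c + 4)) ?_
    ⟨[(N, f)], [], ⟨hs, ?_, ⟨?_, trivial⟩, ?_, ?_, ?_, ?_⟩, rfl⟩).mono ?_ ?_
  · rintro σ b ⟨ws, L₀, hE, rfl⟩ ht
    cases ws with
    | nil =>
      have := hE.count
      simp [BExpr.holds, IExpr.eval, this] at ht
    | cons w ws =>
      refine ⟨c, (pendingCalls cbar (w :: ws) - 1) * (c + 4), ?_,
        (hE.step hN hn hm).mono hc.ge ?_⟩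
      · have : 1 ≤ pendingCalls cbar (w :: ws) := by
          have := (hE.calls w (by simp)).2.ncard_pos (cbar := cbar)
          simp only [pendingCalls, List.map_cons, List.sum_cons]
          omega
        obtain ⟨p, hp⟩ := Nat.exists_eq_add_of_le' this
        rw [hp, Nat.add_sub_cancel, Nat.succ_mul]
        simp only [BExpr.steps, IExpr.steps]
        omega
      · rintro σ' ⟨ws', L₀', hE', hp⟩
        exact ⟨ws', L₀', hE', by rw [← hp, Nat.add_sub_cancel]⟩
  · simpa using hf
  · simpa using h
  · simpa using h1
  · simp [h2]
  · simp [ho, printed]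
  · rintro L ⟨L₁, L₂, r, rfl, rfl⟩
    simpa using r
  · have hp := hf.ncard_pos (cbar := cbar)
    simp only [pendingCalls, List.map_cons, List.map_nil, List.sum_cons, List.sum_nil, add_zero,
      BExpr.steps, IExpr.steps]
    generalize (N.flowsLike cbar f).ncard = F at *
    have e1 : (2 * F - 1) * (c + 4) ≤ (2 * F) * (5004 * (n + m + 1)) :=
      Nat.mul_le_mul (by omega) (by omega)
    have e2 : 2 * F * (5004 * (n + m + 1)) = 10008 * (F * (n + m + 1)) := by ring
    have e3 : 1 ≤ F * (n + m + 1) := Nat.mul_pos hp (by omega)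
    omega
  · rintro σ' ⟨⟨b, ws, L₀, hE, -⟩, ht⟩
    have hnil : ws = [] := by
      have := hE.count
      simp only [BExpr.holds, IExpr.eval, this, not_le] at ht
      exact List.length_eq_zero_iff.1 (by omega)
    subst hnil
    exact ⟨L₀, by simpa using hE.runs [] rfl, hE.out⟩

end Enumerate

/-! ### Preparing the memory -/

/-- The test that the arc `0` has reduced cost zero. -/
def zeroTest : BExpr := .conj (.rle (.arr 1 (.var 0)) .zero) (.rle .zero (.arr 1 (.var 0)))

/-- Store the bounds of the arcs of the first call. -/
def capacitiesProg : Prog :=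
  forLoop 0 mE (.cond zeroTest
    (block [.store 1 (.var 0) (.inp 3 (.var 0)), .store 2 (.var 0) (.inp 4 (.var 0))])
    (block [.store 1 (.var 0) (.arr 0 (.var 0)), .store 2 (.var 0) (.arr 0 (.var 0))]))

/-- Store the half-edges. -/
def halfEdgesProg : Prog :=
  forLoop 0 mE (block
    [.store 3 (.var 0) (.inp 1 (.var 0)), .store 3 (.add mE (.var 0)) (.inp 2 (.var 0)),
    .store 4 (.var 0) (.inp 2 (.var 0)), .store 4 (.add mE (.var 0)) (.inp 1 (.var 0)),
    .store 5 (.var 0) (.add mE (.var 0)), .store 5 (.add mE (.var 0)) (.var 0)])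

/-- Make the lists of the half-edges that leave the nodes. -/
def listsProg : Prog :=
  .seq (forLoop 0 nE (.store 7 (.var 0) (.const (-1))))
    (forLoop 0 mmE (block [.store 6 (.var 0) (.arr 7 (.arr 3 (.var 0))),
      .store 7 (.arr 3 (.var 0)) (.var 0)]))

/-- The algorithm, for the flow in the integer array `0` and the reduced costs in the real
array `1`. -/
def findAllProg : Prog :=
  .seq capacitiesProg (.seq halfEdgesProg (.seq listsProg
    (.seq (block [.assign 1 (.const 1), .assign 2 (.const 0)]) (.seq printProg enumProg))))

section Setup

variable {n m : ℕ} {I : Input} {cbar : Fin m → ℝ} {N : Network n m} {f : Fin m → ℤ}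

/-- The input contains the network `N`. -/
structure Encodes (I : Input) (N : Network n m) : Prop where
  nodes : I.int 0 0 = n
  arcs : I.int 0 1 = m
  tail : ∀ a : Fin m, I.int 1 ((a : ℕ) : ℤ) = ((N.tail a : ℕ) : ℤ)
  head : ∀ a : Fin m, I.int 2 ((a : ℕ) : ℤ) = ((N.head a : ℕ) : ℤ)
  lo : ∀ a : Fin m, I.int 3 ((a : ℕ) : ℤ) = N.lo a
  up : ∀ a : Fin m, I.int 4 ((a : ℕ) : ℤ) = N.up a
  cost : ∀ a : Fin m, I.real 0 ((a : ℕ) : ℤ) = N.c a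

theorem capacitiesProg_spec (hI : Encodes I N) {σ : State}
    (hf : ∀ a : Fin m, σ.arr 0 ((a : ℕ) : ℤ) = f a)
    (hr : ∀ a : Fin m, σ.rarr 1 ((a : ℕ) : ℤ) = cbar a) :
    HaltsIn I capacitiesProg σ (100 * (m + 1)) (fun σ' =>
      CallAt cbar N f 0 σ' ∧ Keeps capacitiesProg σ σ') := by
  refine (HaltsIn.forLoop m (fun i σ' => ∀ a : Fin m, (a : ℕ) < i →
    σ'.arr 1 ((a : ℕ) : ℤ) = N.effLo cbar f a ∧ σ'.arr 2 ((a : ℕ) : ℤ) = N.effUp cbar f a) 60 rfl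
    ?_ ?_ ?_).mono ?_ ?_
  · exact fun _ => hI.arcs
  · intro a ha; omega
  · intro i hi σ' hk hv hinv
    have h0 := hf ⟨i, hi⟩
    have h1 := hr ⟨i, hi⟩
    have h2 := hI.lo ⟨i, hi⟩
    have h3 := hI.up ⟨i, hi⟩
    simp only at h0 h1 h2 h3
    rw [← hk.arr 0 rfl] at h0
    rw [← hk.rarr 1 rfl] at h1
    have key : ∀ (A B : ℤ → ℤ), A = Function.update (σ'.arr 1) (i : ℤ) (N.effLo cbar f ⟨i, hi⟩) →
        B = Function.update (σ'.arr 2) (i : ℤ) (N.effUp cbar f ⟨i, hi⟩) →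
        ∀ a : Fin m, (a : ℕ) < i + 1 →
          A ((a : ℕ) : ℤ) = N.effLo cbar f a ∧ B ((a : ℕ) : ℤ) = N.effUp cbar f a := by
      rintro A B rfl rfl a ha
      by_cases hai : (a : ℕ) = i
      · have : a = ⟨i, hi⟩ := Fin.ext hai
        subst this
        simp
      · have h3 : ((a : ℕ) : ℤ) ≠ i := by omega
        rw [Function.update_of_ne h3, Function.update_of_ne h3]
        exact hinv a (by omega)
    refine HaltsIn.of_wp_le ?_ ?_
    · simp only [block, zeroTest, Prog.cost, IExpr.steps, RExpr.steps, BExpr.steps]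
      omega
    · simp only [block, zeroTest, Prog.wp, BExpr.holds, RExpr.eval, IExpr.eval, hv, h1,
        ← le_antisymm_iff, State.setArr_arr, State.setArr_var, State.setVar_arr]
      refine ⟨fun c => key _ _ ?_ ?_, fun c => key _ _ ?_ ?_⟩ <;>
        simp [Network.effLo, Network.effUp, c, h0, h2, h3]
  · simp only [IExpr.steps]; omega
  · rintro σ' ⟨h1, hk⟩
    refine ⟨⟨fun a => ?_, fun a => ?_, fun a => ?_⟩, hk⟩
    · rw [zero_add, hk.arr 0 rfl, hf]
    · rw [zero_add, (h1 a a.2).1]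
    · rw [zero_add, (h1 a a.2).2]

/-- Storing the entries of both half-edges of the next arc. -/
theorem update_halfEdges {A : ℤ → ℤ} (F : Fin (m + m) → ℤ) {i : ℕ} (hi : i < m)
    (h : ∀ a : Fin m, (a : ℕ) < i →
      A ((a : ℕ) : ℤ) = F (Fin.castAdd m a) ∧ A (m + ((a : ℕ) : ℤ)) = F (Fin.natAdd m a))
    {x y : ℤ} (hx : x = F (Fin.castAdd m ⟨i, hi⟩)) (hy : y = F (Fin.natAdd m ⟨i, hi⟩))
    (a : Fin m) (ha : (a : ℕ) < i + 1) :
    Function.update (Function.update A (i : ℤ) x) (m + (i : ℤ)) y ((a : ℕ) : ℤ) =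
        F (Fin.castAdd m a) ∧
      Function.update (Function.update A (i : ℤ) x) (m + (i : ℤ)) y (m + ((a : ℕ) : ℤ)) =
        F (Fin.natAdd m a) := by
  subst hx hy
  have ha' := a.2
  have hne : ((a : ℕ) : ℤ) ≠ m + (i : ℤ) := by omega
  have hne' : (m : ℤ) + ((a : ℕ) : ℤ) ≠ i := by omega
  rw [Function.update_of_ne hne]
  by_cases hai : (a : ℕ) = i
  · have : a = ⟨i, hi⟩ := Fin.ext hai
    subst this
    simp
  · have h3 : ((a : ℕ) : ℤ) ≠ i := by omega
    have h4 : (m : ℤ) + ((a : ℕ) : ℤ) ≠ m + (i : ℤ) := by omega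
    rw [Function.update_of_ne h3, Function.update_of_ne h4, Function.update_of_ne hne']
    exact h a (by omega)

theorem halfEdgesProg_spec (hI : Encodes I N) {σ : State} :
    HaltsIn I halfEdgesProg σ (100 * (m + 1)) (fun σ' =>
      GraphAt N.hsrc N.htgt hrev σ' ∧ Keeps halfEdgesProg σ σ') := by
  -- the entries of the arrays `3`, `4` and `5`
  let F : ℕ → Fin (m + m) → ℤ := fun k e =>
    if k = 3 then ((N.hsrc e : ℕ) : ℤ) else if k = 4 then ((N.htgt e : ℕ) : ℤ)
    else ((hrev e : ℕ) : ℤ)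
  refine (HaltsIn.forLoop m (fun i σ' => ∀ k ∈ ([3, 4, 5] : List ℕ), ∀ a : Fin m, (a : ℕ) < i →
    σ'.arr k ((a : ℕ) : ℤ) = F k (Fin.castAdd m a) ∧
    σ'.arr k (m + ((a : ℕ) : ℤ)) = F k (Fin.natAdd m a)) 60 rfl
    ?_ ?_ ?_).mono ?_ ?_
  · exact fun _ => hI.arcs
  · intro k _ a ha; omega
  · intro i hi σ' hk hv hinv
    have h1 := hI.tail ⟨i, hi⟩
    have h2 := hI.head ⟨i, hi⟩
    simp only at h1 h2
    refine HaltsIn.of_wp_le ?_ ?_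
    · simp only [block, Prog.cost, IExpr.steps]
      omega
    · intro k hk3
      have key := fun x y hx hy => update_halfEdges (F k) hi (hinv k hk3) (x := x) (y := y) hx hy
      simp only [List.mem_cons, List.not_mem_nil, or_false] at hk3
      rcases hk3 with rfl | rfl | rfl
      · simpa [hv, hI.arcs] using key _ _
          (by simp only [F, if_true, Network.hsrc, Fin.append_left, h1])
          (by simp only [F, if_true, Network.hsrc, Fin.append_right, h2])
      · simpa [hv, hI.arcs] using key _ _
          (by simp only [F, if_true, show 4 ≠ 3 by decide, if_false, Network.htgt,
            Fin.append_left, h2])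
          (by simp only [F, if_true, show 4 ≠ 3 by decide, if_false, Network.htgt,
            Fin.append_right, h1])
      · simpa [hv, hI.arcs] using key (m + i) i
          (by simp only [F, show 5 ≠ 3 by decide, show 5 ≠ 4 by decide, if_false, hrev,
            Fin.append_left, Fin.val_natAdd, Nat.cast_add])
          (by simp only [F, show 5 ≠ 3 by decide, show 5 ≠ 4 by decide, if_false, hrev,
            Fin.append_right, Fin.val_castAdd])
  · simp only [IExpr.steps]; omega
  · rintro σ' ⟨h1, hk⟩
    have h : ∀ k ∈ ([3, 4, 5] : List ℕ), ∀ e : Fin (m + m), σ'.arr k ((e : ℕ) : ℤ) = F k e := by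
      intro k hk3 e
      induction e using Fin.addCases with
      | left a => exact (h1 k hk3 a a.2).1
      | right a =>
        rw [Fin.val_natAdd, Nat.cast_add]
        exact (h1 k hk3 a a.2).2
    exact ⟨⟨h 3 (by simp), h 4 (by simp), h 5 (by simp)⟩, hk⟩

theorem Linked.congr {M : ℕ} {nx nx' : ℤ → ℤ} {l : List (Fin M)} {p : ℤ} (h : Linked nx p l)
    (h' : ∀ e ∈ l, nx' ((e : ℕ) : ℤ) = nx ((e : ℕ) : ℤ)) : Linked nx' p l := by
  induction l generalizing p with
  | nil => exact h
  | cons e l ih =>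
    obtain ⟨rfl, h2⟩ := h
    refine ⟨rfl, ?_⟩
    rw [h' e (by simp)]
    exact ih h2 fun e he => h' e (by simp [he])

theorem listsProg_spec (hI : Encodes I N) {σ : State} (hg : GraphAt N.hsrc N.htgt hrev σ) :
    HaltsIn I listsProg σ (200 * (n + m + 1)) (fun σ' => StaticAt N σ' ∧ Keeps listsProg σ σ') := by
  refine HaltsIn.keeps ?_
  refine HaltsIn.chain (HaltsIn.forLoop (I := I) (σ₀ := σ) n
    (fun i σ' => ∀ v : Fin n, (v : ℕ) < i → σ'.arr 7 ((v : ℕ) : ℤ) = -1) 10 rfl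
    (fun _ => hI.nodes) (by intro v hv; omega) ?_) ?_ fun σ₁ ⟨h7, k₁⟩ => ?_
  · intro i hi σ' hk hv hinv
    refine HaltsIn.of_wp_le (by simp only [Prog.cost, IExpr.steps]; omega) ?_
    intro v hvi
    by_cases hai : (v : ℕ) = i
    · simp [hv, hai]
    · have h3 : ((v : ℕ) : ℤ) ≠ i := by omega
      simpa [hv, Function.update_of_ne h3] using hinv v (by omega)
  · simp only [IExpr.steps]; omega
  have hg₁ := hg.of_keeps k₁ rfl
  refine (HaltsIn.forLoop (m + m) (fun i σ' => ∃ adj : Fin n → List (Fin (m + m)),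
    (∀ v : Fin n, Linked (σ'.arr 6) (σ'.arr 7 ((v : ℕ) : ℤ)) (adj v)) ∧
    (∀ v e, e ∈ adj v ↔ (e : ℕ) < i ∧ N.hsrc e = v) ∧ ∑ v, (adj v).length = i) 20 rfl
    (fun _ => by simp [IExpr.eval, hI.arcs]) ?_ ?_).mono ?_ ?_
  · exact ⟨fun _ => [], fun v => h7 v v.2, by simp, by simp⟩
  · rintro i hi σ' hk hv ⟨adj, a1, a2, a3⟩
    refine HaltsIn.of_wp_le (by simp only [block, Prog.cost, IExpr.steps]; omega) ?_
    have h3 := (hg₁.of_keeps hk rfl).src ⟨i, hi⟩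
    simp only at h3
    set v := N.hsrc ⟨i, hi⟩ with hvdef
    have hnot : ∀ w : Fin n, (⟨i, hi⟩ : Fin (m + m)) ∉ adj w := fun w hw => by
      have := ((a2 _ _).1 hw).1
      simp at this
    have hlink : ∀ w : Fin n, Linked (Function.update (σ'.arr 6) i (σ'.arr 7 ((v : ℕ) : ℤ)))
        (σ'.arr 7 ((w : ℕ) : ℤ)) (adj w) := by
      intro w
      refine (a1 w).congr fun e he => Function.update_of_ne ?_ _ _
      intro hc
      refine hnot w ?_
      rwa [show (⟨i, hi⟩ : Fin (m + m)) = e from Fin.ext (by simpa using hc.symm)]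
    refine ⟨Function.update adj v (⟨i, hi⟩ :: adj v), fun w => ?_, fun w e => ?_, ?_⟩
    · by_cases hw : w = v
      · subst hw
        simpa [hv, h3, Linked] using hlink v
      · simpa [hv, h3, hw] using hlink w
    · by_cases hw : w = v
      · subst hw
        rw [Function.update_self, List.mem_cons, a2]
        constructor
        · rintro (rfl | ⟨h1, h2⟩)
          · exact ⟨Nat.lt_succ_self i, rfl⟩
          · exact ⟨by omega, h2⟩
        · rintro ⟨h1, h2⟩
          rcases Nat.lt_succ_iff_lt_or_eq.1 h1 with h | h
          · exact .inr ⟨h, h2⟩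
          · exact .inl (Fin.ext h)
      · rw [Function.update_of_ne hw, a2]
        refine ⟨fun h => ⟨by omega, h.2⟩, fun h => ⟨?_, h.2⟩⟩
        rcases Nat.lt_succ_iff_lt_or_eq.1 h.1 with h' | h'
        · exact h'
        · refine absurd ?_ hw
          rw [← h.2, hvdef]
          congr 1
          exact Fin.ext h'
    · rw [sum_length_update _ v ⟨i, hi⟩ (adj v) (by simp)]
      simp [a3]
  · simp only [IExpr.steps]; omega
  · rintro σ₂ ⟨⟨adj, a1, a2, a3⟩, k₂⟩
    exact ⟨hg₁.of_keeps k₂ rfl, adj, a1, fun v e => by rw [a2]; exact and_iff_right e.2, a3⟩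

/-- The program for the algorithm prints the flows of one of its runs; its running time is linear
per flow. The rest of the memory may be arbitrary at the start. -/
theorem findAllProg_spec (hN : N.IsSimple) (hf : N.IntFlow f) (hI : Encodes I N) {σ : State}
    (h0 : ∀ a : Fin m, σ.arr 0 ((a : ℕ) : ℤ) = f a)
    (hr : ∀ a : Fin m, σ.rarr 1 ((a : ℕ) : ℤ) = cbar a) (ho : σ.out = []) :
    HaltsIn I findAllProg σ (30000 * ((N.flowsLike cbar f).ncard * (n + m + 1))) (fun σ' =>
      ∃ L, FindAllOptimalFlows cbar N f L ∧ σ'.out = printed (f :: L)) := by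
  have hF : n + m + 1 ≤ (N.flowsLike cbar f).ncard * (n + m + 1) :=
    Nat.le_mul_of_pos_left _ hf.ncard_pos
  refine HaltsIn.chain (capacitiesProg_spec hI h0 hr) (by omega) fun σ₁ ⟨h1, k₁⟩ => ?_
  refine HaltsIn.chain (halfEdgesProg_spec hI) (by omega) fun σ₂ ⟨h2, k₂⟩ => ?_
  refine HaltsIn.chain (listsProg_spec hI h2) (by omega) fun σ₃ ⟨h3, k₃⟩ => ?_
  have hcall : CallAt cbar N f 0 σ₃ := h1.congr fun k hk z _ _ => by
    interval_cases k
    · rw [k₃.arr 0 rfl, k₂.arr 0 rfl]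
    · rw [k₃.arr 1 rfl, k₂.arr 1 rfl]
    · rw [k₃.arr 2 rfl, k₂.arr 2 rfl]
  refine HaltsIn.chain (T₁ := 10) (HaltsIn.keeps (HaltsIn.of_wp_le
    (Q := fun σ' => σ'.var 1 = 1 ∧ σ'.var 2 = 0) (by simp [block, Prog.cost, IExpr.steps])
    (by simp [block, Prog.wp, IExpr.eval]))) (by omega) fun σ₄ ⟨⟨h41, h42⟩, k₄⟩ => ?_
  have hcall₄ : CallAt cbar N f 0 σ₄ := hcall.congr fun k hk z _ _ => by
    interval_cases k
    · rw [k₄.arr 0 rfl]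
    · rw [k₄.arr 1 rfl]
    · rw [k₄.arr 2 rfl]
  refine HaltsIn.chain (printProg_spec hI.arcs (g := f) ?_) (by omega) fun σ₅ ⟨h5, k₅⟩ => ?_
  · rw [h42]
    exact hcall₄.flow
  have hcall₅ : CallAt cbar N f 0 σ₅ := hcall₄.congr fun k hk z _ _ => by
    interval_cases k
    · rw [k₅.arr 0 rfl]
    · rw [k₅.arr 1 rfl]
    · rw [k₅.arr 2 rfl]
  refine (enumProg_spec hN hf hI.nodes hI.arcs ((h3.of_keeps k₄ rfl).of_keeps k₅ rfl) hcall₅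
    ?_ ?_ ?_).mono (by omega) fun _ h => h
  · rw [k₅.var 1 rfl, h41]
  · rw [k₅.var 2 rfl, h42]
  · rw [h5, k₄.out rfl, k₃.out rfl, k₂.out rfl, k₁.out rfl, ho, List.nil_append]

end Setup

/-! ### The program for a given flow and given reduced costs -/

section Given

variable {n m : ℕ}

theorem toArr_val {α : Type*} [Zero α] {k : ℕ} (v : Fin k → α) (a : Fin k) :
    toArr v ((a : ℕ) : ℤ) = v a := by
  simp [toArr]

theorem Network.encodes_encodeWith (N : Network n m) (f : Fin m → ℤ) (r : Fin m → ℝ) :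
    Encodes (N.encodeWith f r) N :=
  ⟨toArr_val ![(n : ℤ), (m : ℤ)] 0, toArr_val ![(n : ℤ), (m : ℤ)] 1,
    toArr_val fun a => ((N.tail a : ℕ) : ℤ), toArr_val fun a => ((N.head a : ℕ) : ℤ),
    toArr_val N.lo, toArr_val N.up, toArr_val N.c⟩

theorem Network.Admissible.pos {N : Network n m} (h : N.Admissible) : 0 < n := by
  obtain ⟨v⟩ := h.connected.nonempty
  exact v.pos

theorem Network.IsOptInt.intFlow {N : Network n m} {f : Fin m → ℤ} (h : N.IsOptInt f) :
    N.IntFlow f := Network.intFlow_iff.2 h.1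

theorem Network.numOpt_eq {N : Network n m} {f : Fin m → ℤ} {y : Fin n → ℝ} (hf : N.IsOptInt f)
    (hy : N.IsOptPotential y) : N.numOpt = (N.flowsLike (N.reducedCost y) f).ncard := by
  rw [Network.numOpt]
  congr 1
  ext g
  exact Network.isOptInt_iff hy hf g

/-- Copy the flow and the reduced costs from the input. -/
def copyInputProg : Prog :=
  forLoop 0 mE (block [.store 0 (.var 0) (.inp 6 (.var 0)), .rstore 1 (.var 0) (.inp 1 (.var 0))])

theorem copyInputProg_spec (N : Network n m) (f : Fin m → ℤ) (r : Fin m → ℝ) (σ : State) :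
    HaltsIn (N.encodeWith f r) copyInputProg σ (100 * (m + 1)) (fun σ' =>
      (∀ a : Fin m, σ'.arr 0 ((a : ℕ) : ℤ) = f a ∧ σ'.rarr 1 ((a : ℕ) : ℤ) = r a) ∧
        Keeps copyInputProg σ σ') := by
  refine (HaltsIn.forLoop (I := N.encodeWith f r) m (fun i σ' => ∀ a : Fin m, (a : ℕ) < i →
    σ'.arr 0 ((a : ℕ) : ℤ) = f a ∧ σ'.rarr 1 ((a : ℕ) : ℤ) = r a) 60 rfl
    ?_ (by intro a ha; omega) ?_).mono ?_ ?_
  · exact fun _ => (N.encodes_encodeWith f r).arcs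
  · intro i hi σ' hk hv hinv
    refine HaltsIn.of_wp_le (by simp only [block, Prog.cost, IExpr.steps, RExpr.steps]; omega) ?_
    have h1 : (N.encodeWith f r).int 6 (i : ℤ) = f ⟨i, hi⟩ := toArr_val f ⟨i, hi⟩
    have h2 : (N.encodeWith f r).real 1 (i : ℤ) = r ⟨i, hi⟩ := toArr_val r ⟨i, hi⟩
    intro a ha
    by_cases hai : (a : ℕ) = i
    · have : a = ⟨i, hi⟩ := Fin.ext hai
      subst this
      simp [hv, h1, h2, RExpr.eval]
    · have h3 : ((a : ℕ) : ℤ) ≠ i := by omega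
      simpa [hv, h3] using hinv a (by omega)
  · simp only [IExpr.steps]; omega
  · rintro σ' ⟨h, hk⟩
    exact ⟨fun a => h a a.2, hk⟩

/-- The algorithm can be implemented with linear running time per flow. -/
theorem exists_program_of_reducedCosts : ∃ (P : Prog) (K : ℕ),
    ∀ (n m : ℕ) (N : Network n m) (f : Fin m → ℤ) (y : Fin n → ℝ),
      N.Admissible → N.IsOptInt f → N.IsOptPotential y →
      ∃ (σ : State) (t : ℕ) (L : List (Fin m → ℤ)),
        Exec (N.encodeWith f (N.reducedCost y)) P State.init σ t ∧
        FindAllOptimalFlows (N.reducedCost y) N f L ∧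
        σ.out = printed (f :: L) ∧
        t ≤ K * (N.numOpt * (m + n)) := by
  refine ⟨.seq copyInputProg findAllProg, 70000, fun n m N f y hN hf hy => ?_⟩
  have hpos := hN.pos
  have hi := hf.intFlow
  have hF := hi.ncard_pos (cbar := N.reducedCost y)
  have hle : n + m + 1 ≤ 2 * (m + n) := by omega
  rw [Network.numOpt_eq hf hy]
  have : HaltsIn (N.encodeWith f (N.reducedCost y)) (.seq copyInputProg findAllProg) State.init
      (70000 * ((N.flowsLike (N.reducedCost y) f).ncard * (m + n))) (fun σ' =>
      ∃ L, FindAllOptimalFlows (N.reducedCost y) N f L ∧ σ'.out = printed (f :: L)) := by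
    have h1 : m + n ≤ (N.flowsLike (N.reducedCost y) f).ncard * (m + n) :=
      Nat.le_mul_of_pos_left _ hF
    have h2 : (N.flowsLike (N.reducedCost y) f).ncard * (n + m + 1) ≤
        2 * ((N.flowsLike (N.reducedCost y) f).ncard * (m + n)) :=
      (Nat.mul_le_mul_left _ hle).trans (by rw [Nat.mul_left_comm])
    refine HaltsIn.chain (copyInputProg_spec N f _ _) (by omega) fun σ₁ ⟨hc, k₁⟩ => ?_
    exact (findAllProg_spec hN.isSimple hi (N.encodes_encodeWith _ _) (fun a => (hc a).1)
      (fun a => (hc a).2) (k₁.out rfl)).mono (by omega) fun _ h => h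
  obtain ⟨σ, t, h1, h2, L, h3, h4⟩ := this
  exact ⟨σ, t, L, h1, h3, h4, h2⟩

end Given

/-! ### Shortest walks and optimal potentials -/

section Walks

variable {n M : ℕ}

/-- The list `l` of half-edges in `res` is a walk from `u` to `v`. -/
def Walk (src tgt : Fin M → Fin n) (res : Fin M → Prop) : Fin n → List (Fin M) → Fin n → Prop
  | u, [], v => u = v
  | u, e :: l, v => src e = u ∧ res e ∧ Walk src tgt res (tgt e) l v

variable {src tgt : Fin M → Fin n} {res : Fin M → Prop} {u v x : Fin n} {l l' : List (Fin M)}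

theorem walk_append : Walk src tgt res u (l ++ l') x ↔
    ∃ v, Walk src tgt res u l v ∧ Walk src tgt res v l' x := by
  induction l generalizing u with
  | nil => simp [Walk]
  | cons e l ih => simp [Walk, ih, and_assoc]

theorem walk_concat {e : Fin M} : Walk src tgt res u (l ++ [e]) x ↔
    Walk src tgt res u l (src e) ∧ res e ∧ tgt e = x := by
  simp only [walk_append, Walk]
  constructor
  · rintro ⟨v, h, rfl, h'⟩
    exact ⟨h, h'⟩
  · rintro ⟨h, h'⟩
    exact ⟨_, h, rfl, h'⟩

theorem Walk.end_unique (h : Walk src tgt res u l v) (h' : Walk src tgt res u l x) : v = x := by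
  induction l generalizing u with
  | nil => exact Eq.trans (Eq.symm h) h'
  | cons e l ih => exact ih h.2.2 h'.2.2

theorem Walk.mem_res (h : Walk src tgt res u l v) : ∀ e ∈ l, res e := by
  induction l generalizing u with
  | nil => simp
  | cons e l ih => simpa [h.2.1] using ih h.2.2

variable {w : Fin M → ℝ}

/-- If no closed walk has negative cost, then a walk with at least `n` half-edges contains a closed
walk that can be omitted. -/
theorem Walk.exists_shorter (hw : ∀ v l, Walk src tgt res v l v → 0 ≤ (l.map w).sum)
    (h : Walk src tgt res u l v) (hl : n ≤ l.length) :
    ∃ l', Walk src tgt res u l' v ∧ l'.length < l.length ∧ (l'.map w).sum ≤ (l.map w).sum := by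
  have hsplit : ∀ i : Fin (l.length + 1), ∃ x, Walk src tgt res u (l.take i) x := fun i => by
    have h' := h
    rw [← List.take_append_drop (i : ℕ) l] at h'
    obtain ⟨x, hx, -⟩ := walk_append.1 h'
    exact ⟨x, hx⟩
  choose node hnode using hsplit
  -- two of the at least `n + 1` nodes on the walk coincide
  obtain ⟨i, j, hij, hsame⟩ := Fintype.exists_ne_map_eq_of_card_lt node (by simp; omega)
  wlog hlt : i < j generalizing i j
  · exact this j i hij.symm hsame.symm (lt_of_le_of_ne (not_lt.1 hlt) hij.symm)
  have hi : (i : ℕ) < j := hlt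
  have hj : (j : ℕ) ≤ l.length := by omega
  obtain ⟨l₂, hl₂⟩ : ∃ l₂, l.take j = l.take i ++ l₂ :=
    ⟨(l.take j).drop i, by
      conv_lhs =>
        rw [← List.take_append_drop (i : ℕ) (l.take j), List.take_take, min_eq_left hi.le]⟩
  have hdec : l = l.take i ++ l₂ ++ l.drop j := by
    rw [← hl₂, List.take_append_drop]
  have hj' := hnode j
  rw [hl₂] at hj'
  obtain ⟨x, h1, h2⟩ := walk_append.1 hj'
  have hx := h1.end_unique (hnode i)
  subst hx
  rw [← hsame] at h2
  have h3 : Walk src tgt res (node i) (l.drop j) v := by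
    have h' := h
    rw [← List.take_append_drop (j : ℕ) l] at h'
    obtain ⟨x, hx, h3⟩ := walk_append.1 h'
    rwa [hx.end_unique (hnode j), ← hsame] at h3
  refine ⟨l.take i ++ l.drop j, walk_append.2 ⟨_, h1, h3⟩, ?_, ?_⟩
  · simp
    omega
  · have := hw _ _ h2
    conv_rhs => rw [hdec]
    simp only [List.map_append, List.sum_append]
    linarith

theorem Walk.exists_short (hw : ∀ v l, Walk src tgt res v l v → 0 ≤ (l.map w).sum)
    (h : Walk src tgt res u l v) :
    ∃ l', Walk src tgt res u l' v ∧ l'.length ≤ n ∧ (l'.map w).sum ≤ (l.map w).sum := by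
  induction hk : l.length using Nat.strong_induction_on generalizing l with
  | _ k ih =>
    subst hk
    by_cases hl : l.length ≤ n
    · exact ⟨l, h, hl, le_rfl⟩
    · obtain ⟨l', h1, h2, h3⟩ := h.exists_shorter hw (by omega)
      obtain ⟨l'', h4, h5, h6⟩ := ih _ h2 h1 rfl
      exact ⟨l'', h4, h5, h6.trans h3⟩

/-- The invariant of the Bellman-Ford algorithm: the label of a node is the cost of a walk that ends
there, it is a lower bound for the walks with at most `k` half-edges, and also for those with one
more half-edge, if the last one belongs to `S`. -/
structure Labels (src tgt : Fin M → Fin n) (res : Fin M → Prop) (w : Fin M → ℝ) (k : ℕ)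
    (S : Set (Fin M)) (Y : Fin n → ℝ) : Prop where
  attained : ∀ v, ∃ u l, Walk src tgt res u l v ∧ Y v = (l.map w).sum
  le : ∀ u l v, Walk src tgt res u l v → l.length ≤ k → Y v ≤ (l.map w).sum
  le_last : ∀ e ∈ S, res e → ∀ u l, Walk src tgt res u l (src e) → l.length ≤ k →
    Y (tgt e) ≤ (l.map w).sum + w e

theorem Labels.init : Labels src tgt res w 0 ∅ 0 := by
  refine ⟨fun v => ⟨v, [], rfl, by simp⟩, fun u l v _ hl => ?_, by simp⟩
  rw [List.length_eq_zero_iff.1 (Nat.le_zero.1 hl)]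
  simp

variable {k : ℕ} {S : Set (Fin M)} {Y : Fin n → ℝ}

theorem Labels.mono {S' : Set (Fin M)} (h : Labels src tgt res w k S Y) (hS : S' ⊆ S) :
    Labels src tgt res w k S' Y := ⟨h.attained, h.le, fun e he => h.le_last e (hS he)⟩

theorem Labels.insert_of_not (h : Labels src tgt res w k S Y) {e : Fin M} (he : ¬ res e) :
    Labels src tgt res w k (insert e S) Y := by
  refine ⟨h.attained, h.le, fun e' he' => ?_⟩
  rcases he' with rfl | he'
  · exact fun hc => absurd hc he
  · exact h.le_last e' he'

theorem Labels.insert_of_le (h : Labels src tgt res w k S Y) {e : Fin M}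
    (he : Y (tgt e) ≤ Y (src e) + w e) : Labels src tgt res w k (insert e S) Y := by
  refine ⟨h.attained, h.le, fun e' he' => ?_⟩
  rcases he' with rfl | he'
  · intro _ u l hl hk
    have := h.le u l _ hl hk
    linarith
  · exact h.le_last e' he'

/-- Lowering the label of the target of `e`. -/
theorem Labels.relax (h : Labels src tgt res w k S Y) {e : Fin M} (he : res e)
    (hlt : Y (src e) + w e ≤ Y (tgt e)) :
    Labels src tgt res w k (insert e S) (Function.update Y (tgt e) (Y (src e) + w e)) := by
  have hle : ∀ v, Function.update Y (tgt e) (Y (src e) + w e) v ≤ Y v := by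
    intro v
    by_cases hv : v = tgt e
    · subst hv; simpa using hlt
    · simp [hv]
  refine ⟨fun v => ?_, fun u l v hl hk => (hle v).trans (h.le u l v hl hk),
    fun e' he' hr u l hl hk => ?_⟩
  · by_cases hv : v = tgt e
    · subst hv
      obtain ⟨u, l, h1, h2⟩ := h.attained (src e)
      exact ⟨u, l ++ [e], walk_concat.2 ⟨h1, he, rfl⟩, by simp [h2]⟩
    · rw [Function.update_of_ne hv]
      exact h.attained v
  · rcases he' with rfl | he'
    · have := h.le u l _ hl hk
      simpa using this
    · exact (hle _).trans (h.le_last e' he' hr u l hl hk)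

/-- The end of a round of the Bellman-Ford algorithm. -/
theorem Labels.next (h : Labels src tgt res w k Set.univ Y) : Labels src tgt res w (k + 1) ∅ Y := by
  refine ⟨h.attained, fun u l v hl hk => ?_, by simp⟩
  rcases List.eq_nil_or_concat l with rfl | ⟨l', e, rfl⟩
  · exact h.le u _ v hl (by simp)
  · rw [List.concat_eq_append] at *
    obtain ⟨h1, he, rfl⟩ := walk_concat.1 hl
    simpa using h.le_last e trivial he u l' h1 (by simpa using hk)

/-- After `n` rounds the labels are the costs of shortest walks. -/
theorem Labels.le_of_res (hw : ∀ v l, Walk src tgt res v l v → 0 ≤ (l.map w).sum)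
    (h : Labels src tgt res w n S Y) {e : Fin M} (he : res e) : Y (tgt e) ≤ Y (src e) + w e := by
  obtain ⟨u, l, h1, h2⟩ := h.attained (src e)
  obtain ⟨l', h3, h4, h5⟩ := (walk_concat.2 ⟨h1, he, rfl⟩).exists_short hw
  refine (h.le _ _ _ h3 h4).trans (h5.trans (le_of_eq ?_))
  simp [h2]

end Walks

section Potential

variable {n m : ℕ} {N : Network n m} {f : Fin m → ℤ}

/-- The residual half-edges with respect to `f` of the whole network. -/
def Network.hfree (N : Network n m) (f : Fin m → ℤ) : Fin (m + m) → Prop :=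
  Fin.append (fun a => f a < N.up a) (fun a => N.lo a < f a)

/-- The costs of the half-edges. -/
def Network.hcost (N : Network n m) : Fin (m + m) → ℝ := Fin.append N.c (-N.c)

/-- The unit flow along a half-edge. -/
def halfUnit : Fin (m + m) → Fin m → ℤ :=
  Fin.append (fun a => Pi.single a 1) (fun a => Pi.single a (-1))

/-- The flow of one unit along a walk. -/
def walkFlow (l : List (Fin (m + m))) : Fin m → ℤ := (l.map halfUnit).sum

theorem walkFlow_cons (e : Fin (m + m)) (l : List (Fin (m + m))) :
    walkFlow (e :: l) = halfUnit e + walkFlow l := by simp [walkFlow]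

theorem Walk.div_walkFlow {res : Fin (m + m) → Prop} {u v : Fin n} {l : List (Fin (m + m))}
    (h : Walk N.hsrc N.htgt res u l v) (i : Fin n) :
    N.div (walkFlow l) i = (if u = i then 1 else 0) - (if v = i then 1 else 0) := by
  induction l generalizing u with
  | nil =>
    have h' : u = v := h
    simp [walkFlow, Network.div, h']
  | cons e l ih =>
    obtain ⟨rfl, -, h⟩ := h
    rw [walkFlow_cons, N.div_add, ih h]
    induction e using Fin.addCases with
    | left a =>
      simp only [halfUnit, Network.hsrc, Network.htgt, Fin.append_left, N.div_single]
      ring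
    | right a =>
      simp only [halfUnit, Network.hsrc, Network.htgt, Fin.append_right, N.div_single]
      split_ifs <;> ring

theorem sum_cost_walkFlow (N : Network n m) (l : List (Fin (m + m))) :
    ∑ a, N.c a * (walkFlow l a : ℝ) = (l.map N.hcost).sum := by
  induction l with
  | nil => simp [walkFlow]
  | cons e l ih =>
    simp only [walkFlow_cons, Pi.add_apply, Int.cast_add, mul_add, Finset.sum_add_distrib, ih,
      List.map_cons, List.sum_cons]
    congr 1
    have key : ∀ (a : Fin m) (z : ℤ),
        ∑ b, N.c b * ((Pi.single a z : Fin m → ℤ) b : ℝ) = N.c a * z := by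
      intro a z
      rw [Finset.sum_eq_single a]
      · simp
      · intro b _ hb
        simp [hb]
      · simp
    induction e using Fin.addCases with
    | left a => simp only [halfUnit, Network.hcost, Fin.append_left, key]; simp
    | right a => simp only [halfUnit, Network.hcost, Fin.append_right, key]; simp

/-- A flow along residual half-edges does not increase the flow on saturated arcs, and it does not
decrease the flow on arcs at their lower capacity. -/
theorem walkFlow_bounds {l : List (Fin (m + m))} (hl : ∀ e ∈ l, N.hfree f e) (a : Fin m) :
    walkFlow l a ≤ l.length ∧ -(l.length : ℤ) ≤ walkFlow l a ∧ (¬ f a < N.up a → walkFlow l a ≤ 0) ∧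
      (¬ N.lo a < f a → 0 ≤ walkFlow l a) := by
  induction l with
  | nil => simp [walkFlow]
  | cons e l ih =>
    obtain ⟨h1, h2, h3, h4⟩ := ih fun e' he' => hl e' (by simp [he'])
    have he := hl e (by simp)
    rw [walkFlow_cons, Pi.add_apply, List.length_cons]
    have key : halfUnit e a = 0 ∨ (halfUnit e a = 1 ∧ f a < N.up a) ∨
        (halfUnit e a = -1 ∧ N.lo a < f a) := by
      induction e using Fin.addCases with
      | left b =>
        simp only [halfUnit, Network.hfree, Fin.append_left] at he ⊢
        by_cases hb : a = b
        · subst hb; simp [he]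
        · simp [hb]
      | right b =>
        simp only [halfUnit, Network.hfree, Fin.append_right] at he ⊢
        by_cases hb : a = b
        · subst hb; simp [he]
        · simp [hb]
    push_cast
    rcases key with h | ⟨h, h'⟩ | ⟨h, h'⟩ <;> rw [h] <;>
      refine ⟨by omega, by omega, fun hc => ?_, fun hc => ?_⟩ <;>
      first | exact absurd h' hc | (have := h3 hc; omega) | (have := h4 hc; omega)

/-- The residual graph of an optimal integer flow contains no closed walk of negative cost: a small
amount of flow could be sent along it. -/
theorem Network.IsOptInt.closed_walk_nonneg (hf : N.IsOptInt f) {v : Fin n} {l : List (Fin (m + m))}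
    (h : Walk N.hsrc N.htgt (N.hfree f) v l v) : 0 ≤ (l.map N.hcost).sum := by
  have hbd := walkFlow_bounds h.mem_res
  -- small enough for an arc that the walk passes up to `l.length` times
  set ε : ℝ := 1 / (l.length + 1) with hε
  have hpos : 0 < ε := by positivity
  have hle : ε * l.length ≤ 1 := by
    rw [hε, one_div, inv_mul_le_one₀ (by positivity)]
    linarith
  have hx : N.IsFlow (fun a => (f a : ℝ) + ε * walkFlow l a) := by
    refine ⟨fun a => ?_, fun a => ?_, fun i => ?_⟩
    · obtain ⟨-, h2, -, h4⟩ := hbd a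
      have h5 := hf.1.lo_le a
      by_cases hlo : N.lo a < f a
      · have h6 : (N.lo a : ℝ) + 1 ≤ f a := by exact_mod_cast hlo
        have h7 : -(l.length : ℝ) ≤ walkFlow l a := by exact_mod_cast h2
        nlinarith
      · have h6 : (0 : ℝ) ≤ walkFlow l a := by exact_mod_cast h4 hlo
        have := mul_nonneg hpos.le h6
        linarith
    · obtain ⟨h1, -, h3, -⟩ := hbd a
      have h5 := hf.1.le_up a
      by_cases hup : f a < N.up a
      · have h6 : (f a : ℝ) + 1 ≤ N.up a := by exact_mod_cast hup
        have h7 : (walkFlow l a : ℝ) ≤ l.length := by exact_mod_cast h1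
        nlinarith
      · have h6 : (walkFlow l a : ℝ) ≤ 0 := by exact_mod_cast h3 hup
        have := mul_nonpos_of_nonneg_of_nonpos hpos.le h6
        linarith
    · have h1 := hf.1.balance i
      have h2 : ((N.div (walkFlow l) i : ℤ) : ℝ) = 0 := by
        rw [h.div_walkFlow]
        simp
      simp only [Network.div, Int.cast_sub, Int.cast_sum] at h2
      simp only [Finset.sum_add_distrib, ← Finset.mul_sum]
      linear_combination h1 + ε * h2
  have hopt := hf.2 _ hx
  simp only [Network.cost, mul_add, Finset.sum_add_distrib] at hopt
  have h1 : ∑ a, N.c a * (ε * (walkFlow l a : ℝ)) = ε * (l.map N.hcost).sum := by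
    rw [← sum_cost_walkFlow, Finset.mul_sum]
    exact Finset.sum_congr rfl fun a _ => by ring
  rw [h1] at hopt
  exact nonneg_of_mul_nonneg_right (by linarith) hpos

/-- A potential for which no residual half-edge has negative reduced cost is optimal. -/
theorem Network.IsOptInt.isOptPotential (hf : N.IsOptInt f) {Y : Fin n → ℝ}
    (h : ∀ e, N.hfree f e → Y (N.htgt e) ≤ Y (N.hsrc e) + N.hcost e) : N.IsOptPotential Y := by
  refine ⟨_, hf, fun a => ⟨fun hc => ?_, fun hc => ?_⟩⟩
  · have h1 := h (Fin.natAdd m a)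
    simp only [Network.hfree, Network.htgt, Network.hsrc, Network.hcost, Fin.append_right,
      Pi.neg_apply] at h1
    have h2 := hf.intFlow.lo_le a
    rcases h2.lt_or_eq with h3 | h3
    · have := h1 h3
      rw [Network.reducedCost] at hc
      linarith
    · rw [h3]
  · have h1 := h (Fin.castAdd m a)
    simp only [Network.hfree, Network.htgt, Network.hsrc, Network.hcost, Fin.append_left] at h1
    have h2 := hf.intFlow.le_up a
    rcases h2.lt_or_eq with h3 | h3
    · have := h1 h3
      rw [Network.reducedCost] at hc
      linarith
    · rw [h3]

end Potential

/-! ### Computing an optimal potential -/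

/-- If the test `t` holds and the label of the node `d` exceeds `z`, replace it by `z`. -/
def relaxProg (t : BExpr) (d : IExpr) (z : RExpr) : Prog :=
  .cond (.conj t (.neg (.rle (.arr 0 d) z))) (.rstore 0 d z) .skip

/-- The tail of the arc `0`. -/
abbrev tailE : IExpr := .inp 1 (.var 0)

/-- The head of the arc `0`. -/
abbrev headE : IExpr := .inp 2 (.var 0)

/-- Update the labels along the arc `0`, in both directions. -/
def relaxArcProg : Prog :=
  .seq (relaxProg (.lt (.arr 0 (.var 0)) (.inp 4 (.var 0))) headE
      (.add (.arr 0 tailE) (.inp 0 (.var 0))))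
    (relaxProg (.lt (.inp 3 (.var 0)) (.arr 0 (.var 0))) tailE
      (.sub (.arr 0 headE) (.inp 0 (.var 0))))

/-- The Bellman-Ford algorithm for the residual graph of the flow in the integer array `0`, with the
labels in the real array `0`. -/
def labelsProg : Prog :=
  .seq (forLoop 0 nE (.rstore 0 (.var 0) .zero)) (forLoop 16 nE (forLoop 0 mE relaxArcProg))

/-- Store the reduced costs for the potential in the real array `0`. -/
def reducedCostProg : Prog :=
  forLoop 0 mE (.rstore 1 (.var 0) (.sub (.add (.inp 0 (.var 0)) (.arr 0 tailE)) (.arr 0 headE)))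

section Potential

variable {n m : ℕ} {I : Input} {N : Network n m} {f : Fin m → ℤ}

theorem relaxProg_wp {src tgt : Fin (m + m) → Fin n} {res : Fin (m + m) → Prop}
    {w : Fin (m + m) → ℝ} {k : ℕ} {S : Set (Fin (m + m))} {Y : Fin n → ℝ}
    (h : Labels src tgt res w k S Y) {e : Fin (m + m)} {t : BExpr} {d : IExpr} {z : RExpr}
    {σ : State}
    (hY : ∀ v : Fin n, σ.rarr 0 ((v : ℕ) : ℤ) = Y v) (ht : t.holds I σ ↔ res e)
    (hd : d.eval I σ = ((tgt e : ℕ) : ℤ)) (hz : z.eval I σ = Y (src e) + w e) {Q : State → Prop}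
    (hQ : ∀ σ' Y', (∀ v : Fin n, σ'.rarr 0 ((v : ℕ) : ℤ) = Y' v) → σ'.var = σ.var →
      σ'.arr = σ.arr → Labels src tgt res w k (insert e S) Y' → Q σ') :
    (relaxProg t d z).wp I Q σ := by
  simp only [relaxProg, Prog.wp, BExpr.holds, RExpr.eval, hd, hz, hY, ht, not_le]
  refine ⟨fun ⟨h1, h2⟩ => hQ _ _ (fun v => ?_) rfl rfl (h.relax h1 h2.le),
    fun hc => hQ _ Y hY rfl rfl ?_⟩
  · by_cases hv : v = tgt e
    · subst hv; simp
    · have : ((v : ℕ) : ℤ) ≠ ((tgt e : ℕ) : ℤ) := fun hc => hv (Fin.ext (by exact_mod_cast hc))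
      simp [hv, this, hY]
  · by_cases he : res e
    · exact h.insert_of_le (not_lt.1 fun hlt => hc ⟨he, hlt⟩)
    · exact h.insert_of_not he

/-- The half-edges of the arcs below `i`. -/
def halfEdgesBelow (m i : ℕ) : Set (Fin (m + m)) :=
  {e | ((Fin.append id id : Fin (m + m) → Fin m) e : ℕ) < i}

theorem halfEdgesBelow_succ {i : ℕ} (hi : i < m) : halfEdgesBelow m (i + 1) ⊆
    insert (Fin.natAdd m ⟨i, hi⟩) (insert (Fin.castAdd m ⟨i, hi⟩) (halfEdgesBelow m i)) := by
  intro e he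
  induction e using Fin.addCases with
  | left a =>
    simp only [halfEdgesBelow, Set.mem_ofPred_eq, Fin.append_left, id_eq] at he
    rcases Nat.lt_succ_iff_lt_or_eq.1 he with h | h
    · refine .inr (.inr ?_)
      simpa only [halfEdgesBelow, Set.mem_ofPred_eq, Fin.append_left, id_eq] using h
    · exact .inr (.inl (congrArg _ (Fin.ext h)))
  | right a =>
    simp only [halfEdgesBelow, Set.mem_ofPred_eq, Fin.append_right, id_eq] at he
    rcases Nat.lt_succ_iff_lt_or_eq.1 he with h | h
    · refine .inr (.inr ?_)
      simpa only [halfEdgesBelow, Set.mem_ofPred_eq, Fin.append_right, id_eq] using h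
    · exact .inl (congrArg _ (Fin.ext h))

/-- The real array `0` holds the labels of the Bellman-Ford algorithm. -/
def LabelsAt (N : Network n m) (f : Fin m → ℤ) (k : ℕ) (S : Set (Fin (m + m))) (σ : State) : Prop :=
  ∃ Y : Fin n → ℝ, (∀ v : Fin n, σ.rarr 0 ((v : ℕ) : ℤ) = Y v) ∧
    Labels N.hsrc N.htgt (N.hfree f) N.hcost k S Y

theorem relaxArcProg_spec (hI : Encodes I N) {σ : State}
    (hf : ∀ a : Fin m, σ.arr 0 ((a : ℕ) : ℤ) = f a) {a : Fin m} (ha : σ.var 0 = ((a : ℕ) : ℤ))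
    {k : ℕ} {S : Set (Fin (m + m))} (h : LabelsAt N f k S σ) :
    HaltsIn I relaxArcProg σ 60 (LabelsAt N f k
      (insert (Fin.natAdd m a) (insert (Fin.castAdd m a) S))) := by
  obtain ⟨Y, hY, hL⟩ := h
  refine HaltsIn.of_wp_le ?_ ?_
  · simp only [relaxArcProg, relaxProg, Prog.cost, IExpr.steps, RExpr.steps, BExpr.steps, BExpr.lt]
    omega
  refine relaxProg_wp hL (e := Fin.castAdd m a) hY ?_ ?_ ?_ fun σ₁ Y₁ hY₁ hv₁ ha₁ hL₁ => ?_
  · simp only [BExpr.holds_lt, IExpr.eval, ha, hf, hI.up, Network.hfree, Fin.append_left]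
  · simp only [IExpr.eval, ha, hI.head, Network.htgt, Fin.append_left]
  · simp only [RExpr.eval, IExpr.eval, ha, hI.tail, hI.cost, hY, Network.hsrc, Network.hcost,
      Fin.append_left]
  refine relaxProg_wp hL₁ (e := Fin.natAdd m a) hY₁ ?_ ?_ ?_ fun σ₂ Y₂ hY₂ _ _ hL₂ => ⟨Y₂, hY₂, hL₂⟩
  · simp only [BExpr.holds_lt, IExpr.eval, hv₁, ha₁, ha, hf, hI.lo, Network.hfree, Fin.append_right]
  · simp only [IExpr.eval, hv₁, ha, hI.tail, Network.htgt, Fin.append_right]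
  · simp only [RExpr.eval, IExpr.eval, hv₁, ha, hI.head, hI.cost, hY₁, Network.hsrc, Network.hcost,
      Fin.append_right, Pi.neg_apply, sub_eq_add_neg]

theorem labelsProg_spec (hI : Encodes I N) {σ : State}
    (hf : ∀ a : Fin m, σ.arr 0 ((a : ℕ) : ℤ) = f a) :
    HaltsIn I labelsProg σ (200 * ((n + 1) * (m + 1))) (fun σ' =>
      LabelsAt N f n ∅ σ' ∧ Keeps labelsProg σ σ') := by
  refine HaltsIn.keeps ?_
  have hnm : n + 1 ≤ (n + 1) * (m + 1) := Nat.le_mul_of_pos_right _ (Nat.succ_pos m)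
  refine HaltsIn.chain (HaltsIn.forLoop (I := I) (σ₀ := σ) n
    (fun i σ' => ∀ v : Fin n, (v : ℕ) < i → σ'.rarr 0 ((v : ℕ) : ℤ) = 0) 10 rfl
    (fun _ => hI.nodes) (by intro v hv; omega) ?_) ?_ fun σ₁ ⟨h1, k₁⟩ => ?_
  · intro i hi σ' hk hv hinv
    refine HaltsIn.of_wp_le (by simp only [Prog.cost, IExpr.steps, RExpr.steps]; omega) ?_
    intro v hvi
    by_cases hai : (v : ℕ) = i
    · simp [hv, hai, RExpr.eval]
    · have h3 : ((v : ℕ) : ℤ) ≠ i := by omega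
      simpa [hv, h3] using hinv v (by omega)
  · simp only [IExpr.steps]; omega
  refine (HaltsIn.forLoop n (fun i σ' => LabelsAt N f i ∅ σ') (80 * (m + 1)) rfl
    ?_ ⟨0, fun v => h1 v v.2, .init⟩ ?_).mono ?_ fun σ' h => h.1
  · exact fun _ => hI.nodes
  · intro i hi σ₂ k₂ _ hinv
    refine (HaltsIn.forLoop m (fun j σ' => LabelsAt N f i (halfEdgesBelow m j) σ') 60 rfl
      ?_ ?_ ?_).mono ?_ ?_
    · exact fun _ => hI.arcs
    · obtain ⟨Y, hY, hL⟩ := hinv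
      exact ⟨Y, hY, hL.mono fun e he => absurd he (Nat.not_lt_zero _)⟩
    · intro j hj σ₃ k₃ hv₃ hinv₃
      refine (relaxArcProg_spec hI (a := ⟨j, hj⟩) (fun a => ?_) hv₃ hinv₃).mono le_rfl ?_
      · rw [k₃.arr 0 rfl, k₂.arr 0 rfl, k₁.arr 0 rfl, hf]
      · rintro σ₄ ⟨Y, hY, hL⟩
        exact ⟨Y, hY, hL.mono (halfEdgesBelow_succ hj)⟩
    · simp only [IExpr.steps]; omega
    · rintro σ₄ ⟨⟨Y, hY, hL⟩, -⟩
      refine ⟨Y, hY, Labels.next (hL.mono fun e _ => ?_)⟩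
      exact (Fin.append id id e : Fin m).2
  · simp only [IExpr.steps]
    have e1 : (n + 1) * (80 * (m + 1) + (1 + 1) + 10) ≤ (n + 1) * (100 * (m + 1)) :=
      Nat.mul_le_mul_left _ (by omega)
    have e2 : (n + 1) * (100 * (m + 1)) = 100 * ((n + 1) * (m + 1)) := by ring
    omega

theorem reducedCostProg_spec (hI : Encodes I N) {σ : State} {Y : Fin n → ℝ}
    (hY : ∀ v : Fin n, σ.rarr 0 ((v : ℕ) : ℤ) = Y v) :
    HaltsIn I reducedCostProg σ (100 * (m + 1)) (fun σ' =>
      (∀ a : Fin m, σ'.rarr 1 ((a : ℕ) : ℤ) = N.reducedCost Y a) ∧ Keeps reducedCostProg σ σ') := by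
  refine (HaltsIn.forLoop m (fun i σ' => ∀ a : Fin m, (a : ℕ) < i →
    σ'.rarr 1 ((a : ℕ) : ℤ) = N.reducedCost Y a) 60 rfl ?_ (by intro a ha; omega) ?_).mono ?_ ?_
  · exact fun _ => hI.arcs
  · intro i hi σ' hk hv hinv
    refine HaltsIn.of_wp_le (by simp only [Prog.cost, IExpr.steps, RExpr.steps]; omega) ?_
    have h1 := hI.tail ⟨i, hi⟩
    have h2 := hI.head ⟨i, hi⟩
    have h3 := hI.cost ⟨i, hi⟩
    simp only at h1 h2 h3
    intro a ha
    by_cases hai : (a : ℕ) = i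
    · have : a = ⟨i, hi⟩ := Fin.ext hai
      subst this
      simp [hv, h1, h2, h3, RExpr.eval, hk.rarr 0 rfl, hY, Network.reducedCost]
    · have h4 : ((a : ℕ) : ℤ) ≠ i := by omega
      simpa [hv, h4] using hinv a (by omega)
  · simp only [IExpr.steps]; omega
  · rintro σ' ⟨h, hk⟩
    exact ⟨fun a => h a a.2, hk⟩

/-- Given an optimal integer flow, an optimal potential can be computed in `O(mn)` time, and all
optimal integer flows can be enumerated with linear running time per flow. -/
theorem exists_program_of_flow : ∃ (R : Prog) (K : ℕ),
    ∀ (S : Prog) (n m : ℕ) (N : Network n m) (f : Fin m → ℤ) (τ : State) (M : ℕ),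
      N.Admissible → N.IsOptInt f →
      Exec N.encode S State.init τ M →
      (∀ a : Fin m, τ.arr 0 ((a : ℕ) : ℤ) = f a) → τ.out = [] →
      ∃ (σ : State) (t : ℕ) (y : Fin n → ℝ) (L : List (Fin m → ℤ)),
        Exec N.encode (Prog.seq S R) State.init σ t ∧
        N.IsOptPotential y ∧
        FindAllOptimalFlows (N.reducedCost y) N f L ∧
        σ.out = printed (f :: L) ∧
        t ≤ K * (N.numOpt * (m + n) + m * n + M) := by
  refine ⟨.seq labelsProg (.seq reducedCostProg findAllProg), 70000,
    fun S n m N f τ M hN hf hS hτ ho => ?_⟩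
  have hI : Encodes N.encode N := N.encodes_encodeWith 0 0
  have hi := hf.intFlow
  have hpos := hN.pos
  have : HaltsIn N.encode (.seq labelsProg (.seq reducedCostProg findAllProg)) τ
      (70000 * (N.numOpt * (m + n) + m * n)) (fun σ' => ∃ y L, N.IsOptPotential y ∧
        FindAllOptimalFlows (N.reducedCost y) N f L ∧ σ'.out = printed (f :: L)) := by
    have e1 : (n + 1) * (m + 1) = m * n + n + m + 1 := by ring
    have hF₀ : m + n ≤ N.numOpt * (m + n) := by
      refine Nat.le_mul_of_pos_left _ ((Set.ncard_pos ?_).2 ⟨f, hf⟩)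
      exact (Set.finite_Icc N.lo N.up).subset fun g hg =>
        ⟨hg.intFlow.lo_le, hg.intFlow.le_up⟩
    refine HaltsIn.chain (labelsProg_spec hI hτ) (by rw [e1]; omega)
      fun σ₁ ⟨⟨Y, hY, hL⟩, k₁⟩ => ?_
    have hy : N.IsOptPotential Y := hf.isOptPotential fun e he =>
      hL.le_of_res (fun v l hl => hf.closed_walk_nonneg hl) he
    have hF₂ : (N.flowsLike (N.reducedCost Y) f).ncard * (n + m + 1) ≤
        2 * (N.numOpt * (m + n)) := by
      rw [Network.numOpt_eq hf hy, Nat.mul_left_comm]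
      exact Nat.mul_le_mul_left _ (by omega)
    refine HaltsIn.chain (reducedCostProg_spec hI hY) (by rw [e1]; omega) fun σ₂ ⟨hr, k₂⟩ => ?_
    refine (findAllProg_spec hN.isSimple hi hI (σ := σ₂) (fun a => ?_) hr ?_).mono ?_ ?_
    · rw [k₂.arr 0 rfl, k₁.arr 0 rfl, hτ]
    · rw [k₂.out rfl, k₁.out rfl, ho]
    · rw [e1]
      omega
    · rintro σ' ⟨L, h1, h2⟩
      exact ⟨Y, L, hy, h1, h2⟩
  obtain ⟨σ, t, h1, h2, y, L, h3, h4, h5⟩ := this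
  exact ⟨σ, M + t, y, L, .seq _ _ _ _ _ _ _ hS h1, h3, h4, h5, by omega⟩

end Potential

end AOF

theorem mainTheorem1 :
    -- every run of the algorithm enumerates the optimal integer flows, each exactly once
    (∀ (n m : ℕ) (N : AOF.Network n m) (f : Fin m → ℤ) (y : Fin n → ℝ),
      N.Admissible → N.IsOptInt f → N.IsOptPotential y →
      ∀ L : List (Fin m → ℤ), AOF.FindAllOptimalFlows (N.reducedCost y) N f L →
        (f :: L).Nodup ∧ ∀ g : Fin m → ℤ, g ∈ f :: L ↔ N.IsOptInt g) ∧
    -- given `f` and the reduced costs, the algorithm takes `O(F(m+n))` time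
    (∃ (P : AOF.Prog) (K : ℕ),
      ∀ (n m : ℕ) (N : AOF.Network n m) (f : Fin m → ℤ) (y : Fin n → ℝ),
        N.Admissible → N.IsOptInt f → N.IsOptPotential y →
        ∃ (σ : AOF.State) (t : ℕ) (L : List (Fin m → ℤ)),
          AOF.Exec (N.encodeWith f (N.reducedCost y)) P AOF.State.init σ t ∧
          AOF.FindAllOptimalFlows (N.reducedCost y) N f L ∧
          σ.out = AOF.printed (f :: L) ∧
          t ≤ K * (N.numOpt * (m + n))) ∧
    -- run after any program `S` that finds an optimal integer flow in `M` steps, the computation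
    -- of the potential and the algorithm give `O(F(m+n) + mn + M)` time overall
    (∃ (R : AOF.Prog) (K : ℕ),
      ∀ (S : AOF.Prog) (n m : ℕ) (N : AOF.Network n m) (f : Fin m → ℤ) (τ : AOF.State) (M : ℕ),
        N.Admissible → N.IsOptInt f →
        AOF.Exec N.encode S AOF.State.init τ M →
        (∀ a : Fin m, τ.arr 0 ((a : ℕ) : ℤ) = f a) → τ.out = [] →
        ∃ (σ : AOF.State) (t : ℕ) (y : Fin n → ℝ) (L : List (Fin m → ℤ)),
          AOF.Exec N.encode (AOF.Prog.seq S R) AOF.State.init σ t ∧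
          N.IsOptPotential y ∧
          AOF.FindAllOptimalFlows (N.reducedCost y) N f L ∧
          σ.out = AOF.printed (f :: L) ∧
          t ≤ K * (N.numOpt * (m + n) + m * n + M)) := by
  refine ⟨fun n m N f y hN hf hy L hL => ?_, AOF.exists_program_of_reducedCosts,
    AOF.exists_program_of_flow⟩
  have h := hL.enumerates hN.isSimple hf.intFlow
  exact ⟨h.1, fun g => (h.2 g).trans (AOF.Network.isOptInt_iff hy hf g).symm⟩
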